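/- Consider the equations $$u_t+\varepsilon(u^m)_x+f(t)(u^n)_{xxx}=0,\qquad (*)$$ where $\varepsilon=\pm1$, $n,m$ are real constants with $n\neq0,1$ and $m\neq1$, and $f$ is a smooth nonvanishing real function on an open interval $I$; $t\in I$, $x$ ranges over an open interval, and $u$ over an open interval of positive numbers. The maximal Lie invariance algebra $A^{\max}$ of $(*)$ is the space of smooth vector fields $\tau(t,x,u)\partial_t+\xi(t,x,u)\partial_x+\eta(t,x,u)\partial_u$ on this domain whose third prolongation annihilates the left-hand side of $(*)$ at all jets satisfying $(*)$. For $m\neq0$, two equations $(*)$ are called equivalent if they are related by a transformation of the group $G^\sim$: $$\tilde t=\pm\delta_1\delta_3^{1-m}t+\delta_0,\quad \tilde x=\delta_1x+\delta_2,\quad \tilde u=\delta_3u,\quad \tilde f=\pm\delta_1^2\delta_3^{m-n}f,\quad \tilde\varepsilon=\pm\varepsilon,\quad \tilde n=n,\quad \tilde m=m$$ (the same sign throughout). For $m=0$, they are called equivalent if they are related by a transformation of the group $G^\sim_{(n,0)}$: $$\tilde t=T(t),\quad \tilde x=\delta_1x+\delta_2,\quad \tilde u=\delta_3u,\quad \tilde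 f=\frac{\delta_1^3\delta_3^{1-n}}{T_t}f,\quad \tilde n=n,\quad \tilde m=m=0,$$ with $T$ smooth and $T_t\neq0$. Here the $\delta_j$ are real constants with $\delta_1\neq0$, $\delta_3>0$. 1. The kernel algebra, i.e. the intersection of the algebras $A^{\max}$ of all equations $(*)$ (on a given domain), is $\langle\partial_x\rangle$. For fixed $n,m,\varepsilon$ with $m\neq0$ the intersection of the $A^{\max}$ over all $f$ has the basis - (Case 1) $\partial_x$, if $m\neq\frac{n+2}3$; - (Case 2) $\partial_x,\ x\partial_x+\frac3{n-1}u\partial_u$, if $m=\frac{n+2}3$. 2. For $m\neq0$, $A^{\max}$ is equal to the algebra of Case 1 (if $m\ne\frac{n+2}3$), respectively of Case 2 (if $m=\frac{n+2}3$), if and only if the equation is not equivalent to one of those listed below. Every equation with $m=0$ is equivalent to one of those listed in Cases 3 and 4. 3. In the following cases $A^{\max}$ has the indicated basis: - (Case 3) $n\neq-\frac12$, $m=0$, $f=1$: $\partial_t,\ \partial_x,\ x\partial_x+\frac3{n-1}u\partial_u,\ 3t\partial_t+x\partial_x$; - (Case 4) $n=-\frac12$, $m=0$, $f=1$: $\partial_t,\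 \partial_x,\ x\partial_x-2u\partial_u,\ 3t\partial_t+x\partial_x,\ x^2\partial_x-4xu\partial_u$; - (Case 5) $m\neq0$, $(n,m)\neq(-\frac12,-\frac12)$, $f=1$: $\partial_t,\ \partial_x,\ (3m-n-2)t\partial_t+(m-n)x\partial_x-2u\partial_u$; - (Case $6_a$) $n=m=-\frac12$, $\varepsilon=1$, $f=1$: $\partial_t,\ \partial_x,\ 3t\partial_t+2u\partial_u,\ \sin x\,\partial_x-2\cos x\,u\partial_u,\ \cos x\,\partial_x+2\sin x\,u\partial_u$; - (Case $6_b$) $n=m=-\frac12$, $\varepsilon=-1$, $f=1$: $\partial_t,\ \partial_x,\ 3t\partial_t+2u\partial_u,\ e^x\partial_x-2e^xu\partial_u,\ e^{-x}\partial_x+2e^{-x}u\partial_u$; - (Case 7) $m\neq0,\frac{n+2}3$, $f=t^k$ with $t>0$, $k\neq0$: $\partial_x,\ (3m-n-2)t\partial_t+(km-k+m-n)x\partial_x+(k-2)u\partial_u$; - (Case 8) $m=\frac{n+2}3\neq0$, $f=\lambda t^2$ with $t>0$, $\lambda>0$: $\partial_x,\ x\partial_x+\frac3{n-1}u\partial_u,\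 t\partial_t+x\partial_x$; - (Case 9) $m\neq0,\frac{n+2}3$, $f=e^t$: $\partial_x,\ (3m-n-2)\partial_t+(m-1)x\partial_x+u\partial_u$. 4. Cases 3–9 are pairwise inequivalent, including the values of the parameter $k$ in Case 7 and of $\lambda$ in Case 8. -/

import Mathlib

open Set
open scoped ContDiff

noncomputable section

namespace KMN

/-- Points `(t, x, u)` of the space of independent and dependent variables. -/
abbrev Pt : Type := ℝ × ℝ × ℝ

/-- Vector fields `τ ∂_t + ξ ∂_x + η ∂_u`, with value `(τ, ξ, η)` at `(t, x, u)`. -/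
abbrev VField : Type := Pt → Pt

/-- Infinite jets `(t, x, (u_{ij}))`, where `u_{ij}` stands for `∂_t^i ∂_x^j u`. -/
abbrev Jet : Type := ℝ × ℝ × (ℕ → ℕ → ℝ)

/-- The coordinate `u_{ij}` of a jet. -/
def Jet.d (z : Jet) (i j : ℕ) : ℝ := z.2.2 i j

/-- The underlying point `(t, x, u)` of a jet. -/
def Jet.base (z : Jet) : Pt := (z.1, z.2.1, z.2.2 0 0)

/-- The total derivative `D_t = ∂_t + ∑ u_{i+1,j} ∂_{u_{ij}}`, as the derivative along that
vector field on the jet space. -/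
def totalT (P : Jet → ℝ) (z : Jet) : ℝ :=
  lineDeriv ℝ P z (1, 0, fun i j => z.d (i + 1) j)

/-- The total derivative `D_x = ∂_x + ∑ u_{i,j+1} ∂_{u_{ij}}`. -/
def totalX (P : Jet → ℝ) (z : Jet) : ℝ :=
  lineDeriv ℝ P z (0, 1, fun i j => z.d i (j + 1))

/-- The coefficient of `∂_{u_{ij}}` in the prolongation of the vector field `V`:
`η^{(0)} = η` and `η^{J,k} = D_k η^J - u_{J,t} D_k τ - u_{J,x} D_k ξ` for `k = t, x`. -/
def prolongCoeff (V : VField) : ℕ → ℕ → Jet → ℝ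
  | 0, 0 => fun z => (V z.base).2.2
  | 0, j + 1 => fun z =>
      totalX (prolongCoeff V 0 j) z
        - z.d 1 j * totalX (fun w => (V w.base).1) z
        - z.d 0 (j + 1) * totalX (fun w => (V w.base).2.1) z
  | i + 1, j => fun z =>
      totalT (prolongCoeff V i j) z
        - z.d (i + 1) j * totalT (fun w => (V w.base).1) z
        - z.d i (j + 1) * totalT (fun w => (V w.base).2.1) z

/-- The prolonged vector field applied to a differential function `P`. If `P` has order at most
three, only the coefficients of the third prolongation enter. -/
def prolongApply (V : VField) (P : Jet → ℝ) (z : Jet) : ℝ :=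
  lineDeriv ℝ P z ((V z.base).1, (V z.base).2.1, fun i j => prolongCoeff V i j z)

/-- A nonempty open interval, bounded or not. -/
def IsOpenInterval (S : Set ℝ) : Prop := IsOpen S ∧ S.Nonempty ∧ S.OrdConnected

/-- The data of the equation `u_t + ε (u^m)_x + f(t) (u^n)_{xxx} = 0`, considered for
`t ∈ I`, `x ∈ X` and values `u ∈ U`. -/
structure Eqn where
  n : ℝ
  m : ℝ
  ε : ℝ
  f : ℝ → ℝ
  I : Set ℝ
  X : Set ℝ
  U : Set ℝ

/-- The equations under classification: `n ≠ 0, 1`, `m ≠ 1`, `ε = ± 1`, `f` smooth and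
nonvanishing, and `u` positive, as the powers with real exponents require. -/
structure Eqn.Admissible (E : Eqn) : Prop where
  n_ne_zero : E.n ≠ 0
  n_ne_one : E.n ≠ 1
  m_ne_one : E.m ≠ 1
  eps : E.ε = 1 ∨ E.ε = -1
  interval_I : IsOpenInterval E.I
  interval_X : IsOpenInterval E.X
  interval_U : IsOpenInterval E.U
  U_pos : ∀ u ∈ E.U, 0 < u
  f_smooth : ContDiffOn ℝ ∞ E.f E.I
  f_ne_zero : ∀ t ∈ E.I, E.f t ≠ 0

/-- The domain of the vector fields. -/
def Eqn.domain (E : Eqn) : Set Pt := E.I ×ˢ (E.X ×ˢ E.U)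

/-- The left-hand side of the equation, with the `x`-derivatives carried out:
`u_t + ε m u^{m-1} u_x
  + n f(t) (u^{n-1} u_{xxx} + 3(n-1) u^{n-2} u_x u_{xx} + (n-1)(n-2) u^{n-3} u_x^3)`. -/
def Eqn.lhs (E : Eqn) (z : Jet) : ℝ :=
  z.d 1 0 + E.ε * E.m * z.d 0 0 ^ (E.m - 1) * z.d 0 1
    + E.n * E.f z.1 *
      (z.d 0 0 ^ (E.n - 1) * z.d 0 3
        + 3 * (E.n - 1) * z.d 0 0 ^ (E.n - 2) * z.d 0 1 * z.d 0 2
        + (E.n - 1) * (E.n - 2) * z.d 0 0 ^ (E.n - 3) * z.d 0 1 ^ 3)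

/-- `A^max`: the smooth vector fields on the domain that satisfy the infinitesimal invariance
criterion, i.e. whose prolongation annihilates the left-hand side at all jets on the equation.
Vector fields that agree on the domain are to be identified, see `IsBasisOn`. -/
def Eqn.maxAlg (E : Eqn) : Set VField :=
  {V | ContDiffOn ℝ ∞ V E.domain ∧
    ∀ z : Jet, z.base ∈ E.domain → E.lhs z = 0 → prolongApply V E.lhs z = 0}

/-- The listed vector fields form a basis of the real vector space `A` of vector fields on `D`
(vector fields being identified when they agree on `D`). -/
def IsBasisOn (D : Set Pt) (A : Set VField) {k : ℕ} (b : Fin k → VField) : Prop :=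
  (∀ V : VField, V ∈ A ↔ ∃ c : Fin k → ℝ, EqOn V (∑ i, c i • b i) D) ∧
    ∀ c : Fin k → ℝ, EqOn (∑ i, c i • b i) 0 D → c = 0

/-- `∂_t` -/
def dt : VField := fun _ => (1, 0, 0)

/-- `∂_x` -/
def dx : VField := fun _ => (0, 1, 0)

/-- `x ∂_x + 3/(n-1) u ∂_u` -/
def scal (n : ℝ) : VField := fun p => (0, p.2.1, 3 / (n - 1) * p.2.2)

/-- The equation `E'` is the image of `E` under a transformation of the group `G^∼`,
`t' = ± δ₁ δ₃^(1-m) t + δ₀`, `x' = δ₁ x + δ₂`, `u' = δ₃ u`,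
`f' = ± δ₁² δ₃^(m-n) f`, `ε' = ± ε`, `n' = n`, `m' = m`. -/
def GEquiv (E E' : Eqn) : Prop :=
  ∃ s δ₀ δ₁ δ₂ δ₃ : ℝ, (s = 1 ∨ s = -1) ∧ δ₁ ≠ 0 ∧ 0 < δ₃ ∧
    E'.n = E.n ∧ E'.m = E.m ∧ E'.ε = s * E.ε ∧
    E'.I = (fun t => s * δ₁ * δ₃ ^ (1 - E.m) * t + δ₀) '' E.I ∧
    E'.X = (fun x => δ₁ * x + δ₂) '' E.X ∧
    E'.U = (fun u => δ₃ * u) '' E.U ∧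
    ∀ t ∈ E.I, E'.f (s * δ₁ * δ₃ ^ (1 - E.m) * t + δ₀) = s * δ₁ ^ 2 * δ₃ ^ (E.m - E.n) * E.f t

/-- The equation `E'` is the image of `E` (both with `m = 0`, where the `ε`-term is absent) under
a transformation of the group `G^∼_{(n,0)}`, `t' = T(t)`, `x' = δ₁ x + δ₂`, `u' = δ₃ u`,
`f' = (δ₁³ δ₃^(1-n) / T_t) f`, `n' = n`, with `T` smooth and `T_t ≠ 0`. -/
def GZeroEquiv (E E' : Eqn) : Prop :=
  ∃ (T : ℝ → ℝ) (δ₁ δ₂ δ₃ : ℝ), ContDiffOn ℝ ∞ T E.I ∧ (∀ t ∈ E.I, deriv T t ≠ 0) ∧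
    δ₁ ≠ 0 ∧ 0 < δ₃ ∧
    E.m = 0 ∧ E'.m = 0 ∧ E'.n = E.n ∧
    E'.I = T '' E.I ∧
    E'.X = (fun x => δ₁ * x + δ₂) '' E.X ∧
    E'.U = (fun u => δ₃ * u) '' E.U ∧
    ∀ t ∈ E.I, E'.f (T t) = δ₁ ^ 3 * δ₃ ^ (1 - E.n) / deriv T t * E.f t

/-- The equivalence used in the classification: `G^∼` if `m ≠ 0`, `G^∼_{(n,0)}` if `m = 0`. -/
def Equivalent (E E' : Eqn) : Prop :=
  (E.m ≠ 0 ∧ GEquiv E E') ∨ (E.m = 0 ∧ GZeroEquiv E E')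

/-- The cases of Lie symmetry extension in the classification list, with their parameters. -/
inductive ExtCase : Type
  | c3
  | c4
  | c5
  | c6a
  | c6b
  | c7 (k : ℝ)
  | c8 (lam : ℝ)
  | c9

/-- The equation `E` is literally of the form listed in the given case. -/
def ExtCase.Holds : ExtCase → Eqn → Prop
  | .c3, E => E.n ≠ -1 / 2 ∧ E.m = 0 ∧ ∀ t ∈ E.I, E.f t = 1
  | .c4, E => E.n = -1 / 2 ∧ E.m = 0 ∧ ∀ t ∈ E.I, E.f t = 1
  | .c5, E => E.m ≠ 0 ∧ ¬(E.n = -1 / 2 ∧ E.m = -1 / 2) ∧ ∀ t ∈ E.I, E.f t = 1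
  | .c6a, E => E.n = -1 / 2 ∧ E.m = -1 / 2 ∧ E.ε = 1 ∧ ∀ t ∈ E.I, E.f t = 1
  | .c6b, E => E.n = -1 / 2 ∧ E.m = -1 / 2 ∧ E.ε = -1 ∧ ∀ t ∈ E.I, E.f t = 1
  | .c7 k, E => E.m ≠ 0 ∧ E.m ≠ (E.n + 2) / 3 ∧ k ≠ 0 ∧ ∀ t ∈ E.I, 0 < t ∧ E.f t = t ^ k
  | .c8 lam, E => E.m ≠ 0 ∧ E.m = (E.n + 2) / 3 ∧ 0 < lam ∧
      ∀ t ∈ E.I, 0 < t ∧ E.f t = lam * t ^ 2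
  | .c9, E => E.m ≠ 0 ∧ E.m ≠ (E.n + 2) / 3 ∧ ∀ t ∈ E.I, E.f t = Real.exp t

/-- The number of basis operators listed in the given case. -/
def ExtCase.dim : ExtCase → ℕ
  | .c3 => 4
  | .c4 => 5
  | .c5 => 3
  | .c6a => 5
  | .c6b => 5
  | .c7 _ => 2
  | .c8 _ => 3
  | .c9 => 2

/-- The basis operators listed in the given case. -/
def ExtCase.basis (n m : ℝ) : (c : ExtCase) → Fin c.dim → VField
  | .c3 => ![dt, dx, scal n, fun p => (3 * p.1, p.2.1, 0)]
  | .c4 => ![dt, dx, fun p => (0, p.2.1, -2 * p.2.2), fun p => (3 * p.1, p.2.1, 0),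
      fun p => (0, p.2.1 ^ 2, -4 * p.2.1 * p.2.2)]
  | .c5 => ![dt, dx, fun p => ((3 * m - n - 2) * p.1, (m - n) * p.2.1, -2 * p.2.2)]
  | .c6a => ![dt, dx, fun p => (3 * p.1, 0, 2 * p.2.2),
      fun p => (0, Real.sin p.2.1, -2 * Real.cos p.2.1 * p.2.2),
      fun p => (0, Real.cos p.2.1, 2 * Real.sin p.2.1 * p.2.2)]
  | .c6b => ![dt, dx, fun p => (3 * p.1, 0, 2 * p.2.2),
      fun p => (0, Real.exp p.2.1, -2 * Real.exp p.2.1 * p.2.2),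
      fun p => (0, Real.exp (-p.2.1), 2 * Real.exp (-p.2.1) * p.2.2)]
  | .c7 k => ![dx, fun p =>
      ((3 * m - n - 2) * p.1, (k * m - k + m - n) * p.2.1, (k - 2) * p.2.2)]
  | .c8 _ => ![dx, scal n, fun p => (p.1, p.2.1, 0)]
  | .c9 => ![dx, fun p => (3 * m - n - 2, (m - 1) * p.2.1, p.2.2)]

/-- `E` is equivalent to an equation of the form listed in the given case. -/
def Eqn.ReducesTo (E : Eqn) (c : ExtCase) : Prop :=
  ∃ E' : Eqn, E'.Admissible ∧ Equivalent E E' ∧ c.Holds E'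

end KMN

end

/-!
The proof determines `A^max` completely from the infinitesimal invariance criterion and then
solves a classification problem for `f` alone.

**The criterion.** For a smooth field `τ ∂_t + ξ ∂_x + η ∂_u` the prolongation is written out as
`η^{xxx} = D_x³η - 3u_{txx} D_xτ - 3u_{tx} D_x²τ - u_t D_x³τ - 3u_{xxx} D_xξ - 3u_{xx} D_x²ξ - u_x
D_x³ξ`, and similarly for lower orders, where `D_x, D_x², D_x³` of a function of `(t, x, u)` are
the explicit expressions `D1`, `D2`, `D3`. On the equation `u_t` is eliminated and all other jet
coordinates are free, so the criterion is a polynomial identity. Its coefficients give `τ = τ(t)`,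
`ξ = ξ(t, x)`; because `n ≠ 1`, the coefficient of `u_{xxx}` then forces `η = h(t, x) u`
(`homU_of_det3`, `Eqn.mem_maxAlg_iff`). The remaining equations contain `u` only through `1,
u^(m-1), u^(n-1)` and split, because these are linearly independent, up to the coincidence `m = n`
(`splitEqs_of_mem`).

**The case `m ≠ 0`.** The split equations give `h_x = 0`, unless `n = m = -1/2` and `f` is
constant. Hence `ξ` is affine in `x`, `h` is constant, `τ = p t + d`, and all that is left of the
system is `(p t + d) f' = (2p + (3m - n - 2) c) f`, where `h = c` (`mem_maxAlg_iff_linField`). For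
`f = e^t` and `f = e^{2t}` together this leaves only `p = d = (3m - n - 2) c = 0`, which yields
the kernel algebras. A symmetry beyond these exists exactly if `f` solves a nontrivial equation
`(p t + d) f' = q f` (`Extends`). The nonvanishing solutions on an interval are constants,
exponentials and powers of `|t + b|`, and `G^∼` normalises them to the listed forms
(`extends_iff`); for `m = (n+2)/3` only the constants and the square `k = 2` are possible, and
then the factor `λ` cannot be scaled away.

**The exceptional cases.** For `m = 0` the change `t' = ∫ f dt` makes `f = 1`, and `ξ` is a
polynomial of degree at most two in `x`, of degree two only for `n = -1/2`. For `n = m = -1/2`, `f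
= 1` one gets `ξ_{xx} + ε ξ = const`, whence the trigonometric and exponential operators.

**Inequivalence.** Logarithmic derivatives of `f` transform by affine substitutions of `t`, so the
type of the equation `(t + b) f' = k f`, `f' = μ f` or `f' = 0` and the exponent `k` are
invariants. The sign of `ε f` separates the two cases with `n = m = -1/2`, and the leading
coefficient of `f` up to sign gives `λ` (`ExtCase.Invariant`, `eq_of_invariant`).
-/

noncomputable section

namespace KMN

/-! ### Partial derivatives on an open set -/

/-- The derivative of `F` along the constant vector field `v`. -/
def pd (v : Pt) (F : Pt → ℝ) (p : Pt) : ℝ := fderiv ℝ F p v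

/-- The coordinate direction of `t`. -/
def eT : Pt := (1, 0, 0)

/-- The coordinate direction of `x`. -/
def eX : Pt := (0, 1, 0)

/-- The coordinate direction of `u`. -/
def eU : Pt := (0, 0, 1)

lemma pt_eq_sum (v : Pt) : v = v.1 • eT + v.2.1 • eX + v.2.2 • eU := by
  ext <;> simp [eT, eX, eU]

variable {D : Set Pt}

lemma contDiffOn_pd (hD : IsOpen D) {F : Pt → ℝ} (hF : ContDiffOn ℝ ∞ F D) (v : Pt) :
    ContDiffOn ℝ ∞ (pd v F) D :=
  (hF.fderiv_of_isOpen hD (m := ∞) (by simp)).clm_apply contDiffOn_const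

lemma hasFDerivAt_of_contDiffOn (hD : IsOpen D) {F : Pt → ℝ} (hF : ContDiffOn ℝ ∞ F D) {p : Pt}
    (hp : p ∈ D) : HasFDerivAt F (fderiv ℝ F p) p :=
  ((hF.contDiffAt (hD.mem_nhds hp)).differentiableAt (by simp)).hasFDerivAt

lemma pd_congr (hD : IsOpen D) {F G : Pt → ℝ} (h : EqOn F G D) (v : Pt) :
    EqOn (pd v F) (pd v G) D := fun p hp => by
  have : F =ᶠ[nhds p] G := h.eventuallyEq_of_mem (hD.mem_nhds hp)
  simp [pd, this.fderiv_eq]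

lemma pd_comm (hD : IsOpen D) {F : Pt → ℝ} (hF : ContDiffOn ℝ ∞ F D) (v w : Pt) :
    EqOn (pd v (pd w F)) (pd w (pd v F)) D := fun p hp => by
  have hc := hF.contDiffAt (hD.mem_nhds hp)
  have hs : IsSymmSndFDerivAt ℝ F p := hc.isSymmSndFDerivAt (by
    rw [minSmoothness_of_isRCLikeNormedField]; exact WithTop.coe_le_coe.2 (le_top : (2 : ℕ∞) ≤ ⊤))
  have hd : DifferentiableAt ℝ (fderiv ℝ F) p :=
    (hc.fderiv_right (m := ∞) (by simp)).differentiableAt (by simp)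
  have key : ∀ a b : Pt, pd a (pd b F) p = fderiv ℝ (fderiv ℝ F) p a b := fun a b => by
    have h2 := hd.hasFDerivAt.clm_apply (hasFDerivAt_const b p)
    have h3 : fderiv ℝ (pd b F) p = _ := h2.fderiv
    simp only [pd] at h3 ⊢
    simp [h3]
  rw [key, key]
  exact hs v w

lemma eqOn_const_of_pd_eq_zero (hD : IsOpen D) (hc : IsPreconnected D) {F : Pt → ℝ}
    (hF : ContDiffOn ℝ ∞ F D) (ht : EqOn (pd eT F) 0 D) (hx : EqOn (pd eX F) 0 D)
    (hu : EqOn (pd eU F) 0 D) : ∃ c : ℝ, EqOn F (fun _ => c) D := by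
  refine hD.exists_is_const_of_fderiv_eq_zero hc (hF.differentiableOn (by simp)) fun p hp => ?_
  ext
  all_goals
    simpa [pd, eT, eX, eU] using (by first | exact ht hp | exact hx hp | exact hu hp)

/-! ### Derivatives along lines in the jet space -/

lemma Jet.d_add_smul (z v : Jet) (s : ℝ) (i j : ℕ) :
    (z + s • v).d i j = z.d i j + s * v.d i j := by
  simp [Jet.d]

lemma Jet.base_add_smul (z v : Jet) (s : ℝ) : (z + s • v).base = z.base + s • v.base := by
  simp [Jet.base]

lemma Jet.hasDerivAt_d (z v : Jet) (i j : ℕ) :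
    HasDerivAt (fun s : ℝ => (z + s • v).d i j) (v.d i j) 0 := by
  simp only [Jet.d_add_smul]
  simpa using ((hasDerivAt_id (0 : ℝ)).mul_const (v.d i j)).const_add (z.d i j)

lemma Jet.hasDerivAt_base (z v : Jet) :
    HasDerivAt (fun s : ℝ => (z + s • v).base) v.base 0 := by
  simp only [Jet.base_add_smul]
  simpa using ((hasDerivAt_id (0 : ℝ)).smul_const v.base).const_add z.base

lemma Jet.hasDerivAt_comp_base (hD : IsOpen D) {F : Pt → ℝ} (hF : ContDiffOn ℝ ∞ F D) {z : Jet}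
    (hz : z.base ∈ D) (v : Jet) :
    HasDerivAt (fun s : ℝ => F (z + s • v).base) (pd v.base F z.base) 0 := by
  have h1 := Jet.hasDerivAt_base z v
  have h2 := hasFDerivAt_of_contDiffOn hD hF hz
  have e : (z + (0 : ℝ) • v).base = z.base := by simp
  rw [← e] at h2
  have := h2.comp_hasDerivAt (0 : ℝ) h1
  rw [e] at this
  exact this

lemma pd_eq_sum (v : Pt) (F : Pt → ℝ) (p : Pt) :
    pd v F p = v.1 * pd eT F p + v.2.1 * pd eX F p + v.2.2 * pd eU F p := by
  simp only [pd]
  conv_lhs => rw [pt_eq_sum v]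
  simp only [map_add, map_smul, smul_eq_mul]

/-- The domain restricts only the base point, and along a line in the jet space the base point stays
in `D` for small parameters. No topology on the jet space is involved. -/
lemma lineDeriv_congr_of_base (hD : IsOpen D) {P Q : Jet → ℝ}
    (h : ∀ z : Jet, z.base ∈ D → P z = Q z) {z : Jet} (hz : z.base ∈ D) (v : Jet) :
    lineDeriv ℝ P z v = lineDeriv ℝ Q z v := by
  have hc : ContinuousAt (fun s : ℝ => (z + s • v).base) 0 := (Jet.hasDerivAt_base z v).continuousAt
  have : ∀ᶠ s in nhds (0 : ℝ), (z + s • v).base ∈ D := hc (hD.mem_nhds (by simpa using hz))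
  exact Filter.EventuallyEq.deriv_eq (this.mono fun s hs => h _ hs)

/-- The direction of the total derivative `D_x` at a jet. -/
def Jet.tanX (z : Jet) : Jet := (0, 1, fun i j => z.d i (j + 1))

/-- The direction of the total derivative `D_t` at a jet. -/
def Jet.tanT (z : Jet) : Jet := (1, 0, fun i j => z.d (i + 1) j)

/-! ### Total derivatives of functions of the base point -/

/-- `D_x F` at the point `p`, where `a` stands for `u_x`. -/
def D1 (F : Pt → ℝ) (p : Pt) (a : ℝ) : ℝ := pd eX F p + a * pd eU F p

/-- `D_x² F` at the point `p`, where `a, b` stand for `u_x, u_{xx}`. -/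
def D2 (F : Pt → ℝ) (p : Pt) (a b : ℝ) : ℝ :=
  D1 (pd eX F) p a + a * D1 (pd eU F) p a + b * pd eU F p

/-- `D_x³ F` at the point `p`, where `a, b, c` stand for `u_x, u_{xx}, u_{xxx}`. -/
def D3 (F : Pt → ℝ) (p : Pt) (a b c : ℝ) : ℝ :=
  D2 (pd eX F) p a b + a * D2 (pd eU F) p a b + 2 * b * D1 (pd eU F) p a + c * pd eU F p

section
variable {F : Pt → ℝ} {z : Jet}

lemma hasDerivAt_tanX (hD : IsOpen D) (hF : ContDiffOn ℝ ∞ F D) (hz : z.base ∈ D) :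
    HasDerivAt (fun s : ℝ => F (z + s • z.tanX).base) (D1 F z.base (z.d 0 1)) 0 := by
  refine (Jet.hasDerivAt_comp_base hD hF hz z.tanX).congr_deriv ?_
  rw [pd_eq_sum z.tanX.base]
  simp [D1, Jet.tanX, Jet.base, Jet.d]

lemma hasDerivAt_tanT (hD : IsOpen D) (hF : ContDiffOn ℝ ∞ F D) (hz : z.base ∈ D) :
    HasDerivAt (fun s : ℝ => F (z + s • z.tanT).base)
      (pd eT F z.base + z.d 1 0 * pd eU F z.base) 0 := by
  refine (Jet.hasDerivAt_comp_base hD hF hz z.tanT).congr_deriv ?_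
  rw [pd_eq_sum z.tanT.base]
  simp [Jet.tanT, Jet.base, Jet.d]

lemma hasDerivAt_d_tanX (z : Jet) (i j : ℕ) :
    HasDerivAt (fun s : ℝ => (z + s • z.tanX).d i j) (z.d i (j + 1)) 0 :=
  Jet.hasDerivAt_d z z.tanX i j

lemma hasDerivAt_D1_tanX (hD : IsOpen D) (hF : ContDiffOn ℝ ∞ F D) (hz : z.base ∈ D) :
    HasDerivAt (fun s : ℝ => D1 F (z + s • z.tanX).base ((z + s • z.tanX).d 0 1))
      (D2 F z.base (z.d 0 1) (z.d 0 2)) 0 := by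
  have h := (hasDerivAt_tanX hD (contDiffOn_pd hD hF eX) hz).add
    ((hasDerivAt_d_tanX z 0 1).mul (hasDerivAt_tanX hD (contDiffOn_pd hD hF eU) hz))
  refine h.congr_deriv ?_
  simp only [D2, zero_smul, add_zero]
  ring

lemma hasDerivAt_D2_tanX (hD : IsOpen D) (hF : ContDiffOn ℝ ∞ F D) (hz : z.base ∈ D) :
    HasDerivAt (fun s : ℝ => D2 F (z + s • z.tanX).base ((z + s • z.tanX).d 0 1)
        ((z + s • z.tanX).d 0 2))
      (D3 F z.base (z.d 0 1) (z.d 0 2) (z.d 0 3)) 0 := by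
  have hFU := contDiffOn_pd hD hF eU
  have h := ((hasDerivAt_D1_tanX hD (contDiffOn_pd hD hF eX) hz).add
    ((hasDerivAt_d_tanX z 0 1).mul (hasDerivAt_D1_tanX hD hFU hz))).add
    ((hasDerivAt_d_tanX z 0 2).mul (hasDerivAt_tanX hD hFU hz))
  refine h.congr_deriv ?_
  simp only [D3, zero_smul, add_zero]
  ring

end

/-! ### The prolongation in coordinates -/

/-- The component `τ`. -/
def cT (V : VField) (p : Pt) : ℝ := (V p).1

/-- The component `ξ`. -/
def cX (V : VField) (p : Pt) : ℝ := (V p).2.1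

/-- The component `η`. -/
def cU (V : VField) (p : Pt) : ℝ := (V p).2.2

lemma contDiffOn_vField_iff {V : VField} : ContDiffOn ℝ ∞ V D ↔
    ContDiffOn ℝ ∞ (cT V) D ∧ ContDiffOn ℝ ∞ (cX V) D ∧ ContDiffOn ℝ ∞ (cU V) D :=
  ⟨fun h => ⟨h.fst, h.snd.fst, h.snd.snd⟩, fun h => h.1.prodMk (h.2.1.prodMk h.2.2)⟩

section
variable {V : VField}

lemma prolongCoeff_one_zero (hD : IsOpen D) (hV : ContDiffOn ℝ ∞ V D) {z : Jet}
    (hz : z.base ∈ D) :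
    prolongCoeff V 1 0 z = pd eT (cU V) z.base + z.d 1 0 * pd eU (cU V) z.base
      - z.d 1 0 * (pd eT (cT V) z.base + z.d 1 0 * pd eU (cT V) z.base)
      - z.d 0 1 * (pd eT (cX V) z.base + z.d 1 0 * pd eU (cX V) z.base) := by
  obtain ⟨h1, h2, h3⟩ := contDiffOn_vField_iff.1 hV
  have e1 : totalT (fun w => (V w.base).1) z = _ := (hasDerivAt_tanT hD h1 hz).deriv
  have e2 : totalT (fun w => (V w.base).2.1) z = _ := (hasDerivAt_tanT hD h2 hz).deriv
  have e3 : totalT (prolongCoeff V 0 0) z = _ :=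
    (by rw [prolongCoeff]; rfl :
      totalT (prolongCoeff V 0 0) z = totalT (fun w => cU V w.base) z).trans
      (hasDerivAt_tanT hD h3 hz).deriv
  simp only [prolongCoeff] at e3 ⊢
  rw [e1, e2, e3]

lemma prolongCoeff_zero_one (hD : IsOpen D) (hV : ContDiffOn ℝ ∞ V D) {z : Jet}
    (hz : z.base ∈ D) :
    prolongCoeff V 0 1 z = D1 (cU V) z.base (z.d 0 1)
      - z.d 1 0 * D1 (cT V) z.base (z.d 0 1) - z.d 0 1 * D1 (cX V) z.base (z.d 0 1) := by
  obtain ⟨h1, h2, h3⟩ := contDiffOn_vField_iff.1 hV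
  have e1 : totalX (fun w => (V w.base).1) z = _ := (hasDerivAt_tanX hD h1 hz).deriv
  have e2 : totalX (fun w => (V w.base).2.1) z = _ := (hasDerivAt_tanX hD h2 hz).deriv
  have e3 : totalX (prolongCoeff V 0 0) z = _ :=
    (by rw [prolongCoeff]; rfl :
      totalX (prolongCoeff V 0 0) z = totalX (fun w => cU V w.base) z).trans
      (hasDerivAt_tanX hD h3 hz).deriv
  simp only [prolongCoeff, zero_add] at e3 ⊢
  rw [e1, e2, e3]

/-- Here and for the third order, the terms with `u_{xx}` and `u_{tx}` in the recursion combine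
with those from `D_x` of the previous coefficient, as in the Leibniz rule for
`D_x²(η - u_t τ - u_x ξ)`. -/
lemma prolongCoeff_zero_two (hD : IsOpen D) (hV : ContDiffOn ℝ ∞ V D) {z : Jet}
    (hz : z.base ∈ D) :
    prolongCoeff V 0 2 z = D2 (cU V) z.base (z.d 0 1) (z.d 0 2)
      - 2 * z.d 1 1 * D1 (cT V) z.base (z.d 0 1)
      - z.d 1 0 * D2 (cT V) z.base (z.d 0 1) (z.d 0 2)
      - 2 * z.d 0 2 * D1 (cX V) z.base (z.d 0 1)
      - z.d 0 1 * D2 (cX V) z.base (z.d 0 1) (z.d 0 2) := by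
  obtain ⟨h1, h2, h3⟩ := contDiffOn_vField_iff.1 hV
  have e1 : totalX (fun w => (V w.base).1) z = _ := (hasDerivAt_tanX hD h1 hz).deriv
  have e2 : totalX (fun w => (V w.base).2.1) z = _ := (hasDerivAt_tanX hD h2 hz).deriv
  have e3 : totalX (prolongCoeff V 0 1) z = _ :=
    (lineDeriv_congr_of_base hD (fun w hw => prolongCoeff_zero_one hD hV hw) hz _).trans
      (((hasDerivAt_D1_tanX hD h3 hz).sub
        ((hasDerivAt_d_tanX z 1 0).mul (hasDerivAt_D1_tanX hD h1 hz))).sub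
        ((hasDerivAt_d_tanX z 0 1).mul (hasDerivAt_D1_tanX hD h2 hz))).deriv
  rw [prolongCoeff]
  beta_reduce
  rw [e1, e2, e3]
  simp only [zero_smul, add_zero, Nat.reduceAdd]
  ring

lemma prolongCoeff_zero_three (hD : IsOpen D) (hV : ContDiffOn ℝ ∞ V D) {z : Jet}
    (hz : z.base ∈ D) :
    prolongCoeff V 0 3 z = D3 (cU V) z.base (z.d 0 1) (z.d 0 2) (z.d 0 3)
      - 3 * z.d 1 2 * D1 (cT V) z.base (z.d 0 1)
      - 3 * z.d 1 1 * D2 (cT V) z.base (z.d 0 1) (z.d 0 2)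
      - z.d 1 0 * D3 (cT V) z.base (z.d 0 1) (z.d 0 2) (z.d 0 3)
      - 3 * z.d 0 3 * D1 (cX V) z.base (z.d 0 1)
      - 3 * z.d 0 2 * D2 (cX V) z.base (z.d 0 1) (z.d 0 2)
      - z.d 0 1 * D3 (cX V) z.base (z.d 0 1) (z.d 0 2) (z.d 0 3) := by
  obtain ⟨h1, h2, h3⟩ := contDiffOn_vField_iff.1 hV
  have e1 : totalX (fun w => (V w.base).1) z = _ := (hasDerivAt_tanX hD h1 hz).deriv
  have e2 : totalX (fun w => (V w.base).2.1) z = _ := (hasDerivAt_tanX hD h2 hz).deriv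
  have e3 : totalX (prolongCoeff V 0 2) z = _ :=
    (lineDeriv_congr_of_base hD (fun w hw => prolongCoeff_zero_two hD hV hw) hz _).trans
      (((((hasDerivAt_D2_tanX hD h3 hz).sub
        (((hasDerivAt_d_tanX z 1 1).const_mul 2).mul (hasDerivAt_D1_tanX hD h1 hz))).sub
        ((hasDerivAt_d_tanX z 1 0).mul (hasDerivAt_D2_tanX hD h1 hz))).sub
        (((hasDerivAt_d_tanX z 0 2).const_mul 2).mul (hasDerivAt_D1_tanX hD h2 hz))).sub
        ((hasDerivAt_d_tanX z 0 1).mul (hasDerivAt_D2_tanX hD h2 hz))).deriv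
  rw [prolongCoeff]
  beta_reduce
  rw [e1, e2, e3]
  simp only [zero_smul, add_zero, Nat.reduceAdd]
  ring

end

lemma Eqn.Admissible.isOpen_domain {E : Eqn} (hE : E.Admissible) : IsOpen E.domain :=
  hE.interval_I.1.prod (hE.interval_X.1.prod hE.interval_U.1)

/-- The left-hand side of the equation with all powers of `u` expressed through `u^(m-1)` and
`u^(n-1)`, which is legitimate for `u > 0`; the arguments `a, b, c` stand
for `u_x, u_{xx}, u_{xxx}` and `y` for `u_t`. -/
def Eqn.lhsAt (E : Eqn) (p : Pt) (a b c y : ℝ) : ℝ :=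
  y + E.ε * E.m * p.2.2 ^ (E.m - 1) * a + E.n * E.f p.1 * p.2.2 ^ (E.n - 1) *
    (c + 3 * (E.n - 1) * a * b / p.2.2 + (E.n - 1) * (E.n - 2) * a ^ 3 / p.2.2 ^ 2)

/-- The prolonged field applied to the left-hand side of the equation. The arguments
`a, b, c, y` are as in `Eqn.lhsAt`, and `e₁, e₂, e₃, eₜ` are the coefficients of
`∂_{u_x}, ∂_{u_{xx}}, ∂_{u_{xxx}}, ∂_{u_t}`. -/
def Eqn.prolongAt (E : Eqn) (p : Pt) (τ η a b c e₁ e₂ e₃ eₜ : ℝ) : ℝ :=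
  eₜ + E.ε * E.m * p.2.2 ^ (E.m - 1) * ((E.m - 1) * η / p.2.2 * a + e₁)
    + E.n * deriv E.f p.1 * τ * p.2.2 ^ (E.n - 1) *
      (c + 3 * (E.n - 1) * a * b / p.2.2 + (E.n - 1) * (E.n - 2) * a ^ 3 / p.2.2 ^ 2)
    + E.n * E.f p.1 * p.2.2 ^ (E.n - 1) *
      ((E.n - 1) * η / p.2.2 * c + e₃
        + 3 * (E.n - 1) * ((E.n - 2) * η / p.2.2 ^ 2 * a * b + (e₁ * b + a * e₂) / p.2.2)
        + (E.n - 1) * (E.n - 2) *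
          ((E.n - 3) * η / p.2.2 ^ 3 * a ^ 3 + 3 * a ^ 2 * e₁ / p.2.2 ^ 2))

lemma rpow_pred {u : ℝ} (hu : 0 < u) (r s : ℝ) (h : s = r - 1) : u ^ s = u ^ r / u := by
  rw [h, Real.rpow_sub_one hu.ne']

lemma Eqn.lhs_eq (E : Eqn) {z : Jet} (hz : 0 < z.base.2.2) :
    E.lhs z = E.lhsAt z.base (z.d 0 1) (z.d 0 2) (z.d 0 3) (z.d 1 0) := by
  have hu : 0 < z.d 0 0 := hz
  have e1 := rpow_pred hu (E.n - 1) (E.n - 2) (by ring)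
  have e2 := rpow_pred hu (E.n - 2) (E.n - 3) (by ring)
  have hb : z.base.2.2 = z.d 0 0 := rfl
  have hb1 : z.base.1 = z.1 := rfl
  rw [Eqn.lhs, Eqn.lhsAt, e2, e1, hb, hb1]
  field_simp

lemma Eqn.Admissible.hasDerivAt_f {E : Eqn} (hE : E.Admissible) {t : ℝ} (ht : t ∈ E.I) :
    HasDerivAt E.f (deriv E.f t) t :=
  ((hE.f_smooth.contDiffAt (hE.interval_I.1.mem_nhds ht)).differentiableAt (by simp)).hasDerivAt

lemma Eqn.prolongApply_eq {E : Eqn} (hE : E.Admissible) (V : VField) {z : Jet}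
    (hz : z.base ∈ E.domain) :
    prolongApply V E.lhs z = E.prolongAt z.base (cT V z.base) (cU V z.base)
      (z.d 0 1) (z.d 0 2) (z.d 0 3) (prolongCoeff V 0 1 z) (prolongCoeff V 0 2 z)
      (prolongCoeff V 0 3 z) (prolongCoeff V 1 0 z) := by
  have hu : 0 < z.d 0 0 := hE.U_pos _ hz.2.2
  set v : Jet := ((V z.base).1, (V z.base).2.1, fun i j => prolongCoeff V i j z) with hv
  have hd : ∀ i j, HasDerivAt (fun s : ℝ => (z + s • v).d i j) (prolongCoeff V i j z) 0 :=
    fun i j => Jet.hasDerivAt_d z v i j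
  have h0 : HasDerivAt (fun s : ℝ => (z + s • v).d 0 0) (cU V z.base) 0 := by
    have := hd 0 0
    rwa [prolongCoeff] at this
  have hne : (z + (0 : ℝ) • v).d 0 0 ≠ 0 := by simpa using hu.ne'
  have hp : ∀ r : ℝ, HasDerivAt (fun s : ℝ => (z + s • v).d 0 0 ^ r)
      (cU V z.base * r * z.d 0 0 ^ (r - 1)) 0 := fun r => by
    simpa using h0.rpow_const (p := r) (Or.inl hne)
  have hf : HasDerivAt (fun s : ℝ => E.f (z + s • v).1) (deriv E.f z.1 * cT V z.base) 0 := by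
    have h1 : HasDerivAt (fun s : ℝ => (z + s • v).1) (cT V z.base) 0 :=
      by
      simpa [hv, cT] using ((hasDerivAt_id (0 : ℝ)).mul_const v.1).const_add z.1
    have h2 := hE.hasDerivAt_f (t := (z + (0 : ℝ) • v).1)
      (by simpa using (show z.1 ∈ E.I from hz.1))
    have h3 := h2.comp (0 : ℝ) h1
    rw [zero_smul, add_zero] at h3
    exact h3
  have key := (((hd 1 0).add ((((hp (E.m - 1)).const_mul (E.ε * E.m))).mul (hd 0 1))).add
    ((hf.const_mul E.n).mul ((((hp (E.n - 1)).mul (hd 0 3)).add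
      ((((hp (E.n - 2)).const_mul (3 * (E.n - 1))).mul (hd 0 1)).mul (hd 0 2))).add
      (((hp (E.n - 3)).const_mul ((E.n - 1) * (E.n - 2))).mul ((hd 0 1).pow 3))))).deriv
  have hl : prolongApply V E.lhs z = _ := key
  rw [hl]
  have e0 := rpow_pred hu (E.m - 1) (E.m - 1 - 1) (by ring)
  have e1 := rpow_pred hu (E.n - 1) (E.n - 1 - 1) (by ring)
  have e2 := rpow_pred hu (E.n - 1) (E.n - 2) (by ring)
  have e3 := rpow_pred hu (E.n - 2) (E.n - 2 - 1) (by ring)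
  have e4 := rpow_pred hu (E.n - 2) (E.n - 3) (by ring)
  have e5 := rpow_pred hu (E.n - 3) (E.n - 3 - 1) (by ring)
  have hb : z.base.2.2 = z.d 0 0 := rfl
  have hb1 : z.base.1 = z.1 := rfl
  simp only [zero_smul, add_zero, Eqn.prolongAt, hb, hb1, Pi.add_apply, Pi.mul_apply, Pi.pow_apply]
  rw [e5, e4, e3, e2, e1, e0]
  field_simp
  ring

/-! ### The invariance criterion as a polynomial identity in the jet coordinates -/

/-- The jet at the point `p` with `u_x = a`, `u_{xx} = b`, `u_{xxx} = c`, `u_t = y`, `u_{tx} = q`,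
`u_{txx} = r`, all other coordinates being zero. -/
def jetOf (p : Pt) (a b c y q r : ℝ) : Jet :=
  (p.1, p.2.1, fun i j => match i, j with
    | 0, 0 => p.2.2
    | 0, 1 => a
    | 0, 2 => b
    | 0, 3 => c
    | 1, 0 => y
    | 1, 1 => q
    | 1, 2 => r
    | _, _ => 0)

/-- The value at a jet over `p` of the prolonged field applied to the left-hand side; see `jetOf`
for the arguments. -/
def Eqn.criterion (E : Eqn) (V : VField) (p : Pt) (a b c y q r : ℝ) : ℝ :=
  E.prolongAt p (cT V p) (cU V p) a b c
    (D1 (cU V) p a - y * D1 (cT V) p a - a * D1 (cX V) p a)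
    (D2 (cU V) p a b - 2 * q * D1 (cT V) p a - y * D2 (cT V) p a b
      - 2 * b * D1 (cX V) p a - a * D2 (cX V) p a b)
    (D3 (cU V) p a b c - 3 * r * D1 (cT V) p a - 3 * q * D2 (cT V) p a b
      - y * D3 (cT V) p a b c - 3 * c * D1 (cX V) p a - 3 * b * D2 (cX V) p a b
      - a * D3 (cX V) p a b c)
    (pd eT (cU V) p + y * pd eU (cU V) p - y * (pd eT (cT V) p + y * pd eU (cT V) p)
      - a * (pd eT (cX V) p + y * pd eU (cX V) p))

lemma Eqn.mem_maxAlg_iff_criterion {E : Eqn} (hE : E.Admissible) (V : VField) :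
    V ∈ E.maxAlg ↔ ContDiffOn ℝ ∞ V E.domain ∧ ∀ p ∈ E.domain, ∀ a b c y q r : ℝ,
      E.lhsAt p a b c y = 0 → E.criterion V p a b c y q r = 0 := by
  have key : ContDiffOn ℝ ∞ V E.domain → ∀ z : Jet, z.base ∈ E.domain →
      prolongApply V E.lhs z = E.criterion V z.base (z.d 0 1) (z.d 0 2) (z.d 0 3) (z.d 1 0)
        (z.d 1 1) (z.d 1 2) := fun hV z hz => by
    have hD := hE.isOpen_domain
    rw [Eqn.prolongApply_eq hE V hz, prolongCoeff_zero_one hD hV hz,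
      prolongCoeff_zero_two hD hV hz, prolongCoeff_zero_three hD hV hz,
      prolongCoeff_one_zero hD hV hz, Eqn.criterion]
  constructor
  · rintro ⟨hV, h⟩
    refine ⟨hV, fun p hp a b c y q r hl => ?_⟩
    have hb : (jetOf p a b c y q r).base = p := rfl
    have h1 := h (jetOf p a b c y q r) (by rwa [hb])
    rw [E.lhs_eq (by rw [hb]; exact hE.U_pos _ hp.2.2), key hV _ (by rwa [hb])] at h1
    exact h1 hl
  · rintro ⟨hV, h⟩
    refine ⟨hV, fun z hz hl => ?_⟩
    rw [key hV z hz]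
    exact h _ hz _ _ _ _ _ _ (by rwa [← E.lhs_eq (hE.U_pos _ hz.2.2)])

/-! ### Fields projectable to the base -/

section
variable {D : Set Pt} {F : Pt → ℝ} {p : Pt}

lemma pd_zero_of_eqOn (hD : IsOpen D) (h : EqOn F 0 D) (v : Pt) : EqOn (pd v F) 0 D :=
  fun p hp => by
    rw [pd_congr hD h v hp]
    simp [pd]

lemma eqOn_pd_pd_zero (hD : IsOpen D) (hF : ContDiffOn ℝ ∞ F D) {v : Pt} (h : EqOn (pd v F) 0 D)
    (w : Pt) : EqOn (pd v (pd w F)) 0 D :=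
  (pd_comm hD hF v w).trans (pd_zero_of_eqOn hD h w)

lemma D1_eq_of_pd_eU_eq_zero (h : EqOn (pd eU F) 0 D) (hp : p ∈ D) (a : ℝ) :
    D1 F p a = pd eX F p := by
  have := h hp
  simp_all [D1]

lemma D1_pd_eU_eq_zero (hD : IsOpen D) (h : EqOn (pd eU F) 0 D) (hp : p ∈ D) (a : ℝ) :
    D1 (pd eU F) p a = 0 := by
  have h1 := pd_zero_of_eqOn hD h eX hp
  have h2 := pd_zero_of_eqOn hD h eU hp
  simp_all [D1]

lemma D2_eq_of_pd_eU_eq_zero (hD : IsOpen D) (hF : ContDiffOn ℝ ∞ F D) (h : EqOn (pd eU F) 0 D)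
    (hp : p ∈ D) (a b : ℝ) : D2 F p a b = pd eX (pd eX F) p := by
  have h0 : pd eU F p = 0 := h hp
  rw [D2, D1_eq_of_pd_eU_eq_zero (eqOn_pd_pd_zero hD hF h eX) hp, D1_pd_eU_eq_zero hD h hp, h0]
  ring

lemma D3_eq_of_pd_eU_eq_zero (hD : IsOpen D) (hF : ContDiffOn ℝ ∞ F D) (h : EqOn (pd eU F) 0 D)
    (hp : p ∈ D) (a b c : ℝ) : D3 F p a b c = pd eX (pd eX (pd eX F)) p := by
  have h0 : pd eU F p = 0 := h hp
  have h1 : D2 (pd eU F) p a b = 0 := by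
    rw [D2_eq_of_pd_eU_eq_zero hD (contDiffOn_pd hD hF eU) (pd_zero_of_eqOn hD h eU) hp,
      pd_zero_of_eqOn hD (pd_zero_of_eqOn hD h eX) eX hp]
    rfl
  rw [D3, D2_eq_of_pd_eU_eq_zero hD (contDiffOn_pd hD hF eX) (eqOn_pd_pd_zero hD hF h eX) hp,
    D1_pd_eU_eq_zero hD h hp, h0, h1]
  ring

/-- `F` is positively homogeneous of degree one in `u` on `D`, in the differential form
`u F_u = F`. -/
def HomU (D : Set Pt) (F : Pt → ℝ) : Prop := ∀ p ∈ D, p.2.2 * pd eU F p = F p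

lemma pd_mul (hD : IsOpen D) {G : Pt → ℝ} (hF : ContDiffOn ℝ ∞ F D) (hG : ContDiffOn ℝ ∞ G D)
    (hp : p ∈ D) (v : Pt) :
    pd v (fun q => F q * G q) p = pd v F p * G p + F p * pd v G p := by
  have h : HasFDerivAt (fun q => F q * G q) _ p :=
    (hasFDerivAt_of_contDiffOn hD hF hp).mul (hasFDerivAt_of_contDiffOn hD hG hp)
  simp only [pd, h.fderiv]
  simp
  ring

lemma pd_sub (hD : IsOpen D) {G : Pt → ℝ} (hF : ContDiffOn ℝ ∞ F D) (hG : ContDiffOn ℝ ∞ G D)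
    (hp : p ∈ D) (v : Pt) : pd v (fun q => F q - G q) p = pd v F p - pd v G p := by
  have h : HasFDerivAt (fun q => F q - G q) _ p :=
    (hasFDerivAt_of_contDiffOn hD hF hp).sub (hasFDerivAt_of_contDiffOn hD hG hp)
  simp [pd, h.fderiv]

lemma pd_const_mul (hD : IsOpen D) (hF : ContDiffOn ℝ ∞ F D) (hp : p ∈ D) (c : ℝ) (v : Pt) :
    pd v (fun q => c * F q) p = c * pd v F p := by
  have h : HasFDerivAt (fun q => c * F q) _ p := (hasFDerivAt_of_contDiffOn hD hF hp).const_mul c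
  simp [pd, h.fderiv]

lemma pd_coord_u (v p : Pt) : pd v (fun q => q.2.2) p = v.2.2 := by
  have h : HasFDerivAt (fun q : Pt => q.2.2) _ p :=
    (hasFDerivAt_snd (𝕜 := ℝ) (E := ℝ) (F := ℝ × ℝ)).snd
  simp [pd, h.fderiv]

lemma HomU.pd_eX (hD : IsOpen D) (hF : ContDiffOn ℝ ∞ F D) (h : HomU D F) :
    HomU D (pd eX F) := fun p hp => by
  have h1 := pd_congr hD (F := fun q => q.2.2 * pd eU F q) (G := F) h eX hp
  rw [pd_mul hD (by fun_prop) (contDiffOn_pd hD hF eU) hp, pd_coord_u] at h1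
  rw [pd_comm hD hF eU eX hp, ← h1]
  simp [eX]

lemma HomU.pd_eU (hD : IsOpen D) (hF : ContDiffOn ℝ ∞ F D) (hu : ∀ p ∈ D, 0 < p.2.2)
    (h : HomU D F) : EqOn (pd eU (pd eU F)) 0 D := fun p hp => by
  have h1 := pd_congr hD (F := fun q => q.2.2 * pd eU F q) (G := F) h eU hp
  rw [pd_mul hD (by fun_prop) (contDiffOn_pd hD hF eU) hp, pd_coord_u] at h1
  have := (hu p hp).ne'
  simp_all [eU]

lemma HomU.pd_eU_eq (hu : ∀ p ∈ D, 0 < p.2.2) (h : HomU D F) (hp : p ∈ D) :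
    pd eU F p = F p / p.2.2 := by
  rw [eq_div_iff (hu p hp).ne', ← h p hp, mul_comm]

lemma HomU.pd_eX_pd_eU_eq (hD : IsOpen D) (hF : ContDiffOn ℝ ∞ F D) (hu : ∀ p ∈ D, 0 < p.2.2)
    (h : HomU D F) (hp : p ∈ D) : pd eX (pd eU F) p = pd eX F p / p.2.2 := by
  rw [pd_comm hD hF eX eU hp, (h.pd_eX hD hF).pd_eU_eq hu hp]

lemma HomU.D1_eq (hu : ∀ p ∈ D, 0 < p.2.2) (h : HomU D F) (hp : p ∈ D) (a : ℝ) :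
    D1 F p a = pd eX F p + a * F p / p.2.2 := by
  rw [D1, h.pd_eU_eq hu hp, mul_div_assoc]

lemma HomU.D2_eq (hD : IsOpen D) (hF : ContDiffOn ℝ ∞ F D) (hu : ∀ p ∈ D, 0 < p.2.2)
    (h : HomU D F) (hp : p ∈ D) (a b : ℝ) :
    D2 F p a b = pd eX (pd eX F) p + 2 * a * pd eX F p / p.2.2 + b * F p / p.2.2 := by
  rw [D2, (h.pd_eX hD hF).D1_eq hu hp, D1_eq_of_pd_eU_eq_zero (h.pd_eU hD hF hu) hp,
    h.pd_eX_pd_eU_eq hD hF hu hp, h.pd_eU_eq hu hp]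
  ring

lemma HomU.D3_eq (hD : IsOpen D) (hF : ContDiffOn ℝ ∞ F D) (hu : ∀ p ∈ D, 0 < p.2.2)
    (h : HomU D F) (hp : p ∈ D) (a b c : ℝ) :
    D3 F p a b c = pd eX (pd eX (pd eX F)) p + 3 * a * pd eX (pd eX F) p / p.2.2
      + 3 * b * pd eX F p / p.2.2 + c * F p / p.2.2 := by
  have hX := contDiffOn_pd hD hF eX
  have hxx : pd eX (pd eX (pd eU F)) p = pd eX (pd eX F) p / p.2.2 := by
    rw [pd_congr hD (pd_comm hD hF eX eU) eX hp, (h.pd_eX hD hF).pd_eX_pd_eU_eq hD hX hu hp]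
  rw [D3, (h.pd_eX hD hF).D2_eq hD hX hu hp,
    D2_eq_of_pd_eU_eq_zero hD (contDiffOn_pd hD hF eU) (h.pd_eU hD hF hu) hp, hxx,
    D1_eq_of_pd_eU_eq_zero (h.pd_eU hD hF hu) hp, h.pd_eX_pd_eU_eq hD hF hu hp,
    h.pd_eU_eq hu hp]
  ring

end

/-! ### The determining equations -/

section
variable {E : Eqn} {V : VField}

lemma Eqn.Admissible.pos (hE : E.Admissible) : ∀ p ∈ E.domain, 0 < p.2.2 :=
  fun _ hp => hE.U_pos _ hp.2.2

/-- The value of `u_t` that solves the equation for given `u_x, u_{xx}, u_{xxx}`. -/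
def Eqn.solveT (E : Eqn) (p : Pt) (a b c : ℝ) : ℝ :=
  -(E.ε * E.m * p.2.2 ^ (E.m - 1) * a + E.n * E.f p.1 * p.2.2 ^ (E.n - 1) *
    (c + 3 * (E.n - 1) * a * b / p.2.2 + (E.n - 1) * (E.n - 2) * a ^ 3 / p.2.2 ^ 2))

lemma Eqn.lhsAt_eq_zero_iff (E : Eqn) (p : Pt) (a b c y : ℝ) :
    E.lhsAt p a b c y = 0 ↔ y = E.solveT p a b c := by
  rw [Eqn.lhsAt, Eqn.solveT, ← sub_eq_zero (a := y)]
  constructor <;> intro h <;> linarith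

/-- The determining equation from the coefficient of `u_{xxx}`. -/
def Eqn.det3 (E : Eqn) (V : VField) (p : Pt) : ℝ :=
  (E.n - 1) * E.f p.1 * cU V p - p.2.2 * (3 * E.f p.1 * pd eX (cX V) p
    - E.f p.1 * pd eT (cT V) p - cT V p * deriv E.f p.1)

/-- The determining equation from the coefficient of `u_{xx}`. -/
def Eqn.det2 (E : Eqn) (V : VField) (p : Pt) : ℝ :=
  E.n * pd eX (cU V) p - p.2.2 * pd eX (pd eX (cX V)) p

/-- The determining equation from the coefficient of `u_x`. -/
def Eqn.det1 (E : Eqn) (V : VField) (p : Pt) : ℝ :=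
  -pd eT (cX V) p + E.ε * E.m * p.2.2 ^ (E.m - 1) *
      ((E.m - 1) * cU V p / p.2.2 + pd eT (cT V) p - pd eX (cX V) p)
    + E.n * E.f p.1 * p.2.2 ^ (E.n - 1) *
      (3 * E.n * pd eX (pd eX (cU V)) p / p.2.2 - pd eX (pd eX (pd eX (cX V))) p)

/-- The determining equation from the terms free of `x`-derivatives of `u`. -/
def Eqn.det0 (E : Eqn) (V : VField) (p : Pt) : ℝ :=
  pd eT (cU V) p + E.ε * E.m * p.2.2 ^ (E.m - 1) * pd eX (cU V) p
    + E.n * E.f p.1 * p.2.2 ^ (E.n - 1) * pd eX (pd eX (pd eX (cU V))) p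

/-- On fields `τ(t) ∂_t + ξ(t,x) ∂_x + h(t,x) u ∂_u` the invariance criterion is a polynomial
in `u_x, u_{xx}, u_{xxx}` whose coefficients are the determining equations. -/
lemma Eqn.criterion_eq (hE : E.Admissible) (hV : ContDiffOn ℝ ∞ V E.domain)
    (htx : EqOn (pd eX (cT V)) 0 E.domain) (htu : EqOn (pd eU (cT V)) 0 E.domain)
    (hxu : EqOn (pd eU (cX V)) 0 E.domain) (hh : HomU E.domain (cU V)) {p : Pt}
    (hp : p ∈ E.domain) (a b c q r : ℝ) :
    E.criterion V p a b c (E.solveT p a b c) q r =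
      E.det0 V p + a * E.det1 V p
        + 3 * E.n * E.f p.1 * p.2.2 ^ (E.n - 1) / p.2.2 * b * E.det2 V p
        + 3 * (E.n - 1) * E.n * E.f p.1 * p.2.2 ^ (E.n - 1) / p.2.2 ^ 2 * a ^ 2 * E.det2 V p
        + E.n * p.2.2 ^ (E.n - 1) / p.2.2 * E.det3 V p *
          (c + 3 * (E.n - 1) * a * b / p.2.2 + (E.n - 1) * (E.n - 2) * a ^ 3 / p.2.2 ^ 2) := by
  have hD := hE.isOpen_domain
  obtain ⟨h1, h2, h3⟩ := contDiffOn_vField_iff.1 hV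
  have hu := hE.pos
  have hu0 := (hu p hp).ne'
  have t0 : pd eX (cT V) p = 0 := htx hp
  have t1 : pd eX (pd eX (cT V)) p = 0 := pd_zero_of_eqOn hD htx eX hp
  have t2 : pd eX (pd eX (pd eX (cT V))) p = 0 :=
    pd_zero_of_eqOn hD (pd_zero_of_eqOn hD htx eX) eX hp
  have t3 : pd eU (cT V) p = 0 := htu hp
  have t4 : pd eU (cX V) p = 0 := hxu hp
  rw [Eqn.criterion, hh.D1_eq hu hp, hh.D2_eq hD h3 hu hp, hh.D3_eq hD h3 hu hp,
    hh.pd_eU_eq hu hp, D1_eq_of_pd_eU_eq_zero htu hp, D1_eq_of_pd_eU_eq_zero hxu hp,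
    D2_eq_of_pd_eU_eq_zero hD h1 htu hp, D2_eq_of_pd_eU_eq_zero hD h2 hxu hp,
    D3_eq_of_pd_eU_eq_zero hD h1 htu hp, D3_eq_of_pd_eU_eq_zero hD h2 hxu hp,
    t0, t1, t2, t3, t4, Eqn.solveT, Eqn.prolongAt, Eqn.det0, Eqn.det1, Eqn.det2, Eqn.det3]
  generalize p.2.2 ^ (E.m - 1) = P
  generalize p.2.2 ^ (E.n - 1) = Q
  field_simp
  ring

/-- The system of determining equations for the coefficients of a Lie symmetry, over one point. -/
structure DetEqs (E : Eqn) (V : VField) (p : Pt) : Prop where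
  tx : pd eX (cT V) p = 0
  tu : pd eU (cT V) p = 0
  xu : pd eU (cX V) p = 0
  hom : p.2.2 * pd eU (cU V) p = cU V p
  e3 : E.det3 V p = 0
  e2 : E.det2 V p = 0
  e1 : E.det1 V p = 0
  e0 : E.det0 V p = 0

lemma Eqn.mem_maxAlg_of_detEqs (hE : E.Admissible) (hV : ContDiffOn ℝ ∞ V E.domain)
    (h : ∀ p ∈ E.domain, DetEqs E V p) : V ∈ E.maxAlg := by
  refine (Eqn.mem_maxAlg_iff_criterion hE V).2 ⟨hV, fun p hp a b c y q r hl => ?_⟩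
  rw [Eqn.lhsAt_eq_zero_iff] at hl
  rw [hl, Eqn.criterion_eq hE hV (fun p hp => (h p hp).tx) (fun p hp => (h p hp).tu)
    (fun p hp => (h p hp).xu) (fun p hp => (h p hp).hom) hp, (h p hp).e3, (h p hp).e2,
    (h p hp).e1, (h p hp).e0]
  ring

lemma pd_comp_fst {g : ℝ → ℝ} {p : Pt} (hg : DifferentiableAt ℝ g p.1) (v : Pt) :
    pd v (fun q => g q.1) p = v.1 * deriv g p.1 := by
  have h := hg.hasDerivAt.comp_hasFDerivAt p (hasFDerivAt_fst (𝕜 := ℝ) (E := ℝ) (F := ℝ × ℝ))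
  have h' : fderiv ℝ (fun q : Pt => g q.1) p = _ := h.fderiv
  simp [pd, h', mul_comm]

lemma Eqn.Admissible.contDiffOn_f (hE : E.Admissible) :
    ContDiffOn ℝ ∞ (fun p : Pt => E.f p.1) E.domain :=
  hE.f_smooth.comp contDiffOn_fst fun _ hp => hp.1

lemma Eqn.Admissible.contDiffOn_deriv_f (hE : E.Admissible) :
    ContDiffOn ℝ ∞ (fun p : Pt => deriv E.f p.1) E.domain :=
  (hE.f_smooth.deriv_of_isOpen hE.interval_I.1 (m := ∞) (by simp)).comp contDiffOn_fst
    fun _ hp => hp.1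

/-- Since the equation is nonlinear in `u_{xxx}`, the determining equation `det3` forces `η` to be
proportional to `u`. -/
lemma homU_of_det3 (hE : E.Admissible) (hV : ContDiffOn ℝ ∞ V E.domain)
    (htu : EqOn (pd eU (cT V)) 0 E.domain) (hxu : EqOn (pd eU (cX V)) 0 E.domain)
    (h3 : ∀ p ∈ E.domain, E.det3 V p = 0) : HomU E.domain (cU V) := by
  have hD := hE.isOpen_domain
  obtain ⟨c1, c2, c3⟩ := contDiffOn_vField_iff.1 hV
  have cf := hE.contDiffOn_f
  have cf' := hE.contDiffOn_deriv_f
  intro p hp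
  have ef : pd eU (fun q : Pt => E.f q.1) p = 0 := by
    rw [pd_comp_fst (hE.hasDerivAt_f hp.1).differentiableAt]; simp [eU]
  have ef' : pd eU (fun q : Pt => deriv E.f q.1) p = 0 := by
    rw [pd_comp_fst]
    · simp [eU]
    · exact ((hE.f_smooth.deriv_of_isOpen hE.interval_I.1 (m := ∞) (by simp)).contDiffAt
        (hE.interval_I.1.mem_nhds hp.1)).differentiableAt (by simp)
  have s1 := cf.mul c3
  have s2 := cf.mul (contDiffOn_pd hD c2 eX)
  have s3 := cf.mul (contDiffOn_pd hD c1 eT)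
  have s4 := c1.mul cf'
  have s5 := (contDiffOn_const (c := (3 : ℝ))).mul s2
  -- `det3 = (n - 1) f η - u R`, where `R` does not depend on `u`
  have hfun : E.det3 V = fun q => (E.n - 1) * (E.f q.1 * cU V q) - q.2.2 *
      (3 * (E.f q.1 * pd eX (cX V) q) - E.f q.1 * pd eT (cT V) q - cT V q * deriv E.f q.1) := by
    funext q; simp only [Eqn.det3]; ring
  have hz : pd eU (E.det3 V) p = 0 := pd_zero_of_eqOn hD h3 eU hp
  rw [hfun, pd_sub hD (contDiffOn_const.mul s1) (contDiffOn_snd.snd.mul ((s5.sub s3).sub s4)) hp,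
    pd_const_mul hD s1 hp, pd_mul hD contDiffOn_snd.snd ((s5.sub s3).sub s4) hp, pd_coord_u,
    pd_sub hD (s5.sub s3) s4 hp, pd_sub hD s5 s3 hp, pd_const_mul hD s2 hp,
    pd_mul hD cf c3 hp, pd_mul hD cf (contDiffOn_pd hD c2 eX) hp,
    pd_mul hD cf (contDiffOn_pd hD c1 eT) hp, pd_mul hD c1 cf' hp, ef, ef', htu hp,
    eqOn_pd_pd_zero hD c2 hxu eX hp, eqOn_pd_pd_zero hD c1 htu eT hp] at hz
  simp only [show eU.2.2 = 1 from rfl, Pi.zero_apply] at hz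
  have hp3 := h3 p hp
  rw [Eqn.det3] at hp3
  apply mul_left_cancel₀ (mul_ne_zero (sub_ne_zero.2 hE.n_ne_one) (hE.f_ne_zero _ hp.1))
  linear_combination p.2.2 * hz - hp3

/-- The determining equations are read off from the criterion as the coefficients of `u_{txx}`,
`u_{xx}²`, `u_{xxx}`, `u_{xx}`, `u_x` and `1`. -/
lemma Eqn.mem_maxAlg_iff (hE : E.Admissible) (V : VField) :
    V ∈ E.maxAlg ↔ ContDiffOn ℝ ∞ V E.domain ∧ ∀ p ∈ E.domain, DetEqs E V p := by
  refine ⟨fun h => ?_, fun h => Eqn.mem_maxAlg_of_detEqs hE h.1 h.2⟩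
  obtain ⟨hV, h⟩ := (Eqn.mem_maxAlg_iff_criterion hE V).1 h
  refine ⟨hV, ?_⟩
  have hD := hE.isOpen_domain
  obtain ⟨c1, c2, c3⟩ := contDiffOn_vField_iff.1 hV
  have hu := hE.pos
  have hN : ∀ p ∈ E.domain, E.n * E.f p.1 * p.2.2 ^ (E.n - 1) ≠ 0 := fun p hp =>
    mul_ne_zero (mul_ne_zero hE.n_ne_zero (hE.f_ne_zero _ hp.1))
      (Real.rpow_pos_of_pos (hu p hp) _).ne'
  have hs : ∀ p ∈ E.domain, ∀ a b c q r, E.criterion V p a b c (E.solveT p a b c) q r = 0 :=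
    fun p hp a b c q r => h p hp a b c _ q r ((E.lhsAt_eq_zero_iff p a b c _).2 rfl)
  have hd : ∀ p ∈ E.domain, ∀ a, D1 (cT V) p a = 0 := fun p hp a => by
    have h1 := hs p hp a 0 0 0 1
    have h0 := hs p hp a 0 0 0 0
    apply mul_left_cancel₀ (hN p hp)
    simp only [Eqn.criterion, Eqn.prolongAt] at h1 h0
    linear_combination (h0 - h1) / 3
  have htx : EqOn (pd eX (cT V)) 0 E.domain := fun p hp => by simpa [D1] using hd p hp 0
  have htu : EqOn (pd eU (cT V)) 0 E.domain := fun p hp => by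
    have h1 := hd p hp 1
    have h0 : pd eX (cT V) p = 0 := htx hp
    simpa [D1, h0] using h1
  have hxu : EqOn (pd eU (cX V)) 0 E.domain := fun p hp => by
    have h1 := hs p hp 0 1 0 0 0
    have h2 := hs p hp 0 (-1) 0 0 0
    have h0 := hs p hp 0 0 0 0 0
    apply mul_left_cancel₀ (hN p hp)
    simp only [Eqn.criterion, Eqn.prolongAt, Eqn.solveT, D3, D2, D1] at h1 h2 h0
    simp only [Pi.zero_apply]
    linear_combination (2 * h0 - h1 - h2) / 6
  have h3 : ∀ p ∈ E.domain, E.det3 V p = 0 := fun p hp => by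
    have h1 := hs p hp 0 0 1 0 0
    have h0 := hs p hp 0 0 0 0 0
    have t0 : pd eX (cT V) p = 0 := htx hp
    have t1 : pd eX (pd eX (cT V)) p = 0 := pd_zero_of_eqOn hD htx eX hp
    have t2 : pd eX (pd eX (pd eX (cT V))) p = 0 :=
      pd_zero_of_eqOn hD (pd_zero_of_eqOn hD htx eX) eX hp
    have t3 : pd eU (cT V) p = 0 := htu hp
    have t4 : pd eU (cX V) p = 0 := hxu hp
    have hQ := (Real.rpow_pos_of_pos (hu p hp) (E.n - 1)).ne'
    have hu0 := (hu p hp).ne'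
    apply mul_left_cancel₀ (mul_ne_zero hE.n_ne_zero hQ)
    simp only [Eqn.criterion, Eqn.prolongAt, Eqn.solveT, D3, D2, D1, t0, t1, t2, t3, t4] at h1 h0
    rw [Eqn.det3]
    have hk : cU V p / p.2.2 * p.2.2 = cU V p := div_mul_cancel₀ _ hu0
    linear_combination p.2.2 * (h1 - h0)
      - E.n * p.2.2 ^ (E.n - 1) * (E.n - 1) * E.f p.1 * hk
  have hh := homU_of_det3 hE hV htu hxu h3
  intro p hp
  have hc := fun a b c => Eqn.criterion_eq hE hV htx htu hxu hh hp a b c 0 0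
  simp only [hs p hp, h3 p hp] at hc
  have e0 : E.det0 V p = 0 := by linear_combination -hc 0 0 0
  have e2 : E.det2 V p = 0 := by
    have hk : E.det2 V p / p.2.2 * p.2.2 = E.det2 V p := div_mul_cancel₀ _ (hu p hp).ne'
    have h1 := hc 0 1 0
    apply mul_left_cancel₀ (hN p hp)
    rw [e0] at h1
    linear_combination -(p.2.2 / 3) * h1 - E.n * E.f p.1 * p.2.2 ^ (E.n - 1) * hk
  have e1 : E.det1 V p = 0 := by
    have h1 := hc 1 0 0
    rw [e0, e2] at h1
    linear_combination -h1
  exact ⟨htx hp, htu hp, hxu hp, hh p hp, h3 p hp, e2, e1, e0⟩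

end

/-! ### Splitting the determining equations in `u` -/

lemma deriv_eq_zero_of_eqOn_zero {U : Set ℝ} (hU : IsOpen U) {g : ℝ → ℝ} {g' u : ℝ}
    (h : ∀ v ∈ U, g v = 0) (hu : u ∈ U) (hg : HasDerivAt g g' u) : g' = 0 := by
  have h1 : g =ᶠ[nhds u] fun _ => (0 : ℝ) :=
    (hU.mem_nhds hu) |> Filter.mem_of_superset <| fun v hv => h v hv
  simpa [hg.deriv] using h1.deriv_eq

lemma rpow_indep_two {U : Set ℝ} (hU : IsOpen U) (hne : U.Nonempty) (hpos : ∀ u ∈ U, 0 < u)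
    {α A B : ℝ} (hα : α ≠ 0) (h : ∀ u ∈ U, A + B * u ^ α = 0) : A = 0 ∧ B = 0 := by
  obtain ⟨u, hu⟩ := hne
  have h1 := deriv_eq_zero_of_eqOn_zero hU h hu
    (((Real.hasDerivAt_rpow_const (p := α) (Or.inl (hpos u hu).ne')).const_mul B).const_add A)
  have h2 := (Real.rpow_pos_of_pos (hpos u hu) (α - 1)).ne'
  have hB : B = 0 := by simpa [hα, h2] using h1
  exact ⟨by simpa [hB] using h u hu, hB⟩

/-- Differentiation and division by `u^(α-1)` reduce three powers to two. -/
lemma rpow_indep_three {U : Set ℝ} (hU : IsOpen U) (hne : U.Nonempty) (hpos : ∀ u ∈ U, 0 < u)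
    {α β A B C : ℝ} (hα : α ≠ 0) (hβ : β ≠ 0) (hαβ : α ≠ β)
    (h : ∀ u ∈ U, A + B * u ^ α + C * u ^ β = 0) : A = 0 ∧ B = 0 ∧ C = 0 := by
  have h1 : ∀ u ∈ U, B * α + C * β * u ^ (β - α) = 0 := fun u hu => by
    have hp := hpos u hu
    have h1 := deriv_eq_zero_of_eqOn_zero hU h hu
      ((((Real.hasDerivAt_rpow_const (p := α) (Or.inl hp.ne')).const_mul B).const_add A).add
        ((Real.hasDerivAt_rpow_const (p := β) (Or.inl hp.ne')).const_mul C))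
    have h2 : u ^ (β - 1) = u ^ (α - 1) * u ^ (β - α) := by
      rw [← Real.rpow_add hp]; ring_nf
    apply mul_left_cancel₀ (Real.rpow_pos_of_pos hp (α - 1)).ne'
    rw [h2] at h1
    linear_combination h1
  obtain ⟨hB, hC⟩ := rpow_indep_two hU hne hpos (sub_ne_zero.2 hαβ.symm) h1
  have hB : B = 0 := by simpa [hα] using hB
  have hC : C = 0 := by simpa [hβ] using hC
  obtain ⟨u, hu⟩ := hne
  exact ⟨by simpa [hB, hC] using h u hu, hB, hC⟩

section
variable {E : Eqn} {V : VField}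

lemma IsOpenInterval.isPreconnected {S : Set ℝ} (h : IsOpenInterval S) : IsPreconnected S :=
  h.2.2.isPreconnected

lemma Eqn.Admissible.isPreconnected_domain (hE : E.Admissible) : IsPreconnected E.domain :=
  hE.interval_I.isPreconnected.prod
    (hE.interval_X.isPreconnected.prod hE.interval_U.isPreconnected)

lemma Eqn.Admissible.convex_domain (hE : E.Admissible) : Convex ℝ E.domain :=
  hE.interval_I.2.2.convex.prod (hE.interval_X.2.2.convex.prod hE.interval_U.2.2.convex)

lemma eq_add_of_pd_eq_zero {D : Set Pt} (hD : IsOpen D) (hc : Convex ℝ D) {F : Pt → ℝ}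
    (hF : ContDiffOn ℝ ∞ F D) {v p : Pt} (h : EqOn (pd v F) 0 D) (hp : p ∈ D) (hq : p + v ∈ D) :
    F (p + v) = F p := by
  have hmem : ∀ s ∈ Icc (0 : ℝ) 1, p + s • v ∈ D := fun s hs => hc.add_smul_mem hp hq hs
  have hd : ∀ s ∈ Icc (0 : ℝ) 1, HasDerivAt (fun s : ℝ => F (p + s • v)) 0 s := fun s hs => by
    have h1 := hasFDerivAt_of_contDiffOn hD hF (hmem s hs)
    have h2 : HasDerivAt (fun s : ℝ => p + s • v) v s := by
      simpa using ((hasDerivAt_id s).smul_const v).const_add p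
    have h3 := h1.comp_hasDerivAt s h2
    have h4 : fderiv ℝ F (p + s • v) v = 0 := h (hmem s hs)
    rwa [h4] at h3
  have := constant_of_has_deriv_right_zero (fun s hs => (hd s hs).continuousAt.continuousWithinAt)
    (fun s hs => (hd s (Ico_subset_Icc_self hs)).hasDerivWithinAt) 1 (by simp)
  simpa using this

lemma pd_smul (c : ℝ) (v : Pt) (F : Pt → ℝ) (p : Pt) : pd (c • v) F p = c * pd v F p := by
  simp [pd]

lemma eq_of_pd_eU_eq_zero (hE : E.Admissible) {F : Pt → ℝ} (hF : ContDiffOn ℝ ∞ F E.domain)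
    (h : EqOn (pd eU F) 0 E.domain) {t x u u' : ℝ} (hp : (t, x, u) ∈ E.domain)
    (hp' : (t, x, u') ∈ E.domain) : F (t, x, u') = F (t, x, u) := by
  have e : ((t, x, u') : Pt) = (t, x, u) + (u' - u) • eU := by simp [eU]
  rw [e]
  refine eq_add_of_pd_eq_zero hE.isOpen_domain hE.convex_domain hF (fun q hq => ?_) hp (e ▸ hp')
  rw [pd_smul, h hq]
  simp

lemma eq_of_pd_eT_eq_zero (hE : E.Admissible) {F : Pt → ℝ} (hF : ContDiffOn ℝ ∞ F E.domain)
    (h : EqOn (pd eT F) 0 E.domain) {t t' x u : ℝ} (hp : (t, x, u) ∈ E.domain)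
    (hp' : (t', x, u) ∈ E.domain) : F (t', x, u) = F (t, x, u) := by
  have e : ((t', x, u) : Pt) = (t, x, u) + (t' - t) • eT := by simp [eT]
  rw [e]
  refine eq_add_of_pd_eq_zero hE.isOpen_domain hE.convex_domain hF (fun q hq => ?_) hp (e ▸ hp')
  rw [pd_smul, h hq]
  simp

/-- The coefficient `h` of a field with `η = h u`, encoded as `η_u`. -/
def cH (V : VField) : Pt → ℝ := pd eU (cU V)

/-- The determining equations over the domain, split with respect to the powers of `u`. -/
structure SplitEqs (E : Eqn) (V : VField) : Prop where
  smooth : ContDiffOn ℝ ∞ V E.domain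
  tx : EqOn (pd eX (cT V)) 0 E.domain
  tu : EqOn (pd eU (cT V)) 0 E.domain
  xu : EqOn (pd eU (cX V)) 0 E.domain
  hu : EqOn (pd eU (cH V)) 0 E.domain
  eta : ∀ p ∈ E.domain, cU V p = cH V p * p.2.2
  xt : EqOn (pd eT (cX V)) 0 E.domain
  ht : EqOn (pd eT (cH V)) 0 E.domain
  e3 : ∀ p ∈ E.domain, (E.n - 1) * E.f p.1 * cH V p =
    3 * E.f p.1 * pd eX (cX V) p - E.f p.1 * pd eT (cT V) p - cT V p * deriv E.f p.1
  e2 : ∀ p ∈ E.domain, E.n * pd eX (cH V) p = pd eX (pd eX (cX V)) p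
  -- for `m = n` the coefficients of `u^(m-1)` and `u^(n-1)` merge into one equation
  ne1 : E.m ≠ E.n → ∀ p ∈ E.domain,
    E.m * ((E.m - 1) * cH V p + pd eT (cT V) p - pd eX (cX V) p) = 0 ∧
      3 * E.n * pd eX (pd eX (cH V)) p = pd eX (pd eX (pd eX (cX V))) p
  ne0 : E.m ≠ E.n → ∀ p ∈ E.domain, E.m * pd eX (cH V) p = 0
  eq1 : E.m = E.n → ∀ p ∈ E.domain,
    E.ε * ((E.m - 1) * cH V p + pd eT (cT V) p - pd eX (cX V) p)
      + E.f p.1 * (3 * E.n * pd eX (pd eX (cH V)) p - pd eX (pd eX (pd eX (cX V))) p) = 0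
  eq0 : E.m = E.n → ∀ p ∈ E.domain,
    E.ε * pd eX (cH V) p + E.f p.1 * pd eX (pd eX (pd eX (cH V))) p = 0

lemma Eqn.Admissible.eps_ne_zero (hE : E.Admissible) : E.ε ≠ 0 := by
  rcases hE.eps with h | h <;> simp [h]

/-- All coefficients of the powers of `u` in the determining equations are independent of `u`, so
the equations can be split at every `(t, x)` by varying `u` alone. -/
lemma splitEqs_of_mem (hE : E.Admissible) (hV : V ∈ E.maxAlg) : SplitEqs E V := by
  obtain ⟨hs, hd⟩ := (Eqn.mem_maxAlg_iff hE V).1 hV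
  have hD := hE.isOpen_domain
  obtain ⟨c1, c2, c3⟩ := contDiffOn_vField_iff.1 hs
  have hu := hE.pos
  have hh : HomU E.domain (cU V) := fun p hp => (hd p hp).hom
  have htu : EqOn (pd eU (cT V)) 0 E.domain := fun p hp => (hd p hp).tu
  have hxu : EqOn (pd eU (cX V)) 0 E.domain := fun p hp => (hd p hp).xu
  have ch : ContDiffOn ℝ ∞ (cH V) E.domain := contDiffOn_pd hD c3 eU
  have hhu : EqOn (pd eU (cH V)) 0 E.domain := hh.pd_eU hD c3 hu
  have heta : ∀ p ∈ E.domain, cU V p = cH V p * p.2.2 := fun p hp => by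
    rw [← hh p hp, cH, mul_comm]
  -- `x`- and `t`-derivatives of `η = h u`
  have ex : EqOn (pd eX (cU V)) (fun p => p.2.2 * pd eX (cH V) p) E.domain := fun p hp => by
    rw [pd_congr hD (F := cU V) (G := fun p => cH V p * p.2.2) heta eX hp,
      pd_mul hD ch contDiffOn_snd.snd hp, pd_coord_u]
    simp [eX]; ring
  have hmul : ∀ {G : Pt → ℝ}, ContDiffOn ℝ ∞ G E.domain →
      EqOn (pd eX (fun p => p.2.2 * G p)) (fun p => p.2.2 * pd eX G p) E.domain :=
    fun hG p hp => by
      rw [pd_mul hD contDiffOn_snd.snd hG hp, pd_coord_u]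
      simp [eX]
  have chx := contDiffOn_pd hD ch eX
  have chxx := contDiffOn_pd hD chx eX
  have exx : EqOn (pd eX (pd eX (cU V))) (fun p => p.2.2 * pd eX (pd eX (cH V)) p) E.domain :=
    (pd_congr hD ex eX).trans (hmul chx)
  have exxx : EqOn (pd eX (pd eX (pd eX (cU V))))
      (fun p => p.2.2 * pd eX (pd eX (pd eX (cH V))) p) E.domain :=
    (pd_congr hD exx eX).trans (hmul chxx)
  have et : EqOn (pd eT (cU V)) (fun p => p.2.2 * pd eT (cH V) p) E.domain := fun p hp => by
    rw [pd_congr hD (F := cU V) (G := fun p => cH V p * p.2.2) heta eT hp,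
      pd_mul hD ch contDiffOn_snd.snd hp, pd_coord_u]
    simp [eT]; ring
  -- all coefficients of the powers of `u` are independent of `u`
  have f1 := eqOn_pd_pd_zero hD c2 hxu
  have f2 := eqOn_pd_pd_zero hD ch hhu
  have cxx := contDiffOn_pd hD c2 eX
  have split1 : ∀ t x u, (t, x, u) ∈ E.domain → ∀ v ∈ E.U,
      -pd eT (cX V) (t, x, u) + E.ε * E.m * ((E.m - 1) * cH V (t, x, u) + pd eT (cT V) (t, x, u)
          - pd eX (cX V) (t, x, u)) * v ^ (E.m - 1)
        + E.n * E.f t * (3 * E.n * pd eX (pd eX (cH V)) (t, x, u)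
          - pd eX (pd eX (pd eX (cX V))) (t, x, u)) * v ^ (E.n - 1) = 0 := by
    intro t x u hp v hv
    have hq : (t, x, v) ∈ E.domain := ⟨hp.1, hp.2.1, hv⟩
    have hv0 : v ≠ 0 := (hu _ hq).ne'
    have h1 := (hd _ hq).e1
    rw [Eqn.det1, exx hq, heta _ hq] at h1
    simp only at h1
    rw [eq_of_pd_eU_eq_zero hE (contDiffOn_pd hD c2 eT) (f1 eT) hp hq,
      eq_of_pd_eU_eq_zero hE ch hhu hp hq,
      eq_of_pd_eU_eq_zero hE (contDiffOn_pd hD c1 eT) (eqOn_pd_pd_zero hD c1 htu eT) hp hq,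
      eq_of_pd_eU_eq_zero hE cxx (f1 eX) hp hq,
      eq_of_pd_eU_eq_zero hE chxx (eqOn_pd_pd_zero hD chx (f2 eX) eX) hp hq,
      eq_of_pd_eU_eq_zero hE (contDiffOn_pd hD (contDiffOn_pd hD cxx eX) eX)
        (eqOn_pd_pd_zero hD (contDiffOn_pd hD cxx eX) (eqOn_pd_pd_zero hD cxx (f1 eX) eX) eX)
        hp hq] at h1
    have k1 : ∀ y : ℝ, y * v / v = y := fun y => mul_div_cancel_right₀ y hv0
    rw [← mul_assoc (E.m - 1), k1, mul_comm v, ← mul_assoc (3 * E.n), k1] at h1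
    linear_combination h1
  have split0 : ∀ t x u, (t, x, u) ∈ E.domain → ∀ v ∈ E.U,
      pd eT (cH V) (t, x, u) + E.ε * E.m * pd eX (cH V) (t, x, u) * v ^ (E.m - 1)
        + E.n * E.f t * pd eX (pd eX (pd eX (cH V))) (t, x, u) * v ^ (E.n - 1) = 0 := by
    intro t x u hp v hv
    have hq : (t, x, v) ∈ E.domain := ⟨hp.1, hp.2.1, hv⟩
    have hv0 : v ≠ 0 := (hu _ hq).ne'
    have h1 := (hd _ hq).e0
    rw [Eqn.det0, exxx hq, ex hq, et hq] at h1
    simp only at h1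
    rw [eq_of_pd_eU_eq_zero hE (contDiffOn_pd hD ch eT) (f2 eT) hp hq,
      eq_of_pd_eU_eq_zero hE chx (f2 eX) hp hq,
      eq_of_pd_eU_eq_zero hE (contDiffOn_pd hD chxx eX)
        (eqOn_pd_pd_zero hD chxx (eqOn_pd_pd_zero hD chx (f2 eX) eX) eX) hp hq] at h1
    apply mul_left_cancel₀ hv0
    linear_combination h1
  have hm1 := sub_ne_zero.2 hE.m_ne_one
  have hn1 := sub_ne_zero.2 hE.n_ne_one
  have hε := hE.eps_ne_zero
  have hnf : ∀ p ∈ E.domain, E.n * E.f p.1 ≠ 0 := fun p hp =>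
    mul_ne_zero hE.n_ne_zero (hE.f_ne_zero _ hp.1)
  have ind := fun {A B C : ℝ} => rpow_indep_three (A := A) (B := B) (C := C) hE.interval_U.1
    hE.interval_U.2.1 hE.U_pos hm1 hn1
  have ind' := fun {A B : ℝ} => rpow_indep_two (A := A) (B := B) hE.interval_U.1
    hE.interval_U.2.1 hE.U_pos hm1
  refine ⟨hs, fun p hp => (hd p hp).tx, htu, hxu, hhu, heta, ?_, ?_, ?_, ?_, ?_, ?_, ?_, ?_⟩
  · rintro ⟨t, x, u⟩ hp
    by_cases hmn : E.m = E.n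
    · have h1 := (ind' (A := -pd eT (cX V) (t, x, u)) fun v hv => by
        have := split1 t x u hp v hv
        rw [← hmn, add_assoc, ← add_mul] at this
        exact this).1
      simpa using h1
    · simpa using (ind (fun h => hmn (by linarith)) (split1 t x u hp)).1
  · rintro ⟨t, x, u⟩ hp
    by_cases hmn : E.m = E.n
    · exact (ind' (A := pd eT (cH V) (t, x, u)) fun v hv => by
        have := split0 t x u hp v hv
        rw [← hmn, add_assoc, ← add_mul] at this
        exact this).1
    · exact (ind (fun h => hmn (by linarith)) (split0 t x u hp)).1
  · intro p hp
    have h1 := (hd p hp).e3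
    rw [Eqn.det3, heta p hp] at h1
    apply mul_left_cancel₀ (hu p hp).ne'
    linear_combination h1
  · intro p hp
    have h1 := (hd p hp).e2
    rw [Eqn.det2, ex hp] at h1
    apply mul_left_cancel₀ (hu p hp).ne'
    linear_combination h1
  · rintro hmn ⟨t, x, u⟩ hp
    obtain ⟨-, h2, h3⟩ := ind (fun h => hmn (by linarith)) (split1 t x u hp)
    constructor
    · apply mul_left_cancel₀ hε
      linear_combination h2
    · apply mul_left_cancel₀ (hnf _ hp)
      linear_combination h3
  · rintro hmn ⟨t, x, u⟩ hp
    obtain ⟨-, h2, h3⟩ := ind (fun h => hmn (by linarith)) (split0 t x u hp)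
    apply mul_left_cancel₀ hε
    linear_combination h2
  · rintro hmn ⟨t, x, u⟩ hp
    have h1 := (ind' fun v hv => by
        have := split1 t x u hp v hv
        rw [← hmn, add_assoc, ← add_mul] at this
        exact this).2
    apply mul_left_cancel₀ (hmn ▸ hE.n_ne_zero : E.m ≠ 0)
    rw [← hmn]
    linear_combination h1
  · rintro hmn ⟨t, x, u⟩ hp
    have h1 := (ind' fun v hv => by
        have := split0 t x u hp v hv
        rw [← hmn, add_assoc, ← add_mul] at this
        exact this).2
    apply mul_left_cancel₀ (hmn ▸ hE.n_ne_zero : E.m ≠ 0)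
    linear_combination h1

end

section
variable {E : Eqn} {V W : VField}

lemma Eqn.mem_maxAlg_congr (hE : E.Admissible) (h : EqOn V W E.domain) (hW : W ∈ E.maxAlg) :
    V ∈ E.maxAlg := by
  rw [Eqn.mem_maxAlg_iff hE] at hW ⊢
  obtain ⟨hs, hd⟩ := hW
  refine ⟨hs.congr h, fun p hp => ?_⟩
  have hD := hE.isOpen_domain
  have hT : EqOn (cT V) (cT W) E.domain := fun q hq => by simp [cT, h hq]
  have hX : EqOn (cX V) (cX W) E.domain := fun q hq => by simp [cX, h hq]
  have hU : EqOn (cU V) (cU W) E.domain := fun q hq => by simp [cU, h hq]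
  have g1 := fun v w => pd_congr hD (pd_congr hD hX v) w
  have g2 := fun v w => pd_congr hD (pd_congr hD hU v) w
  obtain ⟨h1, h2, h3, h4, h5, h6, h7, h8⟩ := hd p hp
  refine ⟨?_, ?_, ?_, ?_, ?_, ?_, ?_, ?_⟩
  · rw [pd_congr hD hT _ hp, h1]
  · rw [pd_congr hD hT _ hp, h2]
  · rw [pd_congr hD hX _ hp, h3]
  · rw [pd_congr hD hU _ hp, h4, hU hp]
  · rw [Eqn.det3] at h5 ⊢
    rw [pd_congr hD hT _ hp, pd_congr hD hX _ hp, hT hp, hU hp, h5]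
  · rw [Eqn.det2] at h6 ⊢
    rw [pd_congr hD hU _ hp, g1 _ _ hp, h6]
  · rw [Eqn.det1] at h7 ⊢
    rw [pd_congr hD hT _ hp, pd_congr hD hX _ hp, pd_congr hD hX _ hp, g2 _ _ hp,
      pd_congr hD (g1 _ _) _ hp, hU hp, h7]
  · rw [Eqn.det0] at h8 ⊢
    rw [pd_congr hD hU _ hp, pd_congr hD hU _ hp, pd_congr hD (g2 _ _) _ hp, h8]

/-! ### Fields with separated coefficients -/

/-- The field `(p t + d) ∂_t + ξ(x) ∂_x + h(x) u ∂_u`. -/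
def sepField (p d : ℝ) (ξ h : ℝ → ℝ) : VField :=
  fun q => (p * q.1 + d, ξ q.2.1, h q.2.1 * q.2.2)

lemma pd_comp_x {g : ℝ → ℝ} (hg : Differentiable ℝ g) (v p : Pt) :
    pd v (fun q => g q.2.1) p = v.2.1 * deriv g p.2.1 := by
  have h1 : HasFDerivAt (fun q : Pt => q.2.1) _ p :=
    (hasFDerivAt_snd (𝕜 := ℝ) (E := ℝ) (F := ℝ × ℝ)).fst
  have h := (hg p.2.1).hasDerivAt.comp_hasFDerivAt p h1
  have h' : fderiv ℝ (fun q : Pt => g q.2.1) p = _ := h.fderiv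
  simp [pd, h', mul_comm]

lemma pd_mul_u {g : ℝ → ℝ} (hg : Differentiable ℝ g) (v p : Pt) :
    pd v (fun q => g q.2.1 * q.2.2) p = v.2.1 * deriv g p.2.1 * p.2.2 + g p.2.1 * v.2.2 := by
  have h1 : HasFDerivAt (fun q : Pt => q.2.1) _ p :=
    (hasFDerivAt_snd (𝕜 := ℝ) (E := ℝ) (F := ℝ × ℝ)).fst
  have h2 : HasFDerivAt (fun q : Pt => q.2.2) _ p :=
    (hasFDerivAt_snd (𝕜 := ℝ) (E := ℝ) (F := ℝ × ℝ)).snd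
  have h := ((hg p.2.1).hasDerivAt.comp_hasFDerivAt p h1).mul h2
  have h' : fderiv ℝ (fun q : Pt => g q.2.1 * q.2.2) p = _ := h.fderiv
  simp [pd, h']
  ring

lemma pd_affine_t (a d : ℝ) (v p : Pt) : pd v (fun q => a * q.1 + d) p = v.1 * a := by
  have h : HasFDerivAt (fun q : Pt => a * q.1 + d) _ p :=
    ((hasFDerivAt_fst (𝕜 := ℝ) (E := ℝ) (F := ℝ × ℝ)).const_mul a).add_const d
  simp [pd, h.fderiv, mul_comm]

lemma sepField_mem_maxAlg (hE : E.Admissible) {p d : ℝ} {ξ h : ℝ → ℝ} (hξ : ContDiff ℝ ∞ ξ)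
    (hh : ContDiff ℝ ∞ h)
    (h3 : ∀ t ∈ E.I, ∀ x ∈ E.X, (E.n - 1) * E.f t * h x =
      3 * E.f t * deriv ξ x - E.f t * p - (p * t + d) * deriv E.f t)
    (h2 : ∀ x ∈ E.X, E.n * deriv h x = deriv (deriv ξ) x)
    (h1 : ∀ t ∈ E.I, ∀ x ∈ E.X, ∀ u ∈ E.U,
      E.ε * E.m * u ^ (E.m - 1) * ((E.m - 1) * h x + p - deriv ξ x) + E.n * E.f t * u ^ (E.n - 1) *
        (3 * E.n * deriv (deriv h) x - deriv (deriv (deriv ξ)) x) = 0)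
    (h0 : ∀ t ∈ E.I, ∀ x ∈ E.X, ∀ u ∈ E.U, E.ε * E.m * u ^ (E.m - 1) * deriv h x
      + E.n * E.f t * u ^ (E.n - 1) * deriv (deriv (deriv h)) x = 0) :
    sepField p d ξ h ∈ E.maxAlg := by
  have dξ : ContDiff ℝ ∞ (deriv ξ) := (contDiff_infty_iff_deriv.1 hξ).2
  have ddξ : ContDiff ℝ ∞ (deriv (deriv ξ)) := (contDiff_infty_iff_deriv.1 dξ).2
  have dh : ContDiff ℝ ∞ (deriv h) := (contDiff_infty_iff_deriv.1 hh).2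
  have ddh : ContDiff ℝ ∞ (deriv (deriv h)) := (contDiff_infty_iff_deriv.1 dh).2
  have tX : eX.2.1 = 1 := rfl
  have tU : eX.2.2 = 0 := rfl
  have x1 : ∀ {g : ℝ → ℝ}, ContDiff ℝ ∞ g →
      pd eX (fun q => g q.2.1) = fun q => deriv g q.2.1 := fun hg => by
    funext q; rw [pd_comp_x (hg.differentiable (by simp)), tX, one_mul]
  have u1 : ∀ {g : ℝ → ℝ}, ContDiff ℝ ∞ g →
      pd eX (fun q => g q.2.1 * q.2.2) = fun q => deriv g q.2.1 * q.2.2 := fun hg => by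
    funext q; rw [pd_mul_u (hg.differentiable (by simp)), tX, tU]; ring
  have eT' : cT (sepField p d ξ h) = fun q => p * q.1 + d := rfl
  have eX' : cX (sepField p d ξ h) = fun q => ξ q.2.1 := rfl
  have eU' : cU (sepField p d ξ h) = fun q => h q.2.1 * q.2.2 := rfl
  refine Eqn.mem_maxAlg_of_detEqs hE ?_ fun q hq => ?_
  · refine ContDiff.contDiffOn ?_
    unfold sepField
    fun_prop
  have hu := (hE.pos q hq).ne'
  refine ⟨?_, ?_, ?_, ?_, ?_, ?_, ?_, ?_⟩
  · rw [eT', pd_affine_t]; simp [eX]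
  · rw [eT', pd_affine_t]; simp [eU]
  · rw [eX', pd_comp_x (hξ.differentiable (by simp))]; simp [eU]
  · rw [eU', pd_mul_u (hh.differentiable (by simp))]; simp [eU]; ring
  · have := h3 _ hq.1 _ hq.2.1
    rw [Eqn.det3, eT', eX', eU', pd_affine_t, x1 hξ]
    simp only [eT]
    linear_combination q.2.2 * this
  · have := h2 _ hq.2.1
    rw [Eqn.det2, eX', eU', u1 hh, x1 hξ, x1 dξ]
    linear_combination q.2.2 * this
  · have := h1 _ hq.1 _ hq.2.1 _ hq.2.2
    rw [Eqn.det1, eT', eX', eU', pd_affine_t, u1 hh, u1 dh, x1 hξ, x1 dξ, x1 ddξ,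
      pd_comp_x (hξ.differentiable (by simp))]
    simp only [eT, ← mul_assoc, mul_div_cancel_right₀ _ hu]
    simp only [mul_assoc] at this ⊢
    linear_combination this
  · have := h0 _ hq.1 _ hq.2.1 _ hq.2.2
    rw [Eqn.det0, eU', pd_mul_u (hh.differentiable (by simp)), u1 hh, u1 dh, u1 ddh]
    simp only [eT]
    linear_combination q.2.2 * this

/-- The field `(p t + d) ∂_t + ((p + (m - 1) c) x + b) ∂_x + c u ∂_u`. These are the fields that
rescale and shift the variables and leave the ratio of `u_t` and `(u^m)_x` unchanged. -/
def linField (m p c b d : ℝ) : VField :=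
  fun q => (p * q.1 + d, (p + (m - 1) * c) * q.2.1 + b, c * q.2.2)

/-- The equation for `f` is `det3`; the other determining equations hold identically, also for
`m = 0`. -/
lemma linField_mem_maxAlg (hE : E.Admissible) {p c d : ℝ} (b : ℝ)
    (h : ∀ t ∈ E.I, (p * t + d) * deriv E.f t = (2 * p + (3 * E.m - E.n - 2) * c) * E.f t) :
    linField E.m p c b d ∈ E.maxAlg := by
  have h1 : deriv (fun x : ℝ => (p + (E.m - 1) * c) * x + b) = fun _ => p + (E.m - 1) * c := by
    simp
  have h2 : deriv (fun _ : ℝ => c) = fun _ => 0 := by simp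
  have h3 : deriv (fun _ : ℝ => p + (E.m - 1) * c) = fun _ => 0 := by simp
  have h4 : deriv (fun _ : ℝ => (0 : ℝ)) = fun _ => 0 := by simp
  refine sepField_mem_maxAlg hE (ξ := fun x => (p + (E.m - 1) * c) * x + b) (h := fun _ => c)
    (by fun_prop) contDiff_const (fun t ht x hx => ?_) ?_ ?_ ?_
  · rw [h1]
    linear_combination h t ht
  all_goals
    intros
    simp only [h1, h2, h3, h4]
    ring

/-! ### Integration of the split equations -/

lemma pd_add {D : Set Pt} {F G : Pt → ℝ} {p : Pt} (hD : IsOpen D) (hF : ContDiffOn ℝ ∞ F D)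
    (hG : ContDiffOn ℝ ∞ G D) (hp : p ∈ D) (v : Pt) :
    pd v (fun q => F q + G q) p = pd v F p + pd v G p := by
  have h : HasFDerivAt (fun q => F q + G q) _ p :=
    (hasFDerivAt_of_contDiffOn hD hF hp).add (hasFDerivAt_of_contDiffOn hD hG hp)
  simp [pd, h.fderiv]

lemma exists_eq_add_const (hE : E.Admissible) {F G : Pt → ℝ} (hF : ContDiffOn ℝ ∞ F E.domain)
    (hG : ContDiffOn ℝ ∞ G E.domain) (ht : EqOn (pd eT F) (pd eT G) E.domain)
    (hx : EqOn (pd eX F) (pd eX G) E.domain) (hu : EqOn (pd eU F) (pd eU G) E.domain) :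
    ∃ c : ℝ, ∀ p ∈ E.domain, F p = G p + c := by
  have hD := hE.isOpen_domain
  obtain ⟨c, hc⟩ := eqOn_const_of_pd_eq_zero hD hE.isPreconnected_domain (hF.sub hG)
    (fun p hp => by rw [pd_sub hD hF hG hp, ht hp]; simp)
    (fun p hp => by rw [pd_sub hD hF hG hp, hx hp]; simp)
    (fun p hp => by rw [pd_sub hD hF hG hp, hu hp]; simp)
  exact ⟨c, fun p hp => by linarith [hc hp]⟩

namespace SplitEqs

lemma smooth_T (S : SplitEqs E V) : ContDiffOn ℝ ∞ (cT V) E.domain :=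
  (contDiffOn_vField_iff.1 S.smooth).1

lemma smooth_X (S : SplitEqs E V) : ContDiffOn ℝ ∞ (cX V) E.domain :=
  (contDiffOn_vField_iff.1 S.smooth).2.1

lemma smooth_H (S : SplitEqs E V) (hE : E.Admissible) : ContDiffOn ℝ ∞ (cH V) E.domain :=
  contDiffOn_pd hE.isOpen_domain (contDiffOn_vField_iff.1 S.smooth).2.2 eU

lemma cT_eq (S : SplitEqs E V) (hE : E.Admissible)
    (h : EqOn (pd eT (pd eT (cT V))) 0 E.domain) :
    ∃ p d : ℝ, (∀ q ∈ E.domain, cT V q = p * q.1 + d) ∧ ∀ q ∈ E.domain, pd eT (cT V) q = p := by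
  have hD := hE.isOpen_domain
  obtain ⟨p, hp⟩ := eqOn_const_of_pd_eq_zero hD hE.isPreconnected_domain
    (contDiffOn_pd hD S.smooth_T eT) h (eqOn_pd_pd_zero hD S.smooth_T S.tx eT)
    (eqOn_pd_pd_zero hD S.smooth_T S.tu eT)
  obtain ⟨d, hd⟩ := exists_eq_add_const hE (G := fun q => p * q.1 + 0) S.smooth_T (by fun_prop)
    (fun q hq => by rw [hp hq, pd_affine_t]; simp [eT])
    (fun q hq => by rw [S.tx hq, pd_affine_t]; simp [eX])
    (fun q hq => by rw [S.tu hq, pd_affine_t]; simp [eU])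
  exact ⟨p, d, fun q hq => by simpa using hd q hq, hp⟩

lemma cX_eq (S : SplitEqs E V) (hE : E.Admissible) {g : ℝ → ℝ} (hg : ContDiff ℝ ∞ g)
    (h : ∀ q ∈ E.domain, pd eX (cX V) q = deriv g q.2.1) :
    ∃ b : ℝ, ∀ q ∈ E.domain, cX V q = g q.2.1 + b := by
  have hg' := hg.differentiable (by simp)
  exact exists_eq_add_const hE (G := fun q => g q.2.1) S.smooth_X
    (ContDiff.contDiffOn (by fun_prop))
    (fun q hq => by rw [S.xt hq, pd_comp_x hg']; simp [eT])
    (fun q hq => by rw [h q hq, pd_comp_x hg']; simp [eX])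
    (fun q hq => by rw [S.xu hq, pd_comp_x hg']; simp [eU])

/-- Only for `n = -1/2` can the rescaling of `u` depend on `x`. -/
lemma two_mul_add_one_mul (S : SplitEqs E V) (hE : E.Admissible) {q : Pt} (hq : q ∈ E.domain) :
    (2 * E.n + 1) * pd eX (cH V) q = 0 := by
  have hD := hE.isOpen_domain
  have cf := hE.contDiffOn_f
  have cf' := hE.contDiffOn_deriv_f
  have cXx := contDiffOn_pd hD S.smooth_X eX
  have cTt := contDiffOn_pd hD S.smooth_T eT
  have cF := cf.mul (S.smooth_H hE)
  have s2 := cf.mul cXx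
  have s3 := cf.mul cTt
  have s4 := S.smooth_T.mul cf'
  have s5 := (contDiffOn_const (c := (3 : ℝ))).mul s2
  have ef : pd eX (fun q : Pt => E.f q.1) q = 0 := by
    rw [pd_comp_fst (hE.hasDerivAt_f hq.1).differentiableAt]; simp [eX]
  have ef' : pd eX (fun q : Pt => deriv E.f q.1) q = 0 := by
    rw [pd_comp_fst]
    · simp [eX]
    · exact ((hE.f_smooth.deriv_of_isOpen hE.interval_I.1 (m := ∞) (by simp)).contDiffAt
        (hE.interval_I.1.mem_nhds hq.1)).differentiableAt (by simp)
  have h := pd_congr hD (F := fun q => (E.n - 1) * (E.f q.1 * cH V q))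
    (G := fun q => 3 * (E.f q.1 * pd eX (cX V) q) - E.f q.1 * pd eT (cT V) q
      - cT V q * deriv E.f q.1)
    (fun q hq => by
      have := S.e3 q hq
      simp only
      linear_combination this) eX hq
  rw [pd_const_mul hD cF hq, pd_mul hD cf (S.smooth_H hE) hq, pd_sub hD (s5.sub s3) s4 hq,
    pd_sub hD s5 s3 hq, pd_const_mul hD s2 hq, pd_mul hD cf cXx hq, pd_mul hD cf cTt hq,
    pd_mul hD S.smooth_T cf' hq, ef, ef', S.tx hq, eqOn_pd_pd_zero hD S.smooth_T S.tx eT hq,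
    ← S.e2 q hq] at h
  simp only [Pi.zero_apply] at h
  apply mul_left_cancel₀ (hE.f_ne_zero _ hq.1)
  linear_combination -h

lemma exists_linear (S : SplitEqs E V) (hE : E.Admissible)
    (h : ∀ q ∈ E.domain, pd eX (cH V) q = 0) :
    ∃ a b c : ℝ, (∀ q ∈ E.domain, cX V q = a * q.2.1 + b) ∧
      (∀ q ∈ E.domain, pd eX (cX V) q = a) ∧ ∀ q ∈ E.domain, cH V q = c := by
  have hD := hE.isOpen_domain
  obtain ⟨c, hc⟩ := eqOn_const_of_pd_eq_zero hD hE.isPreconnected_domain (S.smooth_H hE) S.ht h S.hu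
  have cXx := contDiffOn_pd hD S.smooth_X eX
  obtain ⟨a, ha⟩ := eqOn_const_of_pd_eq_zero hD hE.isPreconnected_domain cXx
    (eqOn_pd_pd_zero hD S.smooth_X S.xt eX) (fun q hq => by rw [← S.e2 q hq, h q hq]; simp)
    (eqOn_pd_pd_zero hD S.smooth_X S.xu eX)
  obtain ⟨b, hb⟩ := S.cX_eq hE (g := fun x => a * x) (by fun_prop) (fun q hq => by
    rw [ha hq]; simp)
  exact ⟨a, b, c, hb, ha, hc⟩

end SplitEqs

/-- For `m ≠ 0` the rescaling of `u` does not depend on `x`, outside the exceptional case. -/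
lemma pd_eX_cH_eq_zero (S : SplitEqs E V) (hE : E.Admissible) (hm : E.m ≠ 0)
    (hsp : ¬(E.n = -1 / 2 ∧ E.m = -1 / 2) ∨ ∃ t ∈ E.I, ∃ t' ∈ E.I, E.f t ≠ E.f t') :
    ∀ q ∈ E.domain, pd eX (cH V) q = 0 := by
  rintro ⟨t₀, x, u⟩ hq
  by_cases hmn : E.m = E.n
  · by_cases hn : 2 * E.n + 1 = 0
    · rcases hsp with h | ⟨t, ht, t', ht', hne⟩
      · exact absurd ⟨by linarith, by linarith⟩ h
      -- `h_x` and `h_{xxx}` do not depend on `t`, while `f` does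
      have hD := hE.isOpen_domain
      have c1 := contDiffOn_pd hD (S.smooth_H hE) eX
      have c3 := contDiffOn_pd hD (contDiffOn_pd hD c1 eX) eX
      have z1 := eqOn_pd_pd_zero hD (S.smooth_H hE) S.ht eX
      have z3 := eqOn_pd_pd_zero hD (contDiffOn_pd hD c1 eX) (eqOn_pd_pd_zero hD c1 z1 eX) eX
      have q1 : (t, x, u) ∈ E.domain := ⟨ht, hq.2⟩
      have q2 : (t', x, u) ∈ E.domain := ⟨ht', hq.2⟩
      have h1 := S.eq0 hmn _ q1
      have h2 := S.eq0 hmn _ q2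
      rw [eq_of_pd_eT_eq_zero hE c1 z1 hq q1, eq_of_pd_eT_eq_zero hE c3 z3 hq q1] at h1
      rw [eq_of_pd_eT_eq_zero hE c1 z1 hq q2, eq_of_pd_eT_eq_zero hE c3 z3 hq q2] at h2
      have h3 : pd eX (pd eX (pd eX (cH V))) (t₀, x, u) = 0 := by
        apply mul_left_cancel₀ (sub_ne_zero.2 hne)
        linear_combination h1 - h2
      rw [h3, mul_zero, add_zero] at h1
      exact (mul_eq_zero.1 h1).resolve_left hE.eps_ne_zero
    · exact (mul_eq_zero.1 (S.two_mul_add_one_mul hE hq)).resolve_left hn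
  · exact (mul_eq_zero.1 (S.ne0 hmn _ hq)).resolve_left hm

lemma vField_ext {p : Pt} {a b c : ℝ} (h1 : cT V p = a) (h2 : cX V p = b) (h3 : cU V p = c) :
    V p = (a, b, c) := by
  rw [← h1, ← h2, ← h3]; rfl

/-- For `m ≠ 0` the Lie symmetries are the fields `linField` subject to a first-order equation
for `f`, unless `n = m = -1/2` and `f` is constant. -/
lemma mem_maxAlg_iff_linField (hE : E.Admissible) (hm : E.m ≠ 0)
    (hsp : ¬(E.n = -1 / 2 ∧ E.m = -1 / 2) ∨ ∃ t ∈ E.I, ∃ t' ∈ E.I, E.f t ≠ E.f t')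
    (V : VField) :
    V ∈ E.maxAlg ↔ ∃ p c b d : ℝ, EqOn V (linField E.m p c b d) E.domain ∧
      ∀ t ∈ E.I, (p * t + d) * deriv E.f t = (2 * p + (3 * E.m - E.n - 2) * c) * E.f t := by
  constructor
  · intro hV
    have S := splitEqs_of_mem hE hV
    have hD := hE.isOpen_domain
    have hx := pd_eX_cH_eq_zero S hE hm hsp
    obtain ⟨a, b, c, h1, h1', h2⟩ := S.exists_linear hE hx
    have hτ : ∀ q ∈ E.domain, pd eT (cT V) q = a - (E.m - 1) * c := fun q hq => by
      by_cases hmn : E.m = E.n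
      · have e := S.eq1 hmn q hq
        have z2 : pd eX (pd eX (cH V)) q = 0 := pd_zero_of_eqOn hD hx eX hq
        have z3 : pd eX (pd eX (pd eX (cX V))) q = 0 :=
          pd_zero_of_eqOn hD (fun q hq => by rw [← S.e2 q hq, hx q hq]; simp) eX hq
        rw [z2, z3, h2 q hq, h1' q hq] at e
        have e' : (E.m - 1) * c + pd eT (cT V) q - a = 0 := by
          apply mul_left_cancel₀ hE.eps_ne_zero
          linear_combination e
        linear_combination e'
      · have e := (mul_eq_zero.1 (S.ne1 hmn q hq).1).resolve_left hm
        rw [h2 q hq, h1' q hq] at e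
        linear_combination e
    obtain ⟨p, d, h3, h3'⟩ := S.cT_eq hE (fun q hq => by
      rw [pd_congr hD (G := fun _ => a - (E.m - 1) * c) hτ eT hq]; simp [pd])
    obtain ⟨t₀, ht₀⟩ := hE.interval_I.2.1
    obtain ⟨x₀, hx₀⟩ := hE.interval_X.2.1
    obtain ⟨u₀, hu₀⟩ := hE.interval_U.2.1
    have hq₀ : (t₀, x₀, u₀) ∈ E.domain := ⟨ht₀, hx₀, hu₀⟩
    have hp : a = p + (E.m - 1) * c := by
      linear_combination (hτ _ hq₀).symm.trans (h3' _ hq₀)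
    refine ⟨p, c, b, d, fun q hq => ?_, fun t ht => ?_⟩
    · exact vField_ext (h3 q hq) (hp ▸ h1 q hq) (by rw [S.eta q hq, h2 q hq])
    · have hq : (t, x₀, u₀) ∈ E.domain := ⟨ht, hx₀, hu₀⟩
      have e := S.e3 _ hq
      rw [h2 _ hq, h1' _ hq, h3' _ hq, h3 _ hq, hp] at e
      simp only at e
      linear_combination e
  · rintro ⟨p, c, b, d, h, hf⟩
    exact Eqn.mem_maxAlg_congr hE h (linField_mem_maxAlg hE b hf)

end

/-! ### Elementary families of functions -/

lemma deriv_quad (a b c : ℝ) :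
    deriv (fun x : ℝ => c + a * x + b * x ^ 2) = fun x => a + 2 * b * x + 0 * x ^ 2 := by
  funext x
  have h := ((((hasDerivAt_id x).const_mul a).const_add c).add
    ((hasDerivAt_pow 2 x).const_mul b)).deriv
  refine Eq.trans h ?_
  push_cast
  ring

lemma deriv_trig (a b c : ℝ) :
    deriv (fun x : ℝ => c + a * Real.sin x + b * Real.cos x) =
      fun x => 0 + (-b) * Real.sin x + a * Real.cos x := by
  funext x
  have h := ((((Real.hasDerivAt_sin x).const_mul a).const_add c).add
    ((Real.hasDerivAt_cos x).const_mul b)).deriv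
  refine Eq.trans h ?_
  ring

lemma deriv_expPair (a b c : ℝ) :
    deriv (fun x : ℝ => c + a * Real.exp x + b * Real.exp (-x)) =
      fun x => 0 + a * Real.exp x + (-b) * Real.exp (-x) := by
  funext x
  have h := ((((Real.hasDerivAt_exp x).const_mul a).const_add c).add
    ((hasDerivAt_id x).neg.exp.const_mul b)).deriv
  refine Eq.trans h ?_
  simp

lemma hasDerivAt_of_deriv_eq {g g' : ℝ → ℝ} (hg : Differentiable ℝ g) (h : deriv g = g') (x : ℝ) :
    HasDerivAt g (g' x) x := h ▸ (hg x).hasDerivAt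

section
variable {S : Set ℝ}

lemma deriv_eq_zero_on (hS : IsOpen S) {g g' : ℝ → ℝ} (hg : Differentiable ℝ g) (h : deriv g = g')
    (h0 : ∀ x ∈ S, g x = 0) : ∀ x ∈ S, g' x = 0 := fun x hx =>
  deriv_eq_zero_of_eqOn_zero hS h0 hx (hasDerivAt_of_deriv_eq hg h x)

lemma quad_indep (hS : IsOpen S) (hne : S.Nonempty) {a b c : ℝ}
    (h : ∀ x ∈ S, c + a * x + b * x ^ 2 = 0) : c = 0 ∧ a = 0 ∧ b = 0 := by
  have h1 := deriv_eq_zero_on hS (by fun_prop) (deriv_quad a b c) h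
  have h2 := deriv_eq_zero_on hS (by fun_prop) (deriv_quad _ _ _) h1
  obtain ⟨x, hx⟩ := hne
  have hb : b = 0 := by linarith [h2 x hx]
  have ha : a = 0 := by simpa [hb] using h1 x hx
  exact ⟨by simpa [ha, hb] using h x hx, ha, hb⟩

lemma affine_indep (hS : IsOpen S) (hne : S.Nonempty) {a c : ℝ}
    (h : ∀ x ∈ S, c + a * x = 0) : c = 0 ∧ a = 0 := by
  obtain ⟨h1, h2, -⟩ := quad_indep hS hne (a := a) (b := 0) (c := c)
    (fun x hx => by linarith [h x hx])
  exact ⟨h1, h2⟩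

lemma trig_indep (hS : IsOpen S) (hne : S.Nonempty) {a b c : ℝ}
    (h : ∀ x ∈ S, c + a * Real.sin x + b * Real.cos x = 0) : c = 0 ∧ a = 0 ∧ b = 0 := by
  have h1 := deriv_eq_zero_on hS (by fun_prop) (deriv_trig a b c) h
  have h2 := deriv_eq_zero_on hS (by fun_prop) (deriv_trig _ _ _) h1
  obtain ⟨x, hx⟩ := hne
  have e1 := h1 x hx
  have e2 := h2 x hx
  have hs := Real.sin_sq_add_cos_sq x
  have ha : a = 0 := by
    linear_combination Real.cos x * e1 - Real.sin x * e2 - a * hs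
  have hb : b = 0 := by
    linear_combination -Real.sin x * e1 - Real.cos x * e2 - b * hs
  exact ⟨by simpa [ha, hb] using h x hx, ha, hb⟩

lemma expPair_indep (hS : IsOpen S) (hne : S.Nonempty) {a b c : ℝ}
    (h : ∀ x ∈ S, c + a * Real.exp x + b * Real.exp (-x) = 0) : c = 0 ∧ a = 0 ∧ b = 0 := by
  have h1 := deriv_eq_zero_on hS (by fun_prop) (deriv_expPair a b c) h
  have h2 := deriv_eq_zero_on hS (by fun_prop) (deriv_expPair _ _ _) h1
  obtain ⟨x, hx⟩ := hne
  have e1 := h1 x hx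
  have e2 := h2 x hx
  have ha : a = 0 := by
    apply mul_right_cancel₀ (Real.exp_pos x).ne'
    linear_combination (e1 + e2) / 2
  have hb : b = 0 := by
    apply mul_right_cancel₀ (Real.exp_pos (-x)).ne'
    linear_combination (e2 - e1) / 2
  exact ⟨by simpa [ha, hb] using h x hx, ha, hb⟩

end

section
variable {E : Eqn} {V : VField}

/-! ### Equations with `f = 1` -/

lemma deriv_f_of_eqOn (hE : E.Admissible) {g : ℝ → ℝ} (h : ∀ t ∈ E.I, E.f t = g t) :
    ∀ t ∈ E.I, deriv E.f t = deriv g t := fun t ht => by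
  have h1 : E.f =ᶠ[nhds t] g := Filter.mem_of_superset (hE.interval_I.1.mem_nhds ht) h
  exact h1.deriv_eq

lemma deriv_f_eq_zero_of_const (hE : E.Admissible) {κ : ℝ} (h : ∀ t ∈ E.I, E.f t = κ) :
    ∀ t ∈ E.I, deriv E.f t = 0 := fun t ht => by
  simpa using deriv_f_of_eqOn hE h t ht

lemma exists_ne_of_deriv_ne_zero (hE : E.Admissible) {t : ℝ} (ht : t ∈ E.I)
    (h : deriv E.f t ≠ 0) : ∃ t ∈ E.I, ∃ t' ∈ E.I, E.f t ≠ E.f t' := by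
  by_contra! hc
  exact h (deriv_f_eq_zero_of_const hE (κ := E.f t) (fun s hs => hc s hs t ht) t ht)

/-- For `f = 1` the equation `det3` reads `(n - 1) h = 3 ξ_x - τ_t`, where `h` and `ξ` do not depend
on `t`. -/
lemma SplitEqs.cT_cH_eq (S : SplitEqs E V) (hE : E.Admissible) (hf : ∀ t ∈ E.I, E.f t = 1) :
    ∃ p d : ℝ, (∀ q ∈ E.domain, cT V q = p * q.1 + d) ∧
      ∀ q ∈ E.domain, (E.n - 1) * cH V q = 3 * pd eX (cX V) q - p := by
  have hD := hE.isOpen_domain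
  have hf' := deriv_f_eq_zero_of_const hE hf
  have e3 : ∀ q ∈ E.domain, pd eT (cT V) q = 3 * pd eX (cX V) q - (E.n - 1) * cH V q :=
    fun q hq => by
      have := S.e3 q hq
      rw [hf _ hq.1, hf' _ hq.1] at this
      linear_combination this
  have cXx := contDiffOn_pd hD S.smooth_X eX
  have cH' := S.smooth_H hE
  obtain ⟨p, d, h1, h2⟩ := S.cT_eq hE (fun q hq => by
    rw [pd_congr hD (G := fun q => 3 * pd eX (cX V) q - (E.n - 1) * cH V q) e3 eT hq,
      pd_sub hD (contDiffOn_const.mul cXx) (contDiffOn_const.mul cH') hq, pd_const_mul hD cXx hq,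
      pd_const_mul hD cH' hq, S.ht hq, eqOn_pd_pd_zero hD S.smooth_X S.xt eX hq]
    simp)
  refine ⟨p, d, h1, fun q hq => ?_⟩
  have := e3 q hq
  rw [h2 q hq] at this
  linear_combination this

/-- In the case `m = 0`, `f = 1` the coefficient `ξ` is a quadratic polynomial in `x`. -/
lemma SplitEqs.quad_of_m_eq_zero (S : SplitEqs E V) (hE : E.Admissible) (hm : E.m = 0) :
    ∃ a b c : ℝ, (∀ q ∈ E.domain, cX V q = c + a * q.2.1 + b * q.2.1 ^ 2) ∧
      (∀ q ∈ E.domain, pd eX (cX V) q = a + 2 * b * q.2.1) ∧ (E.n ≠ -1 / 2 → b = 0) := by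
  have hD := hE.isOpen_domain
  have hmn : E.m ≠ E.n := hm ▸ hE.n_ne_zero.symm
  have cH' := S.smooth_H hE
  have cHx := contDiffOn_pd hD cH' eX
  have cXx := contDiffOn_pd hD S.smooth_X eX
  have cXxx := contDiffOn_pd hD cXx eX
  have hxxx : EqOn (pd eX (pd eX (pd eX (cX V)))) 0 E.domain := fun q hq => by
    have h1 := pd_congr hD (F := fun q => E.n * pd eX (cH V) q) S.e2 eX hq
    rw [pd_const_mul hD cHx hq] at h1
    have h2 := (S.ne1 hmn q hq).2
    simp only [Pi.zero_apply]
    linear_combination (h2 - 3 * h1) / 2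
  obtain ⟨b, hb⟩ := eqOn_const_of_pd_eq_zero hD hE.isPreconnected_domain cXxx
    (eqOn_pd_pd_zero hD cXx (eqOn_pd_pd_zero hD S.smooth_X S.xt eX) eX) hxxx
    (eqOn_pd_pd_zero hD cXx (eqOn_pd_pd_zero hD S.smooth_X S.xu eX) eX)
  have hlin : Differentiable ℝ (fun x : ℝ => 0 + b * x + 0 * x ^ 2) := by fun_prop
  obtain ⟨a, ha⟩ := exists_eq_add_const hE
    (G := fun q => (fun x : ℝ => 0 + b * x + 0 * x ^ 2) q.2.1)
    cXx (by fun_prop)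
    (fun q hq => by
      rw [eqOn_pd_pd_zero hD S.smooth_X S.xt eX hq, pd_comp_x hlin]; simp [eT])
    (fun q hq => by rw [hb hq, pd_comp_x hlin, deriv_quad]; simp [eX])
    (fun q hq => by
      rw [eqOn_pd_pd_zero hD S.smooth_X S.xu eX hq, pd_comp_x hlin]; simp [eU])
  obtain ⟨c, hc⟩ := S.cX_eq hE (g := fun x => 0 + a * x + (b / 2) * x ^ 2) (by fun_prop)
    (fun q hq => by rw [ha q hq, deriv_quad]; ring)
  refine ⟨a, b / 2, c, fun q hq => by rw [hc q hq]; ring, fun q hq => by rw [ha q hq]; ring, ?_⟩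
  intro hn
  obtain ⟨t₀, ht₀⟩ := hE.interval_I.2.1
  obtain ⟨x₀, hx₀⟩ := hE.interval_X.2.1
  obtain ⟨u₀, hu₀⟩ := hE.interval_U.2.1
  have hq : (t₀, x₀, u₀) ∈ E.domain := ⟨ht₀, hx₀, hu₀⟩
  have h1 := (mul_eq_zero.1 (S.two_mul_add_one_mul hE hq)).resolve_left (fun h => hn (by linarith))
  have h2 := S.e2 _ hq
  rw [h1, hb hq] at h2
  linarith

/-- For `n = m = -1/2`, `f = 1` the coefficient `ξ` solves `ξ_{xx} + ε ξ = const`. -/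
lemma SplitEqs.exists_cX_ode (S : SplitEqs E V) (hE : E.Admissible) (hn : E.n = -1 / 2)
    (hm : E.m = -1 / 2) (hf : ∀ t ∈ E.I, E.f t = 1) :
    ∃ K p d : ℝ, (∀ q ∈ E.domain, cT V q = p * q.1 + d) ∧
      (∀ q ∈ E.domain, cH V q = -2 * pd eX (cX V) q + 2 / 3 * p) ∧
      ∀ q ∈ E.domain, pd eX (pd eX (cX V)) q = K - E.ε * cX V q := by
  have hD := hE.isOpen_domain
  obtain ⟨p, d, h1, h2⟩ := S.cT_cH_eq hE hf
  have h2' : ∀ q ∈ E.domain, cH V q = -2 * pd eX (cX V) q + 2 / 3 * p := fun q hq => by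
    have := h2 q hq
    rw [hn] at this
    linear_combination -2 / 3 * this
  have cH' := S.smooth_H hE
  have cHx := contDiffOn_pd hD cH' eX
  have cXx := contDiffOn_pd hD S.smooth_X eX
  have cXxx := contDiffOn_pd hD cXx eX
  have hxxx : ∀ q ∈ E.domain, pd eX (pd eX (pd eX (cX V))) q = -E.ε * pd eX (cX V) q :=
    fun q hq => by
      have e1 := pd_congr hD (F := fun q => E.n * pd eX (cH V) q) S.e2 eX hq
      rw [pd_const_mul hD cHx hq] at e1
      have e2 := S.eq1 (hm.trans hn.symm) q hq
      have e3 := S.e3 q hq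
      rw [hf _ hq.1, deriv_f_eq_zero_of_const hE hf _ hq.1] at e3
      rw [hf _ hq.1] at e2
      rw [hn] at e1 e2 e3
      rw [hm] at e2
      linear_combination (e2 - 3 * e1 - E.ε * e3) / 2
  have hz : ∀ v, EqOn (pd v (cX V)) 0 E.domain → EqOn (pd v (pd eX (pd eX (cX V)))) 0 E.domain :=
    fun v hv => eqOn_pd_pd_zero hD cXx (eqOn_pd_pd_zero hD S.smooth_X hv eX) eX
  obtain ⟨K, hK⟩ := exists_eq_add_const hE (F := pd eX (pd eX (cX V)))
    (G := fun q => -E.ε * cX V q) cXxx (contDiffOn_const.mul S.smooth_X)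
    (fun q hq => by rw [hz eT S.xt hq, pd_const_mul hD S.smooth_X hq, S.xt hq]; simp)
    (fun q hq => by rw [hxxx q hq, pd_const_mul hD S.smooth_X hq])
    (fun q hq => by rw [hz eU S.xu hq, pd_const_mul hD S.smooth_X hq, S.xu hq]; simp)
  exact ⟨K, p, d, h1, h2', fun q hq => by rw [hK q hq]; ring⟩

/-- A first integral of the form `(ξ - K) α(x) + ξ_x β(x)` of `ξ_{xx} = ε (K - ξ)`. -/
lemma SplitEqs.exists_first_integral (S : SplitEqs E V) (hE : E.Admissible) {K : ℝ} {α β : ℝ → ℝ}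
    (hα : ContDiff ℝ ∞ α) (hβ : ContDiff ℝ ∞ β)
    (hK : ∀ q ∈ E.domain, pd eX (pd eX (cX V)) q = E.ε * (K - cX V q))
    (h1 : ∀ x, deriv α x = E.ε * β x) (h2 : ∀ x, deriv β x = -α x) :
    ∃ a : ℝ, ∀ q ∈ E.domain, (cX V q - K) * α q.2.1 + pd eX (cX V) q * β q.2.1 = a := by
  have hD := hE.isOpen_domain
  have cXx := contDiffOn_pd hD S.smooth_X eX
  have cα : ContDiffOn ℝ ∞ (fun q : Pt => α q.2.1) E.domain := ContDiff.contDiffOn (by fun_prop)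
  have cβ : ContDiffOn ℝ ∞ (fun q : Pt => β q.2.1) E.domain := ContDiff.contDiffOn (by fun_prop)
  have cF : ContDiffOn ℝ ∞ (fun q => cX V q - K) E.domain := S.smooth_X.sub contDiffOn_const
  have key : ∀ v, ∀ q ∈ E.domain,
      pd v (fun q => (cX V q - K) * α q.2.1 + pd eX (cX V) q * β q.2.1) q =
        pd v (cX V) q * α q.2.1 + (cX V q - K) * (v.2.1 * (E.ε * β q.2.1))
          + (pd v (pd eX (cX V)) q * β q.2.1 + pd eX (cX V) q * (v.2.1 * -α q.2.1)) := by
    intro v q hq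
    have hF : pd v (fun q => cX V q - K) q = pd v (cX V) q := by
      rw [pd_sub hD S.smooth_X contDiffOn_const hq]; simp [pd]
    rw [pd_add hD (cF.mul cα) (cXx.mul cβ) hq, pd_mul hD cF cα hq, pd_mul hD cXx cβ hq, hF,
      pd_comp_x (hα.differentiable (by simp)), pd_comp_x (hβ.differentiable (by simp)), h1, h2]
  refine eqOn_const_of_pd_eq_zero hD hE.isPreconnected_domain ((cF.mul cα).add (cXx.mul cβ))
    (fun q hq => ?_) (fun q hq => ?_) (fun q hq => ?_)
  · rw [key _ q hq, S.xt hq, eqOn_pd_pd_zero hD S.smooth_X S.xt eX hq]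
    simp [eT]
  · rw [key _ q hq, hK q hq]
    simp [eX]
    ring
  · rw [key _ q hq, S.xu hq, eqOn_pd_pd_zero hD S.smooth_X S.xu eX hq]
    simp [eU]

end

section
variable {E : Eqn} {V : VField}

/-! ### Bases of the algebras in the listed cases -/

lemma sum_smul_one (e : Fin 1 → ℝ) (b₀ : VField) (p : Pt) :
    (∑ i, e i • ![b₀] i) p = e 0 • b₀ p := by
  simp

lemma sum_smul_two (e : Fin 2 → ℝ) (b₀ b₁ : VField) (p : Pt) :
    (∑ i, e i • ![b₀, b₁] i) p = e 0 • b₀ p + e 1 • b₁ p := by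
  simp [Fin.sum_univ_two]

lemma sum_smul_three (e : Fin 3 → ℝ) (b₀ b₁ b₂ : VField) (p : Pt) :
    (∑ i, e i • ![b₀, b₁, b₂] i) p = e 0 • b₀ p + e 1 • b₁ p + e 2 • b₂ p := by
  simp [Fin.sum_univ_three]

lemma sum_smul_four (e : Fin 4 → ℝ) (b₀ b₁ b₂ b₃ : VField) (p : Pt) :
    (∑ i, e i • ![b₀, b₁, b₂, b₃] i) p = e 0 • b₀ p + e 1 • b₁ p + e 2 • b₂ p + e 3 • b₃ p := by
  simp [Fin.sum_univ_four]

lemma sum_smul_five (e : Fin 5 → ℝ) (b₀ b₁ b₂ b₃ b₄ : VField) (p : Pt) :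
    (∑ i, e i • ![b₀, b₁, b₂, b₃, b₄] i) p =
      e 0 • b₀ p + e 1 • b₁ p + e 2 • b₂ p + e 3 • b₃ p + e 4 • b₄ p := by
  simp [Fin.sum_univ_five]

/-- A vanishing field has vanishing components. -/
lemma components_eq_zero {τ ξ η : Pt → ℝ}
    (h : EqOn (fun q => ((τ q, ξ q, η q) : Pt)) 0 E.domain) :
    ∀ t ∈ E.I, ∀ x ∈ E.X, ∀ u ∈ E.U, τ (t, x, u) = 0 ∧ ξ (t, x, u) = 0 ∧ η (t, x, u) = 0 :=
  fun t ht x hx u hu => by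
    have := h (show (t, x, u) ∈ E.domain from ⟨ht, hx, hu⟩)
    simpa using this

lemma isBasisOn_case3 (hE : E.Admissible) (hn : E.n ≠ -1 / 2) (hm : E.m = 0)
    (hf : ∀ t ∈ E.I, E.f t = 1) :
    IsBasisOn E.domain E.maxAlg ![dt, dx, scal E.n, fun p => (3 * p.1, p.2.1, 0)] := by
  have hn1 := sub_ne_zero.2 hE.n_ne_one
  obtain ⟨t₀, ht₀⟩ := hE.interval_I.2.1
  obtain ⟨x₀, hx₀⟩ := hE.interval_X.2.1
  obtain ⟨u₀, hu₀⟩ := hE.interval_U.2.1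
  refine ⟨fun V => ⟨fun hV => ?_, ?_⟩, fun e he => ?_⟩
  · have S := splitEqs_of_mem hE hV
    obtain ⟨p, d, h1, h2⟩ := S.cT_cH_eq hE hf
    obtain ⟨a, b, c, h3, h4, h5⟩ := S.quad_of_m_eq_zero hE hm
    have hb := h5 hn
    refine ⟨![d, c, a - p / 3, p / 3], fun q hq => ?_⟩
    rw [sum_smul_four]
    refine (vField_ext (h1 q hq) (h3 q hq) (S.eta q hq)).trans ?_
    have h6 := h2 q hq
    rw [h4 q hq] at h6
    have h7 : cH V q = (a - p / 3) * (3 / (E.n - 1)) := by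
      rw [hb] at h6
      field_simp
      linear_combination h6
    simp [dt, dx, scal, h7, hb]
    refine ⟨by ring, by ring, by ring⟩
  · rintro ⟨e, he⟩
    have h1 : ∀ a c : ℝ, deriv (fun x => c + a * x) = fun _ => a := fun a c => by simp
    refine Eqn.mem_maxAlg_congr hE (W := sepField (3 * e 3) (e 0) (fun x => e 1 + (e 2 + e 3) * x)
      (fun _ => 3 / (E.n - 1) * e 2)) (fun q hq => ?_) (sepField_mem_maxAlg hE (by fun_prop)
      (by fun_prop) (fun t ht x _ => ?_) (fun x _ => ?_) (fun t _ x _ u _ => ?_)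
      (fun t _ x _ u _ => ?_))
    · rw [he hq, sum_smul_four]
      simp [dt, dx, scal, sepField]
      refine ⟨by ring, by ring, by ring⟩
    · rw [h1, hf t ht, deriv_f_eq_zero_of_const hE hf t ht]
      field_simp
      ring
    · simp [h1]
    · simp [h1, hm]
    · simp
  · simp only [EqOn, sum_smul_four] at he
    have h := components_eq_zero (τ := fun q => e 0 + 3 * e 3 * q.1)
      (ξ := fun q => e 1 + (e 2 + e 3) * q.2.1) (η := fun q => 3 / (E.n - 1) * e 2 * q.2.2)
      (fun q hq => by
        rw [← he hq]
        simp [dt, dx, scal]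
        refine ⟨by ring, by ring, by ring⟩)
    obtain ⟨a1, a2⟩ := affine_indep hE.interval_I.1 hE.interval_I.2.1
      (fun t ht => (h t ht x₀ hx₀ u₀ hu₀).1)
    obtain ⟨a3, a4⟩ := affine_indep hE.interval_X.1 hE.interval_X.2.1
      (fun x hx => (h t₀ ht₀ x hx u₀ hu₀).2.1)
    funext i
    fin_cases i <;> simp <;> linarith

lemma isBasisOn_case4 (hE : E.Admissible) (hn : E.n = -1 / 2) (hm : E.m = 0)
    (hf : ∀ t ∈ E.I, E.f t = 1) :
    IsBasisOn E.domain E.maxAlg ![dt, dx, fun p => (0, p.2.1, -2 * p.2.2),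
      fun p => (3 * p.1, p.2.1, 0), fun p => (0, p.2.1 ^ 2, -4 * p.2.1 * p.2.2)] := by
  obtain ⟨t₀, ht₀⟩ := hE.interval_I.2.1
  obtain ⟨x₀, hx₀⟩ := hE.interval_X.2.1
  obtain ⟨u₀, hu₀⟩ := hE.interval_U.2.1
  refine ⟨fun V => ⟨fun hV => ?_, ?_⟩, fun e he => ?_⟩
  · have S := splitEqs_of_mem hE hV
    obtain ⟨p, d, h1, h2⟩ := S.cT_cH_eq hE hf
    obtain ⟨a, b, c, h3, h4, -⟩ := S.quad_of_m_eq_zero hE hm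
    refine ⟨![d, c, a - p / 3, p / 3, b], fun q hq => ?_⟩
    rw [sum_smul_five]
    refine (vField_ext (h1 q hq) (h3 q hq) (S.eta q hq)).trans ?_
    have h6 := h2 q hq
    rw [h4 q hq, hn] at h6
    have h7 : cH V q = -2 * (a - p / 3) - 4 * b * q.2.1 := by
      linear_combination -2 / 3 * h6
    simp [dt, dx, h7]
    refine ⟨by ring, by ring, by ring⟩
  · rintro ⟨e, he⟩
    refine Eqn.mem_maxAlg_congr hE (W := sepField (3 * e 3) (e 0)
      (fun x => e 1 + (e 2 + e 3) * x + e 4 * x ^ 2)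
      (fun x => -2 * e 2 + (-4 * e 4) * x + 0 * x ^ 2)) (fun q hq => ?_)
      (sepField_mem_maxAlg hE (by fun_prop)
      (by fun_prop) (fun t ht x _ => ?_) (fun x _ => ?_) (fun t _ x _ u _ => ?_)
      (fun t _ x _ u _ => ?_))
    · rw [he hq, sum_smul_five]
      simp [dt, dx, sepField]
      refine ⟨by ring, by ring, by ring⟩
    · rw [deriv_quad, hf t ht, deriv_f_eq_zero_of_const hE hf t ht, hn]
      ring
    · rw [deriv_quad, deriv_quad, deriv_quad, hn]; ring
    · simp only [deriv_quad, hm]; ring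
    · simp only [deriv_quad, hm]; ring
  · simp only [EqOn, sum_smul_five] at he
    have h := components_eq_zero (τ := fun q => e 0 + 3 * e 3 * q.1)
      (ξ := fun q => e 1 + (e 2 + e 3) * q.2.1 + e 4 * q.2.1 ^ 2)
      (η := fun q => (-2 * e 2 - 4 * e 4 * q.2.1) * q.2.2)
      (fun q hq => by
        rw [← he hq]
        simp [dt, dx]
        refine ⟨by ring, by ring, by ring⟩)
    obtain ⟨a1, a2⟩ := affine_indep hE.interval_I.1 hE.interval_I.2.1
      (fun t ht => (h t ht x₀ hx₀ u₀ hu₀).1)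
    obtain ⟨a3, a4, a5⟩ := quad_indep hE.interval_X.1 hE.interval_X.2.1
      (fun x hx => (h t₀ ht₀ x hx u₀ hu₀).2.1)
    funext i
    fin_cases i <;> simp <;> linarith

lemma isBasisOn_case6a (hE : E.Admissible) (hn : E.n = -1 / 2) (hm : E.m = -1 / 2)
    (hε : E.ε = 1) (hf : ∀ t ∈ E.I, E.f t = 1) :
    IsBasisOn E.domain E.maxAlg ![dt, dx, fun p => (3 * p.1, 0, 2 * p.2.2),
      fun p => (0, Real.sin p.2.1, -2 * Real.cos p.2.1 * p.2.2),
      fun p => (0, Real.cos p.2.1, 2 * Real.sin p.2.1 * p.2.2)] := by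
  obtain ⟨t₀, ht₀⟩ := hE.interval_I.2.1
  obtain ⟨x₀, hx₀⟩ := hE.interval_X.2.1
  obtain ⟨u₀, hu₀⟩ := hE.interval_U.2.1
  refine ⟨fun V => ⟨fun hV => ?_, ?_⟩, fun e he => ?_⟩
  · have S := splitEqs_of_mem hE hV
    obtain ⟨K, p, d, h1, h2, h3⟩ := S.exists_cX_ode hE hn hm hf
    have h3' : ∀ q ∈ E.domain, pd eX (pd eX (cX V)) q = E.ε * (K - cX V q) := fun q hq => by
      rw [h3 q hq, hε]; ring
    obtain ⟨a, ha⟩ := S.exists_first_integral hE Real.contDiff_sin Real.contDiff_cos h3'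
      (fun x => by simp [hε]) (fun x => by simp)
    obtain ⟨b, hb⟩ := S.exists_first_integral hE Real.contDiff_cos Real.contDiff_sin.neg h3'
      (fun x => by simp [hε]) (fun x => by simp)
    refine ⟨![d, K, p / 3, a, b], fun q hq => ?_⟩
    rw [sum_smul_five]
    have h4 : cX V q = K + a * Real.sin q.2.1 + b * Real.cos q.2.1 := by
      linear_combination Real.sin q.2.1 * ha q hq + Real.cos q.2.1 * hb q hq
        - (cX V q - K) * Real.sin_sq_add_cos_sq q.2.1
    have h5 : cH V q = 2 / 3 * p - 2 * (a * Real.cos q.2.1 - b * Real.sin q.2.1) := by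
      rw [h2 q hq]
      linear_combination -2 * (Real.cos q.2.1 * ha q hq - Real.sin q.2.1 * hb q hq
        - pd eX (cX V) q * Real.sin_sq_add_cos_sq q.2.1)
    refine (vField_ext (h1 q hq) h4 (S.eta q hq)).trans ?_
    simp [dt, dx, h5]
    refine ⟨by ring, by ring⟩
  · rintro ⟨e, he⟩
    refine Eqn.mem_maxAlg_congr hE (W := sepField (3 * e 2) (e 0)
      (fun x => e 1 + e 3 * Real.sin x + e 4 * Real.cos x)
      (fun x => 2 * e 2 + (2 * e 4) * Real.sin x + (-2 * e 3) * Real.cos x)) (fun q hq => ?_)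
      (sepField_mem_maxAlg hE (by fun_prop)
      (by fun_prop) (fun t ht x _ => ?_) (fun x _ => ?_) (fun t ht x _ u _ => ?_)
      (fun t ht x _ u _ => ?_))
    · rw [he hq, sum_smul_five]
      simp [dt, dx, sepField]
      refine ⟨by ring, by ring⟩
    · rw [deriv_trig, hf t ht, deriv_f_eq_zero_of_const hE hf t ht, hn]
      ring
    · rw [deriv_trig, deriv_trig, deriv_trig, hn]; ring
    · simp only [deriv_trig, hm, hn, hε, hf t ht]; ring
    · simp only [deriv_trig, hm, hn, hε, hf t ht]; ring
  · simp only [EqOn, sum_smul_five] at he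
    have h := components_eq_zero (τ := fun q => e 0 + 3 * e 2 * q.1)
      (ξ := fun q => e 1 + e 3 * Real.sin q.2.1 + e 4 * Real.cos q.2.1)
      (η := fun q => (2 * e 2 - 2 * e 3 * Real.cos q.2.1 + 2 * e 4 * Real.sin q.2.1) * q.2.2)
      (fun q hq => by
        rw [← he hq]
        simp [dt, dx]
        refine ⟨by ring, by ring⟩)
    obtain ⟨a1, a2⟩ := affine_indep hE.interval_I.1 hE.interval_I.2.1
      (fun t ht => (h t ht x₀ hx₀ u₀ hu₀).1)
    obtain ⟨a3, a4, a5⟩ := trig_indep hE.interval_X.1 hE.interval_X.2.1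
      (fun x hx => (h t₀ ht₀ x hx u₀ hu₀).2.1)
    funext i
    fin_cases i <;> simp <;> linarith

lemma isBasisOn_case6b (hE : E.Admissible) (hn : E.n = -1 / 2) (hm : E.m = -1 / 2)
    (hε : E.ε = -1) (hf : ∀ t ∈ E.I, E.f t = 1) :
    IsBasisOn E.domain E.maxAlg ![dt, dx, fun p => (3 * p.1, 0, 2 * p.2.2),
      fun p => (0, Real.exp p.2.1, -2 * Real.exp p.2.1 * p.2.2),
      fun p => (0, Real.exp (-p.2.1), 2 * Real.exp (-p.2.1) * p.2.2)] := by
  obtain ⟨t₀, ht₀⟩ := hE.interval_I.2.1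
  obtain ⟨x₀, hx₀⟩ := hE.interval_X.2.1
  obtain ⟨u₀, hu₀⟩ := hE.interval_U.2.1
  refine ⟨fun V => ⟨fun hV => ?_, ?_⟩, fun e he => ?_⟩
  · have S := splitEqs_of_mem hE hV
    obtain ⟨K, p, d, h1, h2, h3⟩ := S.exists_cX_ode hE hn hm hf
    have h3' : ∀ q ∈ E.domain, pd eX (pd eX (cX V)) q = E.ε * (-K - cX V q) := fun q hq => by
      rw [h3 q hq, hε]; ring
    have hd : ∀ x : ℝ, deriv (fun y => Real.exp (-y)) x = -Real.exp (-x) := fun x => by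
      simpa using ((hasDerivAt_id x).neg.exp).deriv
    obtain ⟨a, ha⟩ := S.exists_first_integral hE (α := fun x => Real.exp (-x))
      (β := fun x => Real.exp (-x)) (by fun_prop) (by fun_prop) h3'
      (fun x => by rw [hd, hε]; ring) hd
    obtain ⟨b, hb⟩ := S.exists_first_integral hE (α := Real.exp) (β := fun x => -Real.exp x)
      (by fun_prop) (by fun_prop) h3' (fun x => by simp [hε]) (fun x => by simp)
    refine ⟨![d, -K, p / 3, a / 2, b / 2], fun q hq => ?_⟩
    rw [sum_smul_five]
    have hee : Real.exp q.2.1 * Real.exp (-q.2.1) = 1 := by rw [← Real.exp_add]; simp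
    have h4 : cX V q = -K + a / 2 * Real.exp q.2.1 + b / 2 * Real.exp (-q.2.1) := by
      linear_combination Real.exp q.2.1 / 2 * ha q hq + Real.exp (-q.2.1) / 2 * hb q hq
        - (cX V q + K) * hee
    have h5 : cH V q = 2 / 3 * p - (a * Real.exp q.2.1 - b * Real.exp (-q.2.1)) := by
      rw [h2 q hq]
      linear_combination -(Real.exp q.2.1 * ha q hq - Real.exp (-q.2.1) * hb q hq
        - 2 * pd eX (cX V) q * hee)
    refine (vField_ext (h1 q hq) h4 (S.eta q hq)).trans ?_
    simp [dt, dx, h5]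
    refine ⟨by ring, by ring⟩
  · rintro ⟨e, he⟩
    refine Eqn.mem_maxAlg_congr hE (W := sepField (3 * e 2) (e 0)
      (fun x => e 1 + e 3 * Real.exp x + e 4 * Real.exp (-x))
      (fun x => 2 * e 2 + (-2 * e 3) * Real.exp x + (2 * e 4) * Real.exp (-x))) (fun q hq => ?_)
      (sepField_mem_maxAlg hE (by fun_prop)
      (by fun_prop) (fun t ht x _ => ?_) (fun x _ => ?_) (fun t ht x _ u _ => ?_)
      (fun t ht x _ u _ => ?_))
    · rw [he hq, sum_smul_five]
      simp [dt, dx, sepField]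
      refine ⟨by ring, by ring⟩
    · rw [deriv_expPair, hf t ht, deriv_f_eq_zero_of_const hE hf t ht, hn]
      ring
    · rw [deriv_expPair, deriv_expPair, deriv_expPair, hn]; ring
    · simp only [deriv_expPair, hm, hn, hε, hf t ht]; ring
    · simp only [deriv_expPair, hm, hn, hε, hf t ht]; ring
  · simp only [EqOn, sum_smul_five] at he
    have h := components_eq_zero (τ := fun q => e 0 + 3 * e 2 * q.1)
      (ξ := fun q => e 1 + e 3 * Real.exp q.2.1 + e 4 * Real.exp (-q.2.1))
      (η := fun q => (2 * e 2 - 2 * e 3 * Real.exp q.2.1 + 2 * e 4 * Real.exp (-q.2.1)) * q.2.2)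
      (fun q hq => by
        rw [← he hq]
        simp [dt, dx]
        refine ⟨by ring, by ring⟩)
    obtain ⟨a1, a2⟩ := affine_indep hE.interval_I.1 hE.interval_I.2.1
      (fun t ht => (h t ht x₀ hx₀ u₀ hu₀).1)
    obtain ⟨a3, a4, a5⟩ := expPair_indep hE.interval_X.1 hE.interval_X.2.1
      (fun x hx => (h t₀ ht₀ x hx u₀ hu₀).2.1)
    funext i
    fin_cases i <;> simp <;> linarith

end

section
variable {E : Eqn} {V : VField}

lemma isBasisOn_case5 (hE : E.Admissible) (hm : E.m ≠ 0)
    (hsp : ¬(E.n = -1 / 2 ∧ E.m = -1 / 2)) (hf : ∀ t ∈ E.I, E.f t = 1) :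
    IsBasisOn E.domain E.maxAlg ![dt, dx,
      fun p => ((3 * E.m - E.n - 2) * p.1, (E.m - E.n) * p.2.1, -2 * p.2.2)] := by
  obtain ⟨t₀, ht₀⟩ := hE.interval_I.2.1
  obtain ⟨x₀, hx₀⟩ := hE.interval_X.2.1
  obtain ⟨u₀, hu₀⟩ := hE.interval_U.2.1
  have hf' := deriv_f_eq_zero_of_const hE hf
  refine ⟨fun V => (mem_maxAlg_iff_linField hE hm (Or.inl hsp) V).trans ⟨?_, ?_⟩, fun e he => ?_⟩
  · rintro ⟨p, c, b, d, hV, h⟩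
    have h0 := h t₀ ht₀
    rw [hf' t₀ ht₀, hf t₀ ht₀] at h0
    have hp : p = -(3 * E.m - E.n - 2) * c / 2 := by linear_combination -h0 / 2
    refine ⟨![d, b, -c / 2], fun q hq => ?_⟩
    rw [hV hq, sum_smul_three]
    simp [dt, dx, linField, hp]
    refine ⟨by ring, by ring, by ring⟩
  · rintro ⟨e, he⟩
    refine ⟨(3 * E.m - E.n - 2) * e 2, -2 * e 2, e 1, e 0, fun q hq => ?_, fun t ht => ?_⟩
    · rw [he hq, sum_smul_three]
      simp [dt, dx, linField]
      refine ⟨by ring, by ring, by ring⟩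
    · rw [hf' t ht]; ring
  · simp only [EqOn, sum_smul_three] at he
    have h := components_eq_zero (τ := fun q => e 0 + e 2 * (3 * E.m - E.n - 2) * q.1)
      (ξ := fun q => e 1 + e 2 * (E.m - E.n) * q.2.1) (η := fun q => e 2 * -2 * q.2.2)
      (fun q hq => by
        rw [← he hq]
        simp [dt, dx]
        refine ⟨by ring, by ring, by ring⟩)
    have h2 : e 2 = 0 := by
      simpa [(hE.U_pos u₀ hu₀).ne'] using (h t₀ ht₀ x₀ hx₀ u₀ hu₀).2.2
    obtain ⟨h0, h1, -⟩ := h t₀ ht₀ x₀ hx₀ u₀ hu₀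
    simp only [h2] at h0 h1
    funext i
    fin_cases i <;> simp <;> linarith

lemma isBasisOn_case7 (hE : E.Admissible) (hm : E.m ≠ 0) (hK : E.m ≠ (E.n + 2) / 3) {k : ℝ}
    (hk : k ≠ 0) (hf : ∀ t ∈ E.I, 0 < t ∧ E.f t = t ^ k) :
    IsBasisOn E.domain E.maxAlg ![dx, fun p =>
      ((3 * E.m - E.n - 2) * p.1, (k * E.m - k + E.m - E.n) * p.2.1, (k - 2) * p.2.2)] := by
  obtain ⟨t₀, ht₀⟩ := hE.interval_I.2.1
  obtain ⟨x₀, hx₀⟩ := hE.interval_X.2.1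
  obtain ⟨u₀, hu₀⟩ := hE.interval_U.2.1
  have hK' : 3 * E.m - E.n - 2 ≠ 0 := fun h => hK (by linarith)
  have hf' : ∀ t ∈ E.I, deriv E.f t = k * t ^ k / t := fun t ht => by
    rw [deriv_f_of_eqOn hE (fun s hs => (hf s hs).2) t ht,
      (Real.hasDerivAt_rpow_const (Or.inl (hf t ht).1.ne')).deriv,
      Real.rpow_sub_one (hf t ht).1.ne', mul_div_assoc]
  have hne : ∃ t ∈ E.I, ∃ t' ∈ E.I, E.f t ≠ E.f t' :=
    exists_ne_of_deriv_ne_zero hE ht₀ (by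
      have h0 := (hf t₀ ht₀).1
      rw [hf' t₀ ht₀]
      exact div_ne_zero (mul_ne_zero hk (Real.rpow_pos_of_pos h0 k).ne') h0.ne')
  refine ⟨fun V => (mem_maxAlg_iff_linField hE hm (Or.inr hne) V).trans ⟨?_, ?_⟩, fun e he => ?_⟩
  · rintro ⟨p, c, b, d, hV, h⟩
    obtain ⟨a1, a2⟩ := affine_indep hE.interval_I.1 hE.interval_I.2.1
      (c := d * k) (a := p * k - (2 * p + (3 * E.m - E.n - 2) * c)) (fun t ht => by
        have h0 := (hf t ht).1
        have h1 := h t ht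
        rw [hf' t ht, (hf t ht).2] at h1
        apply mul_left_cancel₀ (Real.rpow_pos_of_pos h0 k).ne'
        field_simp at h1
        linear_combination t ^ k * h1)
    have hd : d = 0 := by simpa [hk] using a1
    obtain ⟨e, rfl⟩ : ∃ e, p = e * (3 * E.m - E.n - 2) :=
      ⟨p / (3 * E.m - E.n - 2), (div_mul_cancel₀ p hK').symm⟩
    have hc : c = e * (k - 2) := by
      apply mul_left_cancel₀ hK'
      linear_combination -a2
    refine ⟨![b, e], fun q hq => ?_⟩
    rw [hV hq, sum_smul_two]
    simp [dx, linField, hd, hc]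
    refine ⟨by ring, by ring, by ring⟩
  · rintro ⟨e, he⟩
    refine ⟨(3 * E.m - E.n - 2) * e 1, (k - 2) * e 1, e 0, 0, fun q hq => ?_, fun t ht => ?_⟩
    · rw [he hq, sum_smul_two]
      simp [dx, linField]
      refine ⟨by ring, by ring, by ring⟩
    · have h0 := (hf t ht).1.ne'
      rw [hf' t ht, (hf t ht).2]
      field_simp
      ring
  · simp only [EqOn, sum_smul_two] at he
    have h := components_eq_zero (τ := fun q => e 1 * (3 * E.m - E.n - 2) * q.1)
      (ξ := fun q => e 0 + e 1 * (k * E.m - k + E.m - E.n) * q.2.1)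
      (η := fun q => e 1 * (k - 2) * q.2.2)
      (fun q hq => by
        rw [← he hq]
        simp [dx]
        refine ⟨by ring, by ring, by ring⟩)
    obtain ⟨h0, h1, -⟩ := h t₀ ht₀ x₀ hx₀ u₀ hu₀
    have h2 : e 1 = 0 := by simpa [hK', (hf t₀ ht₀).1.ne'] using h0
    simp only [h2] at h1
    funext i
    fin_cases i <;> simp <;> linarith

lemma isBasisOn_case8 (hE : E.Admissible) (hm : E.m ≠ 0) (hK : E.m = (E.n + 2) / 3) {lam : ℝ}
    (hl : 0 < lam) (hf : ∀ t ∈ E.I, 0 < t ∧ E.f t = lam * t ^ 2) :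
    IsBasisOn E.domain E.maxAlg ![dx, scal E.n, fun p => (p.1, p.2.1, 0)] := by
  obtain ⟨t₀, ht₀⟩ := hE.interval_I.2.1
  obtain ⟨x₀, hx₀⟩ := hE.interval_X.2.1
  obtain ⟨u₀, hu₀⟩ := hE.interval_U.2.1
  have hn1 := sub_ne_zero.2 hE.n_ne_one
  have hf' : ∀ t ∈ E.I, deriv E.f t = lam * (2 * t) := fun t ht => by
    rw [deriv_f_of_eqOn hE (fun s hs => (hf s hs).2) t ht]
    simp
  refine ⟨fun V => (mem_maxAlg_iff_linField hE hm
    (Or.inl fun h => by rw [h.1, h.2] at hK; norm_num at hK) V).trans ⟨?_, ?_⟩, fun e he => ?_⟩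
  · rintro ⟨p, c, b, d, hV, h⟩
    have hd : d = 0 := by
      have h1 := h t₀ ht₀
      rw [hf' t₀ ht₀, (hf t₀ ht₀).2, hK] at h1
      apply mul_left_cancel₀ (mul_ne_zero hl.ne' (hf t₀ ht₀).1.ne')
      linear_combination h1 / 2
    refine ⟨![b, (E.n - 1) / 3 * c, p], fun q hq => ?_⟩
    rw [hV hq, sum_smul_three]
    simp [dx, linField, scal, hd, hK]
    refine ⟨by ring, ?_⟩
    field_simp
  · rintro ⟨e, he⟩
    refine ⟨e 2, 3 / (E.n - 1) * e 1, e 0, 0, fun q hq => ?_, fun t ht => ?_⟩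
    · rw [he hq, sum_smul_three]
      simp [dx, linField, scal, hK]
      refine ⟨?_, by ring⟩
      field_simp
      ring
    · rw [hf' t ht, (hf t ht).2, hK]
      ring
  · simp only [EqOn, sum_smul_three] at he
    have h := components_eq_zero (τ := fun q => e 2 * q.1)
      (ξ := fun q => e 0 + (e 1 + e 2) * q.2.1) (η := fun q => e 1 * (3 / (E.n - 1)) * q.2.2)
      (fun q hq => by
        rw [← he hq]
        simp [dx, scal]
        refine ⟨by ring, by ring⟩)
    obtain ⟨h0, h1, h3⟩ := h t₀ ht₀ x₀ hx₀ u₀ hu₀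
    have h2 : e 2 = 0 := by simpa [(hf t₀ ht₀).1.ne'] using h0
    have h4 : e 1 = 0 := by simpa [(hE.U_pos u₀ hu₀).ne', hn1] using h3
    simp only [h2, h4] at h1
    funext i
    fin_cases i <;> simp <;> linarith

lemma deriv_f_of_exp (hE : E.Admissible) {μ : ℝ} (hf : ∀ t ∈ E.I, E.f t = Real.exp (μ * t)) :
    ∀ t ∈ E.I, deriv E.f t = μ * Real.exp (μ * t) := fun t ht => by
  rw [deriv_f_of_eqOn hE hf t ht]
  simpa [mul_comm] using ((hasDerivAt_id t).const_mul μ).exp.deriv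

/-- The Lie symmetries for `f = e^{μ t}`. -/
lemma mem_maxAlg_iff_of_exp (hE : E.Admissible) (hm : E.m ≠ 0) {μ : ℝ} (hμ : μ ≠ 0)
    (hf : ∀ t ∈ E.I, E.f t = Real.exp (μ * t)) (V : VField) :
    V ∈ E.maxAlg ↔ ∃ c b d : ℝ, EqOn V (linField E.m 0 c b d) E.domain ∧
      d * μ = (3 * E.m - E.n - 2) * c := by
  obtain ⟨t₀, ht₀⟩ := hE.interval_I.2.1
  have hf' := deriv_f_of_exp hE hf
  have hne : ∃ t ∈ E.I, ∃ t' ∈ E.I, E.f t ≠ E.f t' :=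
    exists_ne_of_deriv_ne_zero hE ht₀ (by
      rw [hf' t₀ ht₀]
      exact mul_ne_zero hμ (Real.exp_pos _).ne')
  rw [mem_maxAlg_iff_linField hE hm (Or.inr hne)]
  constructor
  · rintro ⟨p, c, b, d, hV, h⟩
    obtain ⟨a1, a2⟩ := affine_indep hE.interval_I.1 hE.interval_I.2.1
      (c := d * μ - (2 * p + (3 * E.m - E.n - 2) * c)) (a := p * μ) (fun t ht => by
        have h1 := h t ht
        rw [hf' t ht, hf t ht] at h1
        apply mul_left_cancel₀ (Real.exp_pos (μ * t)).ne'
        linear_combination h1)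
    have hp : p = 0 := by simpa [hμ] using a2
    subst hp
    exact ⟨c, b, d, hV, by linear_combination a1⟩
  · rintro ⟨c, b, d, hV, h⟩
    refine ⟨0, c, b, d, hV, fun t ht => ?_⟩
    rw [hf' t ht, hf t ht]
    linear_combination Real.exp (μ * t) * h

lemma isBasisOn_case9 (hE : E.Admissible) (hm : E.m ≠ 0) (hK : E.m ≠ (E.n + 2) / 3)
    (hf : ∀ t ∈ E.I, E.f t = Real.exp t) :
    IsBasisOn E.domain E.maxAlg
      ![dx, fun p => (3 * E.m - E.n - 2, (E.m - 1) * p.2.1, p.2.2)] := by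
  obtain ⟨t₀, ht₀⟩ := hE.interval_I.2.1
  obtain ⟨x₀, hx₀⟩ := hE.interval_X.2.1
  obtain ⟨u₀, hu₀⟩ := hE.interval_U.2.1
  have hK' : 3 * E.m - E.n - 2 ≠ 0 := fun h => hK (by linarith)
  refine ⟨fun V => (mem_maxAlg_iff_of_exp hE hm one_ne_zero (by simpa using hf) V).trans
    ⟨?_, ?_⟩, fun e he => ?_⟩
  · rintro ⟨c, b, d, hV, h⟩
    refine ⟨![b, c], fun q hq => ?_⟩
    rw [hV hq, sum_smul_two]
    simp [dx, linField]
    refine ⟨by linear_combination h, by ring⟩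
  · rintro ⟨e, he⟩
    refine ⟨e 1, e 0, e 1 * (3 * E.m - E.n - 2), fun q hq => ?_, by ring⟩
    rw [he hq, sum_smul_two]
    simp [dx, linField]
    ring
  · simp only [EqOn, sum_smul_two] at he
    have h := components_eq_zero (τ := fun _ => e 1 * (3 * E.m - E.n - 2))
      (ξ := fun q => e 0 + e 1 * (E.m - 1) * q.2.1) (η := fun q => e 1 * q.2.2)
      (fun q hq => by
        rw [← he hq]
        simp [dx]
        ring)
    obtain ⟨h0, h1, -⟩ := h t₀ ht₀ x₀ hx₀ u₀ hu₀
    have h2 : e 1 = 0 := by simpa [hK'] using h0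
    simp only [h2] at h1
    funext i
    fin_cases i <;> simp <;> linarith

/-- The listed operators form a basis of the maximal Lie invariance algebra in each case. -/
theorem isBasisOn_of_holds (c : ExtCase) (hE : E.Admissible) (h : c.Holds E) :
    IsBasisOn E.domain E.maxAlg (c.basis E.n E.m) := by
  cases c with
  | c3 => exact isBasisOn_case3 hE h.1 h.2.1 h.2.2
  | c4 => exact isBasisOn_case4 hE h.1 h.2.1 h.2.2
  | c5 => exact isBasisOn_case5 hE h.1 h.2.1 h.2.2
  | c6a => exact isBasisOn_case6a hE h.1 h.2.1 h.2.2.1 h.2.2.2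
  | c6b => exact isBasisOn_case6b hE h.1 h.2.1 h.2.2.1 h.2.2.2
  | c7 k => exact isBasisOn_case7 hE h.1 h.2.1 h.2.2.1 h.2.2.2
  | c8 lam => exact isBasisOn_case8 hE h.1 h.2.1 h.2.2.1 h.2.2.2
  | c9 => exact isBasisOn_case9 hE h.1 h.2.1 h.2.2

/-! ### The operators admitted for all `f` -/

lemma isBasisOn_dx_of_iff (hE : E.Admissible) {A : Set VField}
    (h : ∀ V, V ∈ A ↔ ∃ b : ℝ, EqOn V (linField E.m 0 0 b 0) E.domain) :
    IsBasisOn E.domain A ![dx] := by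
  obtain ⟨t₀, ht₀⟩ := hE.interval_I.2.1
  obtain ⟨x₀, hx₀⟩ := hE.interval_X.2.1
  obtain ⟨u₀, hu₀⟩ := hE.interval_U.2.1
  have key : ∀ b q, (linField E.m 0 0 b 0) q = b • dx q := fun b q => by simp [linField, dx]
  refine ⟨fun V => (h V).trans ⟨?_, ?_⟩, fun e he => ?_⟩
  · rintro ⟨b, hV⟩
    exact ⟨![b], fun q hq => by rw [hV hq, sum_smul_one, key]; rfl⟩
  · rintro ⟨e, he⟩
    exact ⟨e 0, fun q hq => by rw [he hq, sum_smul_one, key]⟩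
  · have h1 := he (show (t₀, x₀, u₀) ∈ E.domain from ⟨ht₀, hx₀, hu₀⟩)
    rw [sum_smul_one] at h1
    funext i
    fin_cases i
    simpa [dx] using h1

lemma isBasisOn_dx_scal_of_iff (hE : E.Admissible) (hK : E.m = (E.n + 2) / 3) {A : Set VField}
    (h : ∀ V, V ∈ A ↔ ∃ c b : ℝ, EqOn V (linField E.m 0 c b 0) E.domain) :
    IsBasisOn E.domain A ![dx, scal E.n] := by
  obtain ⟨t₀, ht₀⟩ := hE.interval_I.2.1
  obtain ⟨x₀, hx₀⟩ := hE.interval_X.2.1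
  obtain ⟨u₀, hu₀⟩ := hE.interval_U.2.1
  have hn1 := sub_ne_zero.2 hE.n_ne_one
  have key : ∀ c b q, (linField E.m 0 c b 0) q = b • dx q + ((E.n - 1) / 3 * c) • scal E.n q :=
    fun c b q => by
      simp [linField, dx, scal, hK]
      refine ⟨by ring, ?_⟩
      field_simp
  refine ⟨fun V => (h V).trans ⟨?_, ?_⟩, fun e he => ?_⟩
  · rintro ⟨c, b, hV⟩
    exact ⟨![b, (E.n - 1) / 3 * c], fun q hq => by rw [hV hq, sum_smul_two, key]; rfl⟩
  · rintro ⟨e, he⟩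
    refine ⟨3 / (E.n - 1) * e 1, e 0, fun q hq => ?_⟩
    rw [he hq, sum_smul_two, key]
    congr 2
    field_simp
  · have h1 := he (show (t₀, x₀, u₀) ∈ E.domain from ⟨ht₀, hx₀, hu₀⟩)
    rw [sum_smul_two] at h1
    simp [dx, scal, (hE.U_pos u₀ hu₀).ne', hn1] at h1
    have h2 := h1.1
    rw [h1.2] at h2
    funext i
    fin_cases i
    · simpa using h2
    · simpa using h1.2

lemma admissible_exp (hE : E.Admissible) (μ : ℝ) :
    ({E with f := fun t => Real.exp (μ * t)} : Eqn).Admissible :=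
  ⟨hE.n_ne_zero, hE.n_ne_one, hE.m_ne_one, hE.eps, hE.interval_I, hE.interval_X, hE.interval_U,
    hE.U_pos, ContDiff.contDiffOn (by fun_prop), fun _ _ => (Real.exp_pos _).ne'⟩

/-- The operators admitted for all `f`: the equations with `f = e^t` and `f = e^{2t}` already
have no further common symmetries. -/
lemma mem_forall_maxAlg_iff (hE : E.Admissible) (hm : E.m ≠ 0) (V : VField) :
    (∀ f : ℝ → ℝ, ({E with f := f} : Eqn).Admissible → V ∈ ({E with f := f} : Eqn).maxAlg) ↔
      ∃ c b : ℝ, EqOn V (linField E.m 0 c b 0) E.domain ∧ (3 * E.m - E.n - 2) * c = 0 := by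
  constructor
  · intro h
    obtain ⟨c, b, d, hV, h1⟩ := (mem_maxAlg_iff_of_exp (admissible_exp hE 1) hm one_ne_zero
      (fun _ _ => rfl) V).1 (h _ (admissible_exp hE 1))
    obtain ⟨c', b', d', hV', h1'⟩ := (mem_maxAlg_iff_of_exp (admissible_exp hE 2) hm two_ne_zero
      (fun _ _ => rfl) V).1 (h _ (admissible_exp hE 2))
    obtain ⟨t₀, ht₀⟩ := hE.interval_I.2.1
    obtain ⟨x₀, hx₀⟩ := hE.interval_X.2.1
    obtain ⟨u₀, hu₀⟩ := hE.interval_U.2.1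
    have hq : (t₀, x₀, u₀) ∈ E.domain := ⟨ht₀, hx₀, hu₀⟩
    have h2 := (hV hq).symm.trans (hV' hq)
    simp [linField, (hE.U_pos u₀ hu₀).ne'] at h2
    obtain ⟨hd, -, hc⟩ := h2
    simp only at h1 h1'
    rw [← hd, ← hc] at h1'
    have hd0 : d = 0 := by linarith
    subst hd0
    exact ⟨c, b, hV, by linarith⟩
  · rintro ⟨c, b, hV, h⟩ f hf
    refine Eqn.mem_maxAlg_congr hf hV (linField_mem_maxAlg hf b fun t _ => ?_)
    simp only
    rw [mul_zero, zero_add, h]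
    ring

lemma isBasisOn_forall_of_ne (hE : E.Admissible) (hm : E.m ≠ 0) (hK : E.m ≠ (E.n + 2) / 3) :
    IsBasisOn E.domain {V | ∀ f : ℝ → ℝ, ({E with f := f} : Eqn).Admissible →
      V ∈ ({E with f := f} : Eqn).maxAlg} ![dx] := by
  have hK' : 3 * E.m - E.n - 2 ≠ 0 := fun h => hK (by linarith)
  refine isBasisOn_dx_of_iff hE fun V => (mem_forall_maxAlg_iff hE hm V).trans ⟨?_, ?_⟩
  · rintro ⟨c, b, hV, h⟩
    obtain rfl : c = 0 := by simpa [hK'] using h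
    exact ⟨b, hV⟩
  · rintro ⟨b, hV⟩
    exact ⟨0, b, hV, mul_zero _⟩

lemma isBasisOn_forall_of_eq (hE : E.Admissible) (hm : E.m ≠ 0) (hK : E.m = (E.n + 2) / 3) :
    IsBasisOn E.domain {V | ∀ f : ℝ → ℝ, ({E with f := f} : Eqn).Admissible →
      V ∈ ({E with f := f} : Eqn).maxAlg} ![dx, scal E.n] := by
  have hK' : 3 * E.m - E.n - 2 = 0 := by linarith
  refine isBasisOn_dx_scal_of_iff hE hK fun V => (mem_forall_maxAlg_iff hE hm V).trans ⟨?_, ?_⟩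
  · rintro ⟨c, b, hV, -⟩
    exact ⟨c, b, hV⟩
  · rintro ⟨c, b, hV⟩
    exact ⟨c, b, hV, by rw [hK', zero_mul]⟩

/-- The kernel algebra: `∂_x` is always a symmetry, and for `n = m = 2` no other operator is
admitted for all `f`. -/
lemma isBasisOn_kernel {I X U : Set ℝ} (hI : IsOpenInterval I) (hX : IsOpenInterval X)
    (hU : IsOpenInterval U) (hpos : ∀ u ∈ U, 0 < u) :
    IsBasisOn (I ×ˢ (X ×ˢ U))
      {V | ∀ E : Eqn, E.Admissible → E.I = I → E.X = X → E.U = U → V ∈ E.maxAlg} ![dx] := by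
  let E₀ : Eqn := ⟨2, 2, 1, fun _ => 1, I, X, U⟩
  have h₀ : E₀.Admissible := ⟨two_ne_zero, OfNat.ofNat_ne_one 2, OfNat.ofNat_ne_one 2, Or.inl rfl,
    hI, hX, hU, hpos, contDiffOn_const, fun _ _ => one_ne_zero⟩
  refine isBasisOn_dx_of_iff h₀ fun V => ⟨fun hV => ?_, ?_⟩
  · obtain ⟨c, b, h, hc⟩ := (mem_forall_maxAlg_iff h₀ two_ne_zero V).1
      (fun f hf => hV _ hf rfl rfl rfl)
    obtain rfl : c = 0 := by
      simp only [E₀] at hc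
      linarith
    exact ⟨b, h⟩
  · rintro ⟨b, hV⟩ E hE rfl rfl rfl
    refine Eqn.mem_maxAlg_congr hE (W := linField E.m 0 0 b 0) (fun q hq => ?_)
      (linField_mem_maxAlg hE b (by simp))
    rw [hV hq]
    simp [linField]

/-! ### Symmetry extensions as a condition on `f` -/

/-- The condition `(p t + d) f' = q f` with `(p, d) ≠ 0`, where moreover `q = 2p` is needed if
`m = (n+2)/3`. For `m ≠ 0` it says that the equation admits a Lie symmetry with
`τ ≠ 0`. -/
def Extends (E : Eqn) : Prop :=
  ∃ p d q : ℝ, (p ≠ 0 ∨ d ≠ 0) ∧ (∀ t ∈ E.I, (p * t + d) * deriv E.f t = q * E.f t) ∧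
    (E.m = (E.n + 2) / 3 → q = 2 * p)

lemma mem_maxAlg_iff_of_not_extends (hE : E.Admissible) (hm : E.m ≠ 0) (h : ¬Extends E)
    (V : VField) : V ∈ E.maxAlg ↔
      ∃ c b : ℝ, EqOn V (linField E.m 0 c b 0) E.domain ∧ (3 * E.m - E.n - 2) * c = 0 := by
  obtain ⟨t₀, ht₀⟩ := hE.interval_I.2.1
  have hne : ∃ t ∈ E.I, ∃ t' ∈ E.I, E.f t ≠ E.f t' := by
    by_contra! hc
    have hf' := deriv_f_eq_zero_of_const hE (κ := E.f t₀) (fun s hs => hc s hs t₀ ht₀)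
    exact h ⟨0, 1, 0, Or.inr one_ne_zero, fun t ht => by rw [hf' t ht]; ring, fun _ => by simp⟩
  rw [mem_maxAlg_iff_linField hE hm (Or.inr hne)]
  constructor
  · rintro ⟨p, c, b, d, hV, hf⟩
    have h0 : ¬(p ≠ 0 ∨ d ≠ 0) := fun h0 => h ⟨p, d, _, h0, hf, fun hK => by rw [hK]; ring⟩
    push Not at h0
    obtain ⟨rfl, rfl⟩ := h0
    refine ⟨c, b, hV, ?_⟩
    have h1 := hf t₀ ht₀
    apply mul_right_cancel₀ (hE.f_ne_zero t₀ ht₀)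
    linear_combination -h1
  · rintro ⟨c, b, hV, hc⟩
    refine ⟨0, c, b, 0, hV, fun t _ => ?_⟩
    rw [mul_zero, zero_add, hc]
    ring

lemma exists_mem_maxAlg_of_extends (hE : E.Admissible) (h : Extends E) :
    ∃ V ∈ E.maxAlg, ∃ q ∈ E.domain, (V q).1 ≠ 0 := by
  obtain ⟨p, d, r, h0, hf, hr⟩ := h
  have hc : ∃ c, r = 2 * p + (3 * E.m - E.n - 2) * c := by
    by_cases hK : 3 * E.m - E.n - 2 = 0
    · exact ⟨0, by rw [hr (by linarith)]; ring⟩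
    · exact ⟨(r - 2 * p) / (3 * E.m - E.n - 2), by field_simp; ring⟩
  obtain ⟨c, rfl⟩ := hc
  refine ⟨_, linField_mem_maxAlg hE 0 hf, ?_⟩
  obtain ⟨x₀, hx₀⟩ := hE.interval_X.2.1
  obtain ⟨u₀, hu₀⟩ := hE.interval_U.2.1
  by_contra! hz
  obtain ⟨h1, h2⟩ := affine_indep hE.interval_I.1 hE.interval_I.2.1 (c := d) (a := p)
    (fun t ht => by
      have := hz (t, x₀, u₀) ⟨ht, hx₀, hu₀⟩
      simp only [linField] at this
      linarith)
  rcases h0 with h0 | h0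
  · exact h0 h2
  · exact h0 h1

lemma isBasisOn_dx_iff (hE : E.Admissible) (hm : E.m ≠ 0) (hK : E.m ≠ (E.n + 2) / 3) :
    IsBasisOn E.domain E.maxAlg ![dx] ↔ ¬Extends E := by
  have hK' : 3 * E.m - E.n - 2 ≠ 0 := fun h => hK (by linarith)
  constructor
  · intro hb he
    obtain ⟨V, hV, q, hq, hne⟩ := exists_mem_maxAlg_of_extends hE he
    obtain ⟨e, he⟩ := (hb.1 V).1 hV
    rw [he hq, sum_smul_one] at hne
    simp [dx] at hne
  · intro he
    refine isBasisOn_dx_of_iff hE fun V => (mem_maxAlg_iff_of_not_extends hE hm he V).trans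
      ⟨?_, ?_⟩
    · rintro ⟨c, b, hV, h⟩
      obtain rfl : c = 0 := by simpa [hK'] using h
      exact ⟨b, hV⟩
    · rintro ⟨b, hV⟩
      exact ⟨0, b, hV, mul_zero _⟩

lemma isBasisOn_dx_scal_iff (hE : E.Admissible) (hm : E.m ≠ 0) (hK : E.m = (E.n + 2) / 3) :
    IsBasisOn E.domain E.maxAlg ![dx, scal E.n] ↔ ¬Extends E := by
  have hK' : 3 * E.m - E.n - 2 = 0 := by linarith
  constructor
  · intro hb he
    obtain ⟨V, hV, q, hq, hne⟩ := exists_mem_maxAlg_of_extends hE he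
    obtain ⟨e, he⟩ := (hb.1 V).1 hV
    rw [he hq, sum_smul_two] at hne
    simp [dx, scal] at hne
  · intro he
    refine isBasisOn_dx_scal_of_iff hE hK fun V =>
      (mem_maxAlg_iff_of_not_extends hE hm he V).trans ⟨?_, ?_⟩
    · rintro ⟨c, b, hV, -⟩
      exact ⟨c, b, hV⟩
    · rintro ⟨c, b, hV⟩
      exact ⟨c, b, hV, by rw [hK', zero_mul]⟩

end

/-! ### Transformed equations -/

/-- The image of an open interval under a smooth function with nonvanishing derivative. -/
lemma IsOpenInterval.image {S : Set ℝ} (hS : IsOpenInterval S) {g : ℝ → ℝ}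
    (hg : ContDiffOn ℝ ∞ g S) (h : ∀ t ∈ S, deriv g t ≠ 0) : IsOpenInterval (g '' S) := by
  refine ⟨?_, hS.2.1.image g, (hS.isPreconnected.image g hg.continuousOn).ordConnected⟩
  rw [isOpen_iff_mem_nhds]
  rintro _ ⟨t, ht, rfl⟩
  have h1 : HasStrictDerivAt g (deriv g t) t :=
    (hg.contDiffAt (hS.1.mem_nhds ht)).hasStrictDerivAt (by simp)
  rw [← h1.map_nhds_eq (h t ht)]
  exact Filter.image_mem_map (hS.1.mem_nhds ht)

lemma deriv_affine (a b : ℝ) (t : ℝ) : deriv (fun t : ℝ => a * t + b) t = a := by simp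

lemma IsOpenInterval.image_affine {S : Set ℝ} (hS : IsOpenInterval S) {a : ℝ} (ha : a ≠ 0)
    (b : ℝ) : IsOpenInterval ((fun t => a * t + b) '' S) :=
  hS.image (ContDiff.contDiffOn (by fun_prop)) fun t _ => by rwa [deriv_affine]

lemma IsOpenInterval.image_mul {S : Set ℝ} (hS : IsOpenInterval S) {a : ℝ} (ha : a ≠ 0) :
    IsOpenInterval ((fun t => a * t) '' S) := by
  simpa using hS.image_affine ha 0

section
variable {E : Eqn}

lemma scale_ne_zero {s r δ m : ℝ} (hs : s = 1 ∨ s = -1) (hr : r ≠ 0) (hδ : 0 < δ) :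
    s * r * δ ^ m ≠ 0 := by
  have : s ≠ 0 := by rcases hs with rfl | rfl <;> norm_num
  exact mul_ne_zero (mul_ne_zero this hr) (Real.rpow_pos_of_pos hδ _).ne'

/-- The image of `E` under the transformation of `G^∼` with the given parameters, where `g` is the
transformed arbitrary element. -/
lemma exists_gEquiv (hE : E.Admissible) {s δ₀ δ₁ δ₃ : ℝ} (hs : s = 1 ∨ s = -1) (h1 : δ₁ ≠ 0)
    (h3 : 0 < δ₃) {g : ℝ → ℝ}
    (hg : ContDiffOn ℝ ∞ g ((fun t => s * δ₁ * δ₃ ^ (1 - E.m) * t + δ₀) '' E.I))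
    (h : ∀ t ∈ E.I, g (s * δ₁ * δ₃ ^ (1 - E.m) * t + δ₀) = s * δ₁ ^ 2 * δ₃ ^ (E.m - E.n) * E.f t) :
    ∃ E' : Eqn, E'.Admissible ∧ GEquiv E E' ∧ E'.n = E.n ∧ E'.m = E.m ∧ E'.ε = s * E.ε ∧
      E'.f = g ∧ E'.I = (fun t => s * δ₁ * δ₃ ^ (1 - E.m) * t + δ₀) '' E.I := by
  refine ⟨⟨E.n, E.m, s * E.ε, g, (fun t => s * δ₁ * δ₃ ^ (1 - E.m) * t + δ₀) '' E.I,
    (fun x => δ₁ * x + 0) '' E.X, (fun u => δ₃ * u) '' E.U⟩, ?_,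
    ⟨s, δ₀, δ₁, 0, δ₃, hs, h1, h3, rfl, rfl, rfl, rfl, rfl, rfl, h⟩, rfl, rfl, rfl, rfl, rfl⟩
  refine ⟨hE.n_ne_zero, hE.n_ne_one, hE.m_ne_one, ?_,
    hE.interval_I.image_affine (scale_ne_zero hs h1 h3) _, hE.interval_X.image_affine h1 _,
    hE.interval_U.image_mul h3.ne', ?_, hg, ?_⟩
  · rcases hs with rfl | rfl <;> rcases hE.eps with h | h <;> simp [h]
  · rintro _ ⟨u, hu, rfl⟩
    exact mul_pos h3 (hE.U_pos u hu)
  · rintro _ ⟨t, ht, rfl⟩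
    simp only
    rw [h t ht]
    exact mul_ne_zero (scale_ne_zero hs (pow_ne_zero 2 h1) h3) (hE.f_ne_zero t ht)

/-- Every equation with `m = 0` is mapped to one with `f = 1` by `t' = ∫ f dt`. -/
lemma exists_reducesTo_of_m_eq_zero (hE : E.Admissible) (hm : E.m = 0) :
    ∃ c : ExtCase, E.ReducesTo c := by
  obtain ⟨t₀, ht₀⟩ := hE.interval_I.2.1
  have hfc := hE.f_smooth.continuousOn
  have hd : ∀ t ∈ E.I, HasDerivAt (fun t => ∫ y in t₀..t, E.f y) (E.f t) t := fun t ht => by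
    refine intervalIntegral.integral_hasDerivAt_right ?_ ?_ ?_
    · exact (hfc.mono (hE.interval_I.2.2.uIcc_subset ht₀ ht)).intervalIntegrable
    · exact hfc.stronglyMeasurableAtFilter hE.interval_I.1 t ht
    · exact hfc.continuousAt (hE.interval_I.1.mem_nhds ht)
  have hT : ContDiffOn ℝ ∞ (fun t => ∫ y in t₀..t, E.f y) E.I := by
    rw [contDiffOn_infty_iff_deriv_of_isOpen hE.interval_I.1]
    exact ⟨fun t ht => (hd t ht).differentiableAt.differentiableWithinAt,
      hE.f_smooth.congr fun t ht => (hd t ht).deriv⟩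
  have hT' : ∀ t ∈ E.I, deriv (fun t => ∫ y in t₀..t, E.f y) t ≠ 0 := fun t ht => by
    rw [(hd t ht).deriv]
    exact hE.f_ne_zero t ht
  let E' : Eqn := ⟨E.n, E.m, E.ε, fun _ => 1, (fun t => ∫ y in t₀..t, E.f y) '' E.I,
    (fun x => 1 * x + 0) '' E.X, (fun u => 1 * u) '' E.U⟩
  have hE' : E'.Admissible := by
    refine ⟨hE.n_ne_zero, hE.n_ne_one, hE.m_ne_one, hE.eps, hE.interval_I.image hT hT',
      hE.interval_X.image_affine one_ne_zero _, hE.interval_U.image_mul one_ne_zero, ?_,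
      contDiffOn_const, fun _ _ => one_ne_zero⟩
    rintro _ ⟨u, hu, rfl⟩
    simpa using hE.U_pos u hu
  have hEE : Equivalent E E' := by
    refine Or.inr ⟨hm, _, 1, 0, 1, hT, hT', one_ne_zero, one_pos, hm, hm, rfl, rfl, rfl, rfl,
      fun t ht => ?_⟩
    rw [(hd t ht).deriv]
    have := hE.f_ne_zero t ht
    simp [E', this]
  by_cases hn : E.n = -1 / 2
  · exact ⟨.c4, E', hE', hEE, hn, hm, fun _ _ => rfl⟩
  · exact ⟨.c3, E', hE', hEE, hn, hm, fun _ _ => rfl⟩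

lemma exists_sign {κ : ℝ} (h : κ ≠ 0) : ∃ s : ℝ, (s = 1 ∨ s = -1) ∧ s * κ = |κ| := by
  rcases lt_or_gt_of_ne h with h | h
  · exact ⟨-1, Or.inr rfl, by rw [abs_of_neg h]; ring⟩
  · exact ⟨1, Or.inl rfl, by rw [abs_of_pos h]; ring⟩

lemma sign_mul_self {s : ℝ} (h : s = 1 ∨ s = -1) : s * s = 1 := by
  rcases h with rfl | rfl <;> norm_num

/-- A constant `f` is normalised to `1` by a scaling of `x` and the common sign. -/
lemma exists_reducesTo_of_const (hE : E.Admissible) (hm : E.m ≠ 0) {κ : ℝ}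
    (hf : ∀ t ∈ E.I, E.f t = κ) : ∃ c : ExtCase, E.ReducesTo c := by
  obtain ⟨t₀, ht₀⟩ := hE.interval_I.2.1
  have hκ : κ ≠ 0 := hf t₀ ht₀ ▸ hE.f_ne_zero t₀ ht₀
  obtain ⟨s, hs, hsκ⟩ := exists_sign hκ
  have hpos := abs_pos.2 hκ
  have hsq : √|κ| ^ 2 = |κ| := Real.sq_sqrt hpos.le
  obtain ⟨E', hE', hG, hn', hm', hε', hf', -⟩ := exists_gEquiv hE (δ₀ := 0) (δ₁ := (√|κ|)⁻¹)
    (g := fun _ => 1) hs (inv_ne_zero (Real.sqrt_pos.2 hpos).ne') one_pos contDiffOn_const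
    (fun t ht => by
      rw [hf t ht, Real.one_rpow, inv_pow, hsq, mul_one, mul_right_comm, hsκ,
        mul_inv_cancel₀ hpos.ne'])
  have hEE : Equivalent E E' := Or.inl ⟨hm, hG⟩
  have hone : ∀ t ∈ E'.I, E'.f t = 1 := fun t _ => by rw [hf']
  by_cases hsp : E.n = -1 / 2 ∧ E.m = -1 / 2
  · rcases hE'.eps with h | h
    · exact ⟨.c6a, E', hE', hEE, hn'.trans hsp.1, hm'.trans hsp.2, h, hone⟩
    · exact ⟨.c6b, E', hE', hEE, hn'.trans hsp.1, hm'.trans hsp.2, h, hone⟩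
  · exact ⟨.c5, E', hE', hEE, hm' ▸ hm, by rwa [hn', hm'], hone⟩

lemma exists_eq_const_of_hasDerivAt_zero (hE : E.Admissible) {g : ℝ → ℝ}
    (h : ∀ t ∈ E.I, HasDerivAt g 0 t) : ∃ κ, ∀ t ∈ E.I, g t = κ :=
  hE.interval_I.1.exists_is_const_of_deriv_eq_zero hE.interval_I.isPreconnected
    (fun t ht => (h t ht).differentiableAt.differentiableWithinAt) (fun t ht => (h t ht).deriv)

lemma exists_reducesTo_of_exp (hE : E.Admissible) (hm : E.m ≠ 0) (hK : E.m ≠ (E.n + 2) / 3)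
    {μ : ℝ} (hμ : μ ≠ 0) (hf : ∀ t ∈ E.I, deriv E.f t = μ * E.f t) :
    E.ReducesTo .c9 := by
  obtain ⟨lam, hl⟩ := exists_eq_const_of_hasDerivAt_zero hE
    (g := fun t => E.f t * Real.exp (-(μ * t)))
    (fun t ht => by
      have h := (hE.hasDerivAt_f ht).mul (((hasDerivAt_id t).const_mul μ).neg.exp)
      refine h.congr_deriv ?_
      simp only [hf t ht, id]
      ring)
  have hfl : ∀ t ∈ E.I, E.f t = lam * Real.exp (μ * t) := fun t ht => by
    rw [← hl t ht, mul_assoc, ← Real.exp_add, neg_add_cancel, Real.exp_zero, mul_one]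
  obtain ⟨t₀, ht₀⟩ := hE.interval_I.2.1
  have hl0 : lam ≠ 0 := by
    rintro rfl
    exact hE.f_ne_zero t₀ ht₀ (by rw [hfl t₀ ht₀, zero_mul])
  obtain ⟨s, hs, hsl⟩ := exists_sign hl0
  have hss := sign_mul_self hs
  have hs0 : s ≠ 0 := left_ne_zero_of_mul_eq_one hss
  have hpos : 0 < μ ^ 2 * |lam| := by positivity
  -- `t' = μ t + log (μ² |λ|)`
  obtain ⟨E', hE', hG, hn', hm', hε', hf', -⟩ := exists_gEquiv hE (δ₀ := Real.log (μ ^ 2 * |lam|))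
    (δ₁ := s * μ) (g := Real.exp) hs (mul_ne_zero hs0 hμ) one_pos Real.contDiff_exp.contDiffOn
    (fun t ht => by
      rw [Real.one_rpow, Real.one_rpow, hfl t ht, Real.exp_add, Real.exp_log hpos, ← hsl,
        ← mul_assoc s s μ, hss, one_mul, mul_one]
      linear_combination (-s * μ ^ 2 * lam * Real.exp (μ * t)) * hss)
  exact ⟨E', hE', Or.inl ⟨hm, hG⟩, hm' ▸ hm, by rwa [hn', hm'], fun t _ => by rw [hf']⟩

lemma hasDerivAt_sign_mul_rpow {σ b t k : ℝ} (h : 0 < σ * (t + b)) :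
    HasDerivAt (fun t => (σ * (t + b)) ^ k) (k * (σ * (t + b)) ^ k / (t + b)) t := by
  have h1 : HasDerivAt (fun t => σ * (t + b)) σ t := by
    simpa using ((hasDerivAt_id t).add_const b).const_mul σ
  refine (h1.rpow_const (p := k) (Or.inl h.ne')).congr_deriv ?_
  rw [Real.rpow_sub_one h.ne']
  have hσ : σ ≠ 0 := left_ne_zero_of_mul h.ne'
  have hb : t + b ≠ 0 := right_ne_zero_of_mul h.ne'
  field_simp

/-- The nonvanishing solutions of `(t + b) f' = k f` are multiples of powers of `|t + b|`. -/
lemma exists_eq_mul_rpow (hE : E.Admissible) {b k : ℝ} (hk : k ≠ 0)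
    (hf : ∀ t ∈ E.I, (t + b) * deriv E.f t = k * E.f t) :
    ∃ σ lam : ℝ, (σ = 1 ∨ σ = -1) ∧ lam ≠ 0 ∧
      ∀ t ∈ E.I, 0 < σ * (t + b) ∧ E.f t = lam * (σ * (t + b)) ^ k := by
  obtain ⟨t₀, ht₀⟩ := hE.interval_I.2.1
  have hne : ∀ t ∈ E.I, t + b ≠ 0 := fun t ht h0 => by
    have := hf t ht
    rw [h0, zero_mul] at this
    exact mul_ne_zero hk (hE.f_ne_zero t ht) this.symm
  obtain ⟨σ, hσ, hσ0⟩ := exists_sign (hne t₀ ht₀)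
  have hσσ := sign_mul_self hσ
  have hpos : ∀ t ∈ E.I, 0 < σ * (t + b) := fun t ht => by
    by_contra! hle
    have hc : ContinuousOn (fun t => σ * (t + b)) E.I := by fun_prop
    obtain ⟨r, hr, hr0⟩ := hE.interval_I.isPreconnected.intermediate_value ht ht₀ hc
      (show (0 : ℝ) ∈ Icc _ _ from ⟨hle, by simp only [hσ0]; exact abs_nonneg _⟩)
    exact mul_ne_zero (left_ne_zero_of_mul_eq_one hσσ) (hne r hr) hr0
  obtain ⟨lam, hl⟩ := exists_eq_const_of_hasDerivAt_zero hE
    (g := fun t => E.f t * (σ * (t + b)) ^ (-k))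
    (fun t ht => by
      refine ((hE.hasDerivAt_f ht).mul (hasDerivAt_sign_mul_rpow (hpos t ht))).congr_deriv ?_
      have h1 := hne t ht
      field_simp
      linear_combination (σ * (t + b)) ^ (-k) * hf t ht)
  have hfl : ∀ t ∈ E.I, E.f t = lam * (σ * (t + b)) ^ k := fun t ht => by
    rw [← hl t ht, mul_assoc, ← Real.rpow_add (hpos t ht), neg_add_cancel, Real.rpow_zero, mul_one]
  refine ⟨σ, lam, hσ, ?_, fun t ht => ⟨hpos t ht, hfl t ht⟩⟩
  rintro rfl
  exact hE.f_ne_zero t₀ ht₀ (by rw [hfl t₀ ht₀, zero_mul])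

/-- With `k = 2` and `m = (n+2)/3` the coefficient of the power is invariant under scalings;
otherwise a scaling of `x` (for `k ≠ 2`) or of `u` (for `k = 2`) normalises it to one. -/
lemma exists_reducesTo_of_power (hE : E.Admissible) (hm : E.m ≠ 0) {b k : ℝ} (hk : k ≠ 0)
    (hf : ∀ t ∈ E.I, (t + b) * deriv E.f t = k * E.f t) (h2 : E.m = (E.n + 2) / 3 → k = 2) :
    ∃ c : ExtCase, E.ReducesTo c := by
  obtain ⟨σ, lam, hσ, hl0, hfl⟩ := exists_eq_mul_rpow hE hk hf
  obtain ⟨s, hs, hsl⟩ := exists_sign hl0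
  have hss := sign_mul_self hs
  have hσσ := sign_mul_self hσ
  have hs0 : s ≠ 0 := left_ne_zero_of_mul_eq_one hss
  have hσ0 : σ ≠ 0 := left_ne_zero_of_mul_eq_one hσσ
  have hlp := abs_pos.2 hl0
  by_cases hK : E.m = (E.n + 2) / 3
  · obtain rfl := h2 hK
    -- `t' = σ (t + b)`
    obtain ⟨E', hE', hG, hn', hm', hε', hf', hI'⟩ := exists_gEquiv hE (δ₀ := σ * b) (δ₁ := s * σ)
      (g := fun t => |lam| * t ^ 2) hs (mul_ne_zero hs0 hσ0) one_pos
      (ContDiff.contDiffOn (by fun_prop)) (fun t ht => by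
        rw [Real.one_rpow, Real.one_rpow, (hfl t ht).2, Real.rpow_two, ← hsl, ← mul_assoc s s σ,
          hss]
        linear_combination (-s * lam * (σ * (t + b)) ^ 2) * (s * s * hσσ + hss))
    refine ⟨.c8 |lam|, E', hE', Or.inl ⟨hm, hG⟩, hm' ▸ hm, by rw [hm', hn', hK], hlp, ?_⟩
    rw [hI', hf']
    rintro _ ⟨t, ht, rfl⟩
    refine ⟨?_, rfl⟩
    have := (hfl t ht).1
    simp only [Real.one_rpow, ← mul_assoc s s σ, hss]
    linarith
  · have hK' : 3 * E.m - E.n - 2 ≠ 0 := fun h => hK (by linarith)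
    -- scalings of `x` by `±r` and of `u` by `δ` that normalise the coefficient to one
    obtain ⟨r, δ, hr, hδ, hrδ⟩ : ∃ r δ : ℝ, 0 < r ∧ 0 < δ ∧
        r ^ 2 * δ ^ (E.m - E.n) * |lam| = (r * δ ^ (1 - E.m)) ^ k := by
      by_cases hk2 : k = 2
      · refine ⟨1, |lam| ^ (-1 / (3 * E.m - E.n - 2)), one_pos, Real.rpow_pos_of_pos hlp _, ?_⟩
        rw [hk2, Real.rpow_two, one_pow, one_mul, one_mul,
          ← Real.rpow_natCast, ← Real.rpow_mul hlp.le,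
          ← Real.rpow_mul hlp.le, ← Real.rpow_mul hlp.le]
        nth_rewrite 2 [← Real.rpow_one |lam|]
        rw [← Real.rpow_add hlp]
        congr 1
        push_cast
        field_simp
        ring
      · have hk2' : k - 2 ≠ 0 := sub_ne_zero.2 hk2
        refine ⟨|lam| ^ (1 / (k - 2)), 1, Real.rpow_pos_of_pos hlp _, one_pos, ?_⟩
        rw [Real.one_rpow, Real.one_rpow, mul_one, mul_one, ← Real.rpow_natCast,
          ← Real.rpow_mul hlp.le, ← Real.rpow_mul hlp.le]
        nth_rewrite 2 [← Real.rpow_one |lam|]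
        rw [← Real.rpow_add hlp]
        congr 1
        push_cast
        field_simp
        ring
    have hδm := Real.rpow_pos_of_pos hδ (1 - E.m)
    have harg : ∀ t, s * (s * σ * r) * δ ^ (1 - E.m) * t + σ * r * δ ^ (1 - E.m) * b =
        r * δ ^ (1 - E.m) * (σ * (t + b)) := fun t => by
      linear_combination σ * r * δ ^ (1 - E.m) * t * hss
    have hpos : ∀ t ∈ E.I, 0 < r * δ ^ (1 - E.m) * (σ * (t + b)) := fun t ht =>
      mul_pos (mul_pos hr hδm) (hfl t ht).1
    obtain ⟨E', hE', hG, hn', hm', hε', hf', hI'⟩ := exists_gEquiv hE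
      (δ₀ := σ * r * δ ^ (1 - E.m) * b) (δ₁ := s * σ * r) (g := fun t => t ^ k) hs
      (mul_ne_zero (mul_ne_zero hs0 hσ0) hr.ne') hδ
      (by
        rintro _ ⟨t, ht, rfl⟩
        refine (Real.contDiffAt_rpow_const_of_ne ?_).contDiffWithinAt
        simp only
        rw [harg]
        exact (hpos t ht).ne')
      (fun t ht => by
        rw [harg, Real.mul_rpow (mul_pos hr hδm).le (hfl t ht).1.le, ← hrδ, (hfl t ht).2, ← hsl]
        linear_combination (-s * lam * r ^ 2 * δ ^ (E.m - E.n) * (σ * (t + b)) ^ k)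
          * (s * s * hσσ + hss))
    refine ⟨.c7 k, E', hE', Or.inl ⟨hm, hG⟩, hm' ▸ hm, by rwa [hn', hm'], hk, ?_⟩
    rw [hI', hf']
    rintro _ ⟨t, ht, rfl⟩
    refine ⟨?_, rfl⟩
    simp only
    rw [harg]
    exact hpos t ht

lemma exists_reducesTo_of_extends (hE : E.Admissible) (hm : E.m ≠ 0) (h : Extends E) :
    ∃ c : ExtCase, E.ReducesTo c := by
  obtain ⟨p, d, q, h0, hf, hq⟩ := h
  by_cases hc : ∀ t ∈ E.I, deriv E.f t = 0
  · obtain ⟨κ, hκ⟩ := exists_eq_const_of_hasDerivAt_zero hE (g := E.f)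
      (fun t ht => hc t ht ▸ hE.hasDerivAt_f ht)
    exact exists_reducesTo_of_const hE hm hκ
  · have hq0 : q ≠ 0 := by
      rintro rfl
      -- `p t + d` would vanish on the open set where `f' ≠ 0`
      have hco : ContinuousOn (deriv E.f) E.I :=
        hE.f_smooth.continuousOn_deriv_of_isOpen hE.interval_I.1 (by simp)
      have ho : IsOpen (E.I ∩ deriv E.f ⁻¹' {0}ᶜ) :=
        hco.isOpen_inter_preimage hE.interval_I.1 isOpen_compl_singleton
      push Not at hc
      obtain ⟨h1, h2⟩ := affine_indep ho (a := p) (c := d) hc (fun t ht => by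
        have := hf t ht.1
        rw [zero_mul] at this
        linarith [(mul_eq_zero.1 this).resolve_right ht.2])
      rcases h0 with h0 | h0
      · exact h0 h2
      · exact h0 h1
    by_cases hp : p = 0
    · subst hp
      have hd : d ≠ 0 := by simpa using h0
      refine ⟨.c9, exists_reducesTo_of_exp hE hm (fun hK => hq0 (by rw [hq hK, mul_zero]))
        (div_ne_zero hq0 hd) fun t ht => ?_⟩
      have := hf t ht
      field_simp
      linear_combination this
    · refine exists_reducesTo_of_power hE hm (b := d / p) (div_ne_zero hq0 hp) (fun t ht => ?_)
        (fun hK => by rw [hq hK]; field_simp)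
      have := hf t ht
      field_simp
      linear_combination this

end

section
variable {E E' : Eqn}

/-! ### Invariants of the listed cases -/

/-- What remains of an equivalence transformation with `m ≠ 0` for the function `f`: an affine
change of `t` and a rescaling of `f`, with the relations between the factors. -/
lemma GEquiv.exists_affine (h : GEquiv E E') : ∃ α β C s : ℝ, α ≠ 0 ∧ C ≠ 0 ∧ (s = 1 ∨ s = -1) ∧
    E'.n = E.n ∧ E'.m = E.m ∧ E'.ε = s * E.ε ∧ 0 < s * C ∧
    (E.m = (E.n + 2) / 3 → α ^ 2 = s * C) ∧
    ∀ t ∈ E.I, α * t + β ∈ E'.I ∧ E'.f (α * t + β) = C * E.f t := by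
  obtain ⟨s, δ₀, δ₁, δ₂, δ₃, hs, h1, h3, hn, hm, hε, hI, -, -, hf⟩ := h
  have hss := sign_mul_self hs
  refine ⟨s * δ₁ * δ₃ ^ (1 - E.m), δ₀, s * δ₁ ^ 2 * δ₃ ^ (E.m - E.n), s, scale_ne_zero hs h1 h3,
    scale_ne_zero hs (pow_ne_zero 2 h1) h3, hs, hn, hm, hε, ?_, fun hK => ?_,
    fun t ht => ⟨hI ▸ mem_image_of_mem _ ht, hf t ht⟩⟩
  · have : s * (s * δ₁ ^ 2 * δ₃ ^ (E.m - E.n)) = δ₁ ^ 2 * δ₃ ^ (E.m - E.n) := by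
      linear_combination δ₁ ^ 2 * δ₃ ^ (E.m - E.n) * hss
    rw [this]
    have := Real.rpow_pos_of_pos h3 (E.m - E.n)
    positivity
  · have : δ₃ ^ (E.m - E.n) = (δ₃ ^ (1 - E.m)) ^ 2 := by
      rw [← Real.rpow_natCast, ← Real.rpow_mul h3.le]
      congr 1
      push_cast
      linarith
    rw [this]
    ring

lemma deriv_f_of_affine (hE : E.Admissible) (hE' : E'.Admissible) {α β C : ℝ}
    (h : ∀ t ∈ E.I, α * t + β ∈ E'.I ∧ E'.f (α * t + β) = C * E.f t) :
    ∀ t ∈ E.I, α * deriv E'.f (α * t + β) = C * deriv E.f t := fun t ht => by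
  have h1 : HasDerivAt (fun t => α * t + β) α t := by
    simpa using ((hasDerivAt_id t).const_mul α).add_const β
  have h2 := (hE'.hasDerivAt_f (h t ht).1).comp t h1
  have h3 : (E'.f ∘ fun t => α * t + β) =ᶠ[nhds t] fun t => C * E.f t :=
    Filter.mem_of_superset (hE.interval_I.1.mem_nhds ht) fun s hs => (h s hs).2
  have h4 := (h2.congr_of_eventuallyEq h3.symm).unique ((hE.hasDerivAt_f ht).const_mul C)
  linarith

/-- An affine substitution transforms the equation for `f` into one of the same form and preserves
the relation `q = 2p`. -/
lemma Extends.of_gEquiv (hE : E.Admissible) (hE' : E'.Admissible) (hG : GEquiv E E')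
    (h : Extends E') : Extends E := by
  obtain ⟨α, β, C, s, hα, hC, -, hn, hm, -, -, -, hf⟩ := hG.exists_affine
  obtain ⟨p, d, q, h0, hf', hq⟩ := h
  refine ⟨p * α, p * β + d, α * q, ?_, fun t ht => ?_, fun hK => ?_⟩
  · by_cases hp : p = 0
    · right
      simpa [hp] using h0
    · exact Or.inl (mul_ne_zero hp hα)
  · have h1 := hf' _ (hf t ht).1
    have h2 := deriv_f_of_affine hE hE' hf t ht
    rw [(hf t ht).2] at h1
    apply mul_left_cancel₀ hC
    linear_combination α * h1 - (p * (α * t + β) + d) * h2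
  · rw [hq (by rw [hm, hn, hK])]
    ring

lemma mul_deriv_f_of_power (hE : E.Admissible) {k : ℝ} (hf : ∀ t ∈ E.I, 0 < t ∧ E.f t = t ^ k) :
    ∀ t ∈ E.I, t * deriv E.f t = k * E.f t := fun t ht => by
  have h0 := (hf t ht).1.ne'
  rw [deriv_f_of_eqOn hE (fun t ht => (hf t ht).2) t ht, (hf t ht).2,
    (Real.hasDerivAt_rpow_const (Or.inl h0)).deriv, Real.rpow_sub_one h0]
  field_simp

lemma deriv_f_of_eq_exp (hE : E.Admissible) (hf : ∀ t ∈ E.I, E.f t = Real.exp t) :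
    ∀ t ∈ E.I, deriv E.f t = E.f t := fun t ht => by
  rw [deriv_f_of_eqOn hE hf t ht, hf t ht, Real.deriv_exp]

lemma extends_of_holds (hE : E.Admissible) (hm : E.m ≠ 0) {c : ExtCase} (h : c.Holds E) :
    Extends E := by
  have hconst : (∀ t ∈ E.I, E.f t = 1) → Extends E := fun hf =>
    ⟨0, 1, 0, Or.inr one_ne_zero, fun t ht => by
      rw [deriv_f_eq_zero_of_const hE hf t ht]; ring, fun _ => by simp⟩
  cases c with
  | c3 => exact absurd h.2.1 hm
  | c4 => exact absurd h.2.1 hm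
  | c5 => exact hconst h.2.2
  | c6a => exact hconst h.2.2.2
  | c6b => exact hconst h.2.2.2
  | c7 k =>
    exact ⟨1, 0, k, Or.inl one_ne_zero, fun t ht => by
      rw [one_mul, add_zero, mul_deriv_f_of_power hE h.2.2.2 t ht], fun hK => absurd hK h.2.1⟩
  | c8 lam =>
    refine ⟨1, 0, 2, Or.inl one_ne_zero, fun t ht => ?_, fun _ => by norm_num⟩
    rw [deriv_f_of_eqOn hE (fun t ht => (h.2.2.2 t ht).2) t ht, (h.2.2.2 t ht).2]
    simp
    ring
  | c9 =>
    exact ⟨0, 1, 1, Or.inr one_ne_zero, fun t ht => by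
      rw [deriv_f_of_eq_exp hE h.2.2 t ht]; ring, fun hK => absurd hK h.2.1⟩

lemma extends_iff (hE : E.Admissible) (hm : E.m ≠ 0) :
    Extends E ↔ ∃ c : ExtCase, E.ReducesTo c := by
  refine ⟨exists_reducesTo_of_extends hE hm, ?_⟩
  rintro ⟨c, E', hE', hEE, hc⟩
  rcases hEE with ⟨-, hG⟩ | ⟨h0, -⟩
  · obtain ⟨-, -, -, -, -, -, -, -, hm', -⟩ := hG.exists_affine
    exact Extends.of_gEquiv hE hE' hG (extends_of_holds hE' (hm' ▸ hm) hc)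
  · exact absurd h0 hm

/-- Properties of an equation, invariant under equivalence, that hold if it is equivalent to an
equation of the given case and that determine the case and its parameter. -/
def ExtCase.Invariant : ExtCase → Eqn → Prop
  | .c3, E => E.n ≠ -1 / 2 ∧ E.m = 0
  | .c4, E => E.n = -1 / 2 ∧ E.m = 0
  | .c5, E => E.m ≠ 0 ∧ ¬(E.n = -1 / 2 ∧ E.m = -1 / 2) ∧ ∀ t ∈ E.I, deriv E.f t = 0
  | .c6a, E => E.m ≠ 0 ∧ (E.n = -1 / 2 ∧ E.m = -1 / 2) ∧ (∀ t ∈ E.I, deriv E.f t = 0) ∧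
      ∀ t ∈ E.I, 0 < E.ε * E.f t
  | .c6b, E => E.m ≠ 0 ∧ (E.n = -1 / 2 ∧ E.m = -1 / 2) ∧ (∀ t ∈ E.I, deriv E.f t = 0) ∧
      ∀ t ∈ E.I, E.ε * E.f t < 0
  | .c7 k, E => E.m ≠ 0 ∧ E.m ≠ (E.n + 2) / 3 ∧ k ≠ 0 ∧
      ∃ b, ∀ t ∈ E.I, (t + b) * deriv E.f t = k * E.f t
  | .c8 lam, E => E.m ≠ 0 ∧ E.m = (E.n + 2) / 3 ∧ 0 < lam ∧
      (∃ b, ∀ t ∈ E.I, (t + b) * deriv E.f t = 2 * E.f t) ∧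
      ∃ b s : ℝ, (s = 1 ∨ s = -1) ∧ ∀ t ∈ E.I, E.f t = s * lam * (t + b) ^ 2
  | .c9, E => E.m ≠ 0 ∧ E.m ≠ (E.n + 2) / 3 ∧ ∃ μ, μ ≠ 0 ∧ ∀ t ∈ E.I, deriv E.f t = μ * E.f t

lemma invariant_of_reducesTo (hE : E.Admissible) {c : ExtCase} (h : E.ReducesTo c) :
    c.Invariant E := by
  obtain ⟨E', hE', hEE, hc⟩ := h
  rcases hEE with ⟨hm0, hG⟩ | ⟨hm0, T, δ₁, δ₂, δ₃, -, -, -, -, -, hm', hn', -⟩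
  · obtain ⟨α, β, C, s, hα, hC, hs, hn, hm, hε, hsC, hK, hf⟩ := hG.exists_affine
    have hd := deriv_f_of_affine hE hE' hf
    have hss := sign_mul_self hs
    have hconst : (∀ t ∈ E'.I, E'.f t = 1) → ∀ t ∈ E.I, deriv E.f t = 0 := fun h1 t ht => by
      have := hd t ht
      rw [deriv_f_eq_zero_of_const hE' h1 _ (hf t ht).1, mul_zero] at this
      exact (mul_eq_zero.1 this.symm).resolve_left hC
    -- the sign of `ε f` is invariant
    have hsign : (∀ t ∈ E'.I, E'.f t = 1) → ∀ t ∈ E.I, E'.ε = (s * C) * (E.ε * E.f t) :=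
      fun h1 t ht => by
        have := (hf t ht).2
        rw [h1 _ (hf t ht).1] at this
        rw [hε]
        linear_combination s * E.ε * this
    cases c with
    | c3 => exact absurd (hm ▸ hc.2.1) hm0
    | c4 => exact absurd (hm ▸ hc.2.1) hm0
    | c5 => exact ⟨hm0, by rw [← hn, ← hm]; exact hc.2.1, hconst hc.2.2⟩
    | c6a =>
      refine ⟨hm0, ⟨hn ▸ hc.1, hm ▸ hc.2.1⟩, hconst hc.2.2.2, fun t ht => ?_⟩
      have h1 := hsign hc.2.2.2 t ht
      rw [hc.2.2.1] at h1
      exact (pos_iff_pos_of_mul_pos (h1 ▸ one_pos)).1 hsC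
    | c6b =>
      refine ⟨hm0, ⟨hn ▸ hc.1, hm ▸ hc.2.1⟩, hconst hc.2.2.2, fun t ht => ?_⟩
      have h1 := hsign hc.2.2.2 t ht
      rw [hc.2.2.1] at h1
      exact neg_of_mul_neg_right (h1 ▸ neg_one_lt_zero) hsC.le
    | c7 k =>
      refine ⟨hm0, by rw [← hn, ← hm]; exact hc.2.1, hc.2.2.1, β / α, fun t ht => ?_⟩
      have h1 := mul_deriv_f_of_power hE' hc.2.2.2 _ (hf t ht).1
      have h2 := hd t ht
      rw [(hf t ht).2] at h1
      field_simp
      apply mul_left_cancel₀ hC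
      linear_combination α * h1 - (α * t + β) * h2
    | c8 lam =>
      have hα2 := hK (by rw [← hn, ← hm]; exact hc.2.1)
      have hquad : ∀ t ∈ E.I, E.f t = s * lam * (t + β / α) ^ 2 := fun t ht => by
        have h1 := (hc.2.2.2 _ (hf t ht).1).2
        rw [(hf t ht).2] at h1
        apply mul_left_cancel₀ hC
        rw [h1]
        have h2 : α * t + β = α * (t + β / α) := by field_simp
        rw [h2]
        linear_combination lam * (t + β / α) ^ 2 * hα2
      refine ⟨hm0, by rw [← hn, ← hm]; exact hc.2.1, hc.2.2.1, ⟨β / α, fun t ht => ?_⟩,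
        β / α, s, hs, hquad⟩
      have h3 : deriv (fun t => s * lam * (t + β / α) ^ 2) t = s * lam * (2 * (t + β / α)) := by
        have h4 := ((((hasDerivAt_id t).add_const (β / α)).pow 2).const_mul (s * lam)).deriv
        refine Eq.trans h4 ?_
        simp
      rw [deriv_f_of_eqOn hE hquad t ht, hquad t ht, h3]
      ring
    | c9 =>
      refine ⟨hm0, by rw [← hn, ← hm]; exact hc.2.1, α, hα, fun t ht => ?_⟩
      have h1 := deriv_f_of_eq_exp hE' hc.2.2 _ (hf t ht).1
      have h2 := hd t ht
      rw [(hf t ht).2] at h1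
      apply mul_left_cancel₀ hC
      linear_combination α * h1 - h2
  · cases c with
    | c3 => exact ⟨by rw [← hn']; exact hc.1, hm0⟩
    | c4 => exact ⟨by rw [← hn']; exact hc.1, hm0⟩
    | c5 => exact absurd hm' hc.1
    | c6a => rw [hc.2.1] at hm'; norm_num at hm'
    | c6b => rw [hc.2.1] at hm'; norm_num at hm'
    | c7 k => exact absurd hm' hc.1
    | c8 lam => exact absurd hm' hc.1
    | c9 => exact absurd hm' hc.1

/-! ### Inequivalence -/

lemma power_exponent_unique (hE : E.Admissible) {b b' k k' : ℝ}
    (h : ∀ t ∈ E.I, (t + b) * deriv E.f t = k * E.f t)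
    (h' : ∀ t ∈ E.I, (t + b') * deriv E.f t = k' * E.f t) : k = k' := by
  obtain ⟨-, h2⟩ := affine_indep hE.interval_I.1 hE.interval_I.2.1 (a := k - k')
    (c := k * b' - k' * b) (fun t ht => by
      apply mul_left_cancel₀ (hE.f_ne_zero t ht)
      linear_combination (t + b) * h' t ht - (t + b') * h t ht)
  linarith

lemma not_power_of_exp (hE : E.Admissible) {b k μ : ℝ} (hμ : μ ≠ 0)
    (h : ∀ t ∈ E.I, (t + b) * deriv E.f t = k * E.f t)
    (h' : ∀ t ∈ E.I, deriv E.f t = μ * E.f t) : False := by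
  obtain ⟨-, h2⟩ := affine_indep hE.interval_I.1 hE.interval_I.2.1 (a := μ)
    (c := μ * b - k) (fun t ht => by
      apply mul_left_cancel₀ (hE.f_ne_zero t ht)
      linear_combination h t ht - (t + b) * h' t ht)
  exact hμ h2

lemma not_const_of_power (hE : E.Admissible) {b k : ℝ} (hk : k ≠ 0)
    (h : ∀ t ∈ E.I, (t + b) * deriv E.f t = k * E.f t)
    (h' : ∀ t ∈ E.I, deriv E.f t = 0) : False := by
  obtain ⟨t, ht⟩ := hE.interval_I.2.1
  have := h t ht
  rw [h' t ht, mul_zero] at this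
  exact mul_ne_zero hk (hE.f_ne_zero t ht) this.symm

lemma not_const_of_exp (hE : E.Admissible) {μ : ℝ} (hμ : μ ≠ 0)
    (h : ∀ t ∈ E.I, deriv E.f t = μ * E.f t) (h' : ∀ t ∈ E.I, deriv E.f t = 0) : False := by
  obtain ⟨t, ht⟩ := hE.interval_I.2.1
  have := h t ht
  rw [h' t ht] at this
  exact mul_ne_zero hμ (hE.f_ne_zero t ht) this.symm

lemma quad_coeff_unique (hE : E.Admissible) {b b' s s' lam lam' : ℝ} (hs : s = 1 ∨ s = -1)
    (hs' : s' = 1 ∨ s' = -1) (hl : 0 < lam) (hl' : 0 < lam')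
    (h : ∀ t ∈ E.I, E.f t = s * lam * (t + b) ^ 2)
    (h' : ∀ t ∈ E.I, E.f t = s' * lam' * (t + b') ^ 2) : lam = lam' := by
  obtain ⟨-, -, h2⟩ := quad_indep hE.interval_I.1 hE.interval_I.2.1 (b := s * lam - s' * lam')
    (a := 2 * (s * lam * b - s' * lam' * b')) (c := s * lam * b ^ 2 - s' * lam' * b' ^ 2)
    (fun t ht => by linear_combination h' t ht - h t ht)
  rcases hs with rfl | rfl <;> rcases hs' with rfl | rfl <;> linarith

/-- The invariants separate the cases and their parameters. -/
lemma eq_of_invariant (hE : E.Admissible) {c c' : ExtCase} (h : c.Invariant E)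
    (h' : c'.Invariant E) : c = c' := by
  cases c with
  | c3 => cases c' with
    | c3 => rfl
    | c4 => exact absurd h'.1 h.1
    | _ => exact absurd h.2 h'.1
  | c4 => cases c' with
    | c3 => exact absurd h.1 h'.1
    | c4 => rfl
    | _ => exact absurd h.2 h'.1
  | c5 => cases c' with
    | c3 | c4 => exact absurd h'.2 h.1
    | c5 => rfl
    | c6a | c6b => exact absurd h'.2.1 h.2.1
    | c7 k' => exact (not_const_of_power hE h'.2.2.1 h'.2.2.2.choose_spec h.2.2).elim
    | c8 lam' => exact (not_const_of_power hE two_ne_zero h'.2.2.2.1.choose_spec h.2.2).elim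
    | c9 => exact (not_const_of_exp hE h'.2.2.choose_spec.1 h'.2.2.choose_spec.2 h.2.2).elim
  | c6a => cases c' with
    | c3 | c4 => exact absurd h'.2 h.1
    | c5 => exact absurd h.2.1 h'.2.1
    | c6a => rfl
    | c6b =>
      obtain ⟨t, ht⟩ := hE.interval_I.2.1
      exact (lt_asymm (h.2.2.2 t ht) (h'.2.2.2 t ht)).elim
    | c7 k' => exact (not_const_of_power hE h'.2.2.1 h'.2.2.2.choose_spec h.2.2.1).elim
    | c8 lam' => exact (not_const_of_power hE two_ne_zero h'.2.2.2.1.choose_spec h.2.2.1).elim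
    | c9 => exact (not_const_of_exp hE h'.2.2.choose_spec.1 h'.2.2.choose_spec.2 h.2.2.1).elim
  | c6b => cases c' with
    | c3 | c4 => exact absurd h'.2 h.1
    | c5 => exact absurd h.2.1 h'.2.1
    | c6a =>
      obtain ⟨t, ht⟩ := hE.interval_I.2.1
      exact (lt_asymm (h'.2.2.2 t ht) (h.2.2.2 t ht)).elim
    | c6b => rfl
    | c7 k' => exact (not_const_of_power hE h'.2.2.1 h'.2.2.2.choose_spec h.2.2.1).elim
    | c8 lam' => exact (not_const_of_power hE two_ne_zero h'.2.2.2.1.choose_spec h.2.2.1).elim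
    | c9 => exact (not_const_of_exp hE h'.2.2.choose_spec.1 h'.2.2.choose_spec.2 h.2.2.1).elim
  | c7 k =>
    obtain ⟨b, hb⟩ := h.2.2.2
    cases c' with
    | c3 | c4 => exact absurd h'.2 h.1
    | c5 => exact (not_const_of_power hE h.2.2.1 hb h'.2.2).elim
    | c6a | c6b => exact (not_const_of_power hE h.2.2.1 hb h'.2.2.1).elim
    | c7 k' => rw [power_exponent_unique hE hb h'.2.2.2.choose_spec]
    | c8 lam' => exact absurd h'.2.1 h.2.1
    | c9 => exact (not_power_of_exp hE h'.2.2.choose_spec.1 hb h'.2.2.choose_spec.2).elim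
  | c8 lam =>
    obtain ⟨b, hb⟩ := h.2.2.2.1
    obtain ⟨b₁, s, hs, hq⟩ := h.2.2.2.2
    cases c' with
    | c3 | c4 => exact absurd h'.2 h.1
    | c5 => exact (not_const_of_power hE two_ne_zero hb h'.2.2).elim
    | c6a | c6b => exact (not_const_of_power hE two_ne_zero hb h'.2.2.1).elim
    | c7 k' => exact absurd h.2.1 h'.2.1
    | c8 lam' =>
      obtain ⟨b', s', hs', hq'⟩ := h'.2.2.2.2
      rw [quad_coeff_unique hE hs hs' h.2.2.1 h'.2.2.1 hq hq']
    | c9 => exact absurd h.2.1 h'.2.1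
  | c9 =>
    obtain ⟨μ, hμ, hf⟩ := h.2.2
    cases c' with
    | c3 | c4 => exact absurd h'.2 h.1
    | c5 => exact (not_const_of_exp hE hμ hf h'.2.2).elim
    | c6a | c6b => exact (not_const_of_exp hE hμ hf h'.2.2.1).elim
    | c7 k' => exact (not_power_of_exp hE hμ h'.2.2.2.choose_spec hf).elim
    | c8 lam' => exact absurd h'.2.1 h.2.1
    | c9 => rfl

end

end KMN

end

theorem mainTheorem1 :
    -- the kernel algebra of the whole class
    (∀ I X U : Set ℝ, KMN.IsOpenInterval I → KMN.IsOpenInterval X → KMN.IsOpenInterval U →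
      (∀ u ∈ U, 0 < u) →
      KMN.IsBasisOn (I ×ˢ (X ×ˢ U))
        {V | ∀ E : KMN.Eqn, E.Admissible → E.I = I → E.X = X → E.U = U → V ∈ E.maxAlg}
        ![KMN.dx]) ∧
    -- Cases 1 and 2, arbitrary `f`: the operators admitted for all `f`, with `n, m, ε` fixed
    (∀ E : KMN.Eqn, E.Admissible → E.m ≠ 0 → E.m ≠ (E.n + 2) / 3 →
      KMN.IsBasisOn E.domain
        {V | ∀ f : ℝ → ℝ, ({E with f := f} : KMN.Eqn).Admissible →
          V ∈ ({E with f := f} : KMN.Eqn).maxAlg}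
        ![KMN.dx]) ∧
    (∀ E : KMN.Eqn, E.Admissible → E.m ≠ 0 → E.m = (E.n + 2) / 3 →
      KMN.IsBasisOn E.domain
        {V | ∀ f : ℝ → ℝ, ({E with f := f} : KMN.Eqn).Admissible →
          V ∈ ({E with f := f} : KMN.Eqn).maxAlg}
        ![KMN.dx, KMN.scal E.n]) ∧
    -- extensions of these algebras occur exactly in the listed cases, up to equivalence
    (∀ E : KMN.Eqn, E.Admissible → E.m ≠ 0 → E.m ≠ (E.n + 2) / 3 →
      (KMN.IsBasisOn E.domain E.maxAlg ![KMN.dx] ↔ ¬ ∃ c : KMN.ExtCase, E.ReducesTo c)) ∧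
    (∀ E : KMN.Eqn, E.Admissible → E.m ≠ 0 → E.m = (E.n + 2) / 3 →
      (KMN.IsBasisOn E.domain E.maxAlg ![KMN.dx, KMN.scal E.n] ↔
        ¬ ∃ c : KMN.ExtCase, E.ReducesTo c)) ∧
    (∀ E : KMN.Eqn, E.Admissible → E.m = 0 → ∃ c : KMN.ExtCase, E.ReducesTo c) ∧
    -- the maximal Lie invariance algebras in the listed cases
    (∀ (c : KMN.ExtCase) (E : KMN.Eqn), E.Admissible → c.Holds E →
      KMN.IsBasisOn E.domain E.maxAlg (c.basis E.n E.m)) ∧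
    -- the listed cases are inequivalent
    (∀ (c c' : KMN.ExtCase) (E : KMN.Eqn), E.Admissible → E.ReducesTo c → E.ReducesTo c' →
      c = c') := by
  refine ⟨fun I X U hI hX hU hpos => KMN.isBasisOn_kernel hI hX hU hpos,
    fun E hE hm hK => KMN.isBasisOn_forall_of_ne hE hm hK,
    fun E hE hm hK => KMN.isBasisOn_forall_of_eq hE hm hK, fun E hE hm hK => ?_,
    fun E hE hm hK => ?_, fun E hE hm => KMN.exists_reducesTo_of_m_eq_zero hE hm,
    fun c E hE h => KMN.isBasisOn_of_holds c hE h, fun c c' E hE h h' =>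
      KMN.eq_of_invariant hE (KMN.invariant_of_reducesTo hE h) (KMN.invariant_of_reducesTo hE h')⟩
  · rw [KMN.isBasisOn_dx_iff hE hm hK, KMN.extends_iff hE hm]
  · rw [KMN.isBasisOn_dx_scal_iff hE hm hK, KMN.extends_iff hE hm]
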